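/- Let $d\in\mathbb N$, $d\ge 1$, let $\mathbb R^d_+=(0,\infty)^d$ and $\mathbb N_0=\{0,1,2,\dots\}$. Let $\mathcal S(\mathbb R^d_+)$ be the space of all $f\in C^\infty(\mathbb R^d_+)$ such that every derivative $\partial^p f$ extends to a continuous function on $[0,\infty)^d$ and $\sup_{x\in\mathbb R^d_+}x^\beta|\partial^p f(x)|<\infty$ for all $\beta,p\in\mathbb N_0^d$. Let $$E=-\sum_{j=1}^d\Big(x_j\frac{\partial^2}{\partial x_j^2}+\frac{\partial}{\partial x_j}-\frac{x_j}{4}+\frac12\Big)$$ be the Laguerre operator. For $\alpha>0$ let $\mathbf g^\alpha_\alpha(\mathbb R^d_+)$ be the space of all $f\in\mathcal S(\mathbb R^d_+)$ such that $$\eta^\alpha_h(f)=\sup_{N\in\mathbb N_0}\frac{\|E^Nf\|_{L^2(\mathbb R^d_+)}}{h^N\,N!^{\alpha}}<\infty\qquad\text{for every } h>0,$$ with the projective limit topology, that is, the topology defined by the norms $\eta^\alpha_h$, $h>0$. For $n\in\mathbb N_0^d$ let $h_n(x)=\prod_{j=1}^d h_{n_j}(x_j)$ be the Hermite functions on $\mathbb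 R^d$, where $h_m(t)=(2^m m!\sqrt\pi)^{-1/2}e^{-t^2/2}H_m(t)$ and $H_m(t)=(-1)^m e^{t^2}\frac{d^m}{dt^m}e^{-t^2}$, and put $|n|=n_1+\dots+n_d$. For $\beta>0$ let $\ell_{0,\beta}(\mathbb N_0^d)$ be the space of all complex sequences $a=\{a_n\}_{n\in\mathbb N_0^d}$ such that $\sup_n|a_n|e^{h|n|^{1/(2\beta)}}<\infty$ for every $h>0$, with the topology defined by these norms. Let $\mathcal H_{0,\beta}(\mathbb R^d)$ be the space of all functions $\sum_{n} a_n h_n$ with $a\in\ell_{0,\beta}(\mathbb N_0^d)$, with the topology carried over from $\ell_{0,\beta}(\mathbb N_0^d)$ by the bijection $a\mapsto\sum_n a_nh_n$. Let $\mathcal H_{0,\beta,even}(\mathbb R^d)$ be the subspace, with the induced topology, of those functions in $\mathcal H_{0,\beta}(\mathbb R^d)$ that are even in each variable $x_j$, $j=1,\dots,d$. Let $v(x)=(x_1^2,\dots,x_d^2)$ for $x\in\mathbb R^d$ and $w(x)=(\sqrt{x_1},\dots,\sqrt{x_d})$ for $x\in\mathbb R^d_+$. Then, for every $\alpha>0$,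 the mapping $f\mapsto f\circ v$ (where $f$ is extended continuously to $[0,\infty)^d$) is a topological isomorphism, i.e. a linear homeomorphism, from $\mathbf g^\alpha_\alpha(\mathbb R^d_+)$ onto $\mathcal H_{0,\alpha/2,even}(\mathbb R^d)$, and its inverse is the mapping $\psi\mapsto\psi|_{\mathbb R^d_+}\circ w$. -/

import Mathlib

open Set Filter Topology MeasureTheory
open scoped ENNReal ContDiff

noncomputable section

namespace LagPil

/-! ## Sequence spaces -/

/-- The weight `θ_{h,α}(n) = exp (h |n|^{1/(2α)})` on multi-indices `n ∈ ℕ₀^d`, `|n| = ∑ n_j`. -/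
def weight {d : ℕ} (h α : ℝ) (n : Fin d → ℕ) : ℝ :=
  Real.exp (h * ((∑ j, n j : ℕ) : ℝ) ^ (1 / (2 * α)))

theorem weight_pos {d : ℕ} (h α : ℝ) (n : Fin d → ℕ) : 0 < weight h α n := Real.exp_pos _

/-- The sequences with `sup_n |a_n| θ_{h,α}(n) < ∞` for every `h > 0`, as a vector space. -/
def seqSub (d : ℕ) (α : ℝ) : Submodule ℂ ((Fin d → ℕ) → ℂ) where
  carrier := {a | ∀ h : ℝ, 0 < h → BddAbove (range fun n => ‖a n‖ * weight h α n)}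
  zero_mem' := fun h _ => ⟨0, by rintro _ ⟨n, rfl⟩; simp⟩
  add_mem' := by
    intro a b ha hb h hh
    obtain ⟨A, hA⟩ := ha h hh
    obtain ⟨B, hB⟩ := hb h hh
    refine ⟨A + B, ?_⟩
    rintro _ ⟨n, rfl⟩
    have h1 : ‖a n‖ * weight h α n ≤ A := hA ⟨n, rfl⟩
    have h2 : ‖b n‖ * weight h α n ≤ B := hB ⟨n, rfl⟩
    have h3 := mul_le_mul_of_nonneg_right (norm_add_le (a n) (b n)) (weight_pos h α n).le
    simp only [Pi.add_apply]
    linarith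
  smul_mem' := by
    intro c a ha h hh
    obtain ⟨A, hA⟩ := ha h hh
    refine ⟨‖c‖ * A, ?_⟩
    rintro _ ⟨n, rfl⟩
    have h1 : ‖a n‖ * weight h α n ≤ A := hA ⟨n, rfl⟩
    simp only [Pi.smul_apply, smul_eq_mul, norm_mul, mul_assoc]
    exact mul_le_mul_of_nonneg_left h1 (norm_nonneg c)

/-- The space `ℓ_{0,α}(ℕ₀^d) = ⋂_{h>0} ℓ^∞_{[θ_{h,α}]}(ℕ₀^d)`. -/
def SeqSpace (d : ℕ) (α : ℝ) : Type := ↥(seqSub d α)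

instance (d : ℕ) (α : ℝ) : AddCommGroup (SeqSpace d α) :=
  inferInstanceAs (AddCommGroup ↥(seqSub d α))

instance (d : ℕ) (α : ℝ) : Module ℂ (SeqSpace d α) :=
  inferInstanceAs (Module ℂ ↥(seqSub d α))

instance (d : ℕ) (α : ℝ) : CoeFun (SeqSpace d α) (fun _ => (Fin d → ℕ) → ℂ) := ⟨Subtype.val⟩

/-- The norm of `ℓ^∞_{[θ_{h,α}]}(ℕ₀^d)`, on `ℓ_{0,α}(ℕ₀^d)`. -/
def seqNorm (d : ℕ) (α : ℝ) (h : {h : ℝ // 0 < h}) : Seminorm ℂ (SeqSpace d α) :=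
  Seminorm.of (fun a => ⨆ n, ‖a n‖ * weight h.1 α n)
    (by
      intro a b
      refine ciSup_le fun n => ?_
      have h1 := le_ciSup (a.2 h.1 h.2) n
      have h2 := le_ciSup (b.2 h.1 h.2) n
      have h3 := mul_le_mul_of_nonneg_right (norm_add_le (a n) (b n)) (weight_pos h.1 α n).le
      rw [add_mul] at h3
      exact h3.trans (add_le_add h1 h2))
    (by
      intro c a
      rw [Real.mul_iSup_of_nonneg (norm_nonneg c)]
      refine iSup_congr fun n => ?_
      change ‖c * a n‖ * _ = _
      rw [norm_mul, mul_assoc])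

/-- The projective limit topology of the spaces `ℓ^∞_{[θ_{h,α}]}(ℕ₀^d)`, `h > 0`. -/
instance (d : ℕ) (α : ℝ) : TopologicalSpace (SeqSpace d α) :=
  haveI : Nonempty {h : ℝ // 0 < h} := ⟨⟨1, one_pos⟩⟩
  SeminormFamily.moduleFilterBasis (𝕜 := ℂ) (seqNorm d α) |>.topology

/-! ## Hermite functions and Pilipović spaces of Beurling type -/

/-- The Hermite polynomial `H_n(x) = (-1)^n e^{x²} (d/dx)^n e^{-x²}`. -/
def hermitePoly (n : ℕ) (x : ℝ) : ℝ :=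
  (-1) ^ n * Real.exp (x ^ 2) * iteratedDeriv n (fun t : ℝ => Real.exp (-t ^ 2)) x

/-- The Hermite function `h_n(x) = (2^n n! √π)^{-1/2} e^{-x²/2} H_n(x)`. -/
def hermiteFun (n : ℕ) (x : ℝ) : ℝ :=
  (Real.sqrt (2 ^ n * (Nat.factorial n : ℝ) * Real.sqrt Real.pi))⁻¹ * Real.exp (-x ^ 2 / 2) * hermitePoly n x

/-- The `d`-dimensional Hermite function `h_n(x) = ∏ h_{n_j}(x_j)`. -/
def hermiteFunPi {d : ℕ} (n : Fin d → ℕ) (x : Fin d → ℝ) : ℝ := ∏ j, hermiteFun (n j) (x j)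

theorem gauss_contDiff : ContDiff ℝ ∞ (fun t : ℝ => Real.exp (-t ^ 2)) := by fun_prop

theorem gauss_iter_hasDerivAt (n : ℕ) (x : ℝ) :
    HasDerivAt (iteratedDeriv n (fun t : ℝ => Real.exp (-t ^ 2)))
      (iteratedDeriv (n + 1) (fun t : ℝ => Real.exp (-t ^ 2)) x) x := by
  rw [iteratedDeriv_succ]
  exact ((gauss_contDiff.differentiable_iteratedDeriv n
    (by exact_mod_cast WithTop.coe_lt_top n)) x).hasDerivAt

theorem gauss_rec (n : ℕ) (x : ℝ) :
    iteratedDeriv (n + 2) (fun t : ℝ => Real.exp (-t ^ 2)) x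
      = -2 * x * iteratedDeriv (n + 1) (fun t : ℝ => Real.exp (-t ^ 2)) x
        - 2 * (n + 1) * iteratedDeriv n (fun t : ℝ => Real.exp (-t ^ 2)) x := by
  have h1 : ∀ y : ℝ, iteratedDeriv 1 (fun t : ℝ => Real.exp (-t ^ 2)) y
      = -2 * y * Real.exp (-y ^ 2) := by
    intro y
    rw [iteratedDeriv_one]
    have := ((hasDerivAt_pow 2 y).neg).exp
    rw [HasDerivAt.deriv (f := fun t : ℝ => Real.exp (-t ^ 2)) this]
    simp; ring
  induction n generalizing x with
  | zero =>
    have h2 := gauss_iter_hasDerivAt 1 x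
    have h3 : iteratedDeriv 1 (fun t : ℝ => Real.exp (-t ^ 2))
        = fun y => -2 * y * Real.exp (-y ^ 2) := funext h1
    have h4 : HasDerivAt (fun y : ℝ => -2 * y * Real.exp (-y ^ 2))
        (-2 * Real.exp (-x ^ 2) + -2 * x * (-2 * x * Real.exp (-x ^ 2))) x := by
      have h5 : HasDerivAt (fun y : ℝ => -2 * y) (-2) x := by
        simpa using (hasDerivAt_id x).const_mul (-2 : ℝ)
      have h6 := gauss_iter_hasDerivAt 0 x
      rw [iteratedDeriv_zero, zero_add, h1] at h6
      exact h5.mul h6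
    rw [h3] at h2
    have h7 := h2.unique h4
    simp only [zero_add, h1, iteratedDeriv_zero, Nat.cast_zero] at h7 ⊢
    linarith
  | succ n ih =>
    have h2 := gauss_iter_hasDerivAt (n + 2) x
    have h3 := funext ih
    rw [show iteratedDeriv (n + 2) (fun t : ℝ => Real.exp (-t ^ 2)) = _ from h3] at h2
    have h4 : HasDerivAt (fun y : ℝ => -2 * y) (-2) x := by
      simpa using (hasDerivAt_id x).const_mul (-2 : ℝ)
    have h5 := (h4.mul (gauss_iter_hasDerivAt (n + 1) x)).sub
      ((gauss_iter_hasDerivAt n x).const_mul (2 * ((n : ℝ) + 1)))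
    have h6 := h2.unique h5
    have h7 : n + 1 + 2 = n + 2 + 1 := by ring
    rw [h7, h6]
    push_cast
    ring

theorem hermitePoly_rec (n : ℕ) (x : ℝ) :
    hermitePoly (n + 2) x = 2 * x * hermitePoly (n + 1) x - 2 * (n + 1) * hermitePoly n x := by
  unfold hermitePoly
  rw [gauss_rec]
  ring

theorem hermitePoly_hasDerivAt (n : ℕ) (x : ℝ) :
    HasDerivAt (hermitePoly n) (2 * x * hermitePoly n x - hermitePoly (n + 1) x) x := by
  have h1 : HasDerivAt (fun t : ℝ => Real.exp (t ^ 2)) (Real.exp (x ^ 2) * (2 * x)) x := by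
    simpa using (hasDerivAt_pow 2 x).exp
  have h2 := (h1.const_mul ((-1 : ℝ) ^ n)).mul (gauss_iter_hasDerivAt n x)
  refine h2.congr_deriv ?_
  simp only [hermitePoly]
  ring

theorem hermitePoly_zero (x : ℝ) : hermitePoly 0 x = 1 := by
  simp [hermitePoly, ← Real.exp_add]

theorem hermitePoly_one (x : ℝ) : hermitePoly 1 x = 2 * x := by
  have h := hermitePoly_hasDerivAt 0 x
  have h0 : hermitePoly 0 = fun _ => 1 := funext hermitePoly_zero
  rw [h0] at h
  have h2 := h.unique (hasDerivAt_const x (1 : ℝ))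
  simp only [mul_one, zero_add] at h2
  linarith

theorem hermitePoly_at_zero (n : ℕ) : hermitePoly n 0 ^ 2 ≤ 2 ^ n * (Nat.factorial n : ℝ) := by
  induction n using Nat.twoStepInduction with
  | zero => simp [hermitePoly_zero]
  | one => simp [hermitePoly_one]
  | more n ih _ =>
    rw [hermitePoly_rec]
    have h1 : (Nat.factorial (n + 2) : ℝ) = (n + 2) * ((n + 1) * (Nat.factorial n : ℝ)) := by
      rw [Nat.factorial_succ, Nat.factorial_succ]; push_cast; ring
    rw [h1]
    have h2 : (0 : ℝ) ≤ 2 ^ n * (Nat.factorial n : ℝ) := by positivity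
    have h3 : (0 : ℝ) ≤ n := n.cast_nonneg
    have h4 := mul_le_mul_of_nonneg_left ih (by positivity : (0 : ℝ) ≤ 4 * ((n : ℝ) + 1) ^ 2)
    have h5 : (0 : ℝ) ≤ (n + 1) * (2 ^ n * (Nat.factorial n : ℝ)) := by positivity
    have h6 : (2 : ℝ) ^ (n + 2) = 4 * 2 ^ n := by ring
    rw [h6]
    nlinarith

/-- Monotonicity of `u'² + (2n + 1 - x²) u²`, where `u = e^{-x²/2} H_n`, on both sides of the origin. -/
theorem hermite_energy (n : ℕ) (x : ℝ) (hx : x ^ 2 ≤ 2 * n) :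
    (Real.exp (-x ^ 2 / 2) * hermitePoly n x) ^ 2 ≤ 2 ^ n * (Nat.factorial n : ℝ) * (4 * n + 3) := by
  set u : ℕ → ℝ → ℝ := fun m y => Real.exp (-y ^ 2 / 2) * hermitePoly m y with hu
  have hd : ∀ m y, HasDerivAt (u m) (y * u m y - u (m + 1) y) y := by
    intro m y
    have h1 : HasDerivAt (fun t : ℝ => Real.exp (-t ^ 2 / 2)) (Real.exp (-y ^ 2 / 2) * (-y)) y := by
      have h0 : HasDerivAt (fun t : ℝ => -t ^ 2 / 2) (-y) y := by
        refine (((hasDerivAt_pow 2 y).fun_neg).div_const 2).congr_deriv ?_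
        push_cast
        ring
      exact h0.exp
    refine (h1.mul (hermitePoly_hasDerivAt m y)).congr_deriv ?_
    change _ = y * (Real.exp (-y ^ 2 / 2) * hermitePoly m y)
      - Real.exp (-y ^ 2 / 2) * hermitePoly (m + 1) y
    ring
  have hr : ∀ y, u (n + 1 + 1) y = 2 * y * u (n + 1) y - 2 * (n + 1) * u n y := by
    intro y
    change _ * hermitePoly (n + 2) y = 2 * y * (_ * _) - 2 * (n + 1) * (_ * _)
    rw [hermitePoly_rec]; ring
  set S : ℝ → ℝ := fun y => (y * u n y - u (n + 1) y) ^ 2 + (2 * n + 1 - y ^ 2) * u n y ^ 2 with hS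
  have hSd : ∀ y, HasDerivAt S (-2 * y * u n y ^ 2) y := by
    intro y
    have e1 := (((hasDerivAt_id' y).fun_mul (hd n y)).fun_sub (hd (n + 1) y)).fun_pow 2
    have e2 := ((hasDerivAt_pow 2 y).const_sub (2 * (n : ℝ) + 1)).fun_mul ((hd n y).fun_pow 2)
    refine (e1.fun_add e2).congr_deriv ?_
    rw [hr]
    push_cast
    ring
  have hSc : Continuous S := continuous_iff_continuousAt.2 fun y => (hSd y).continuousAt
  have hle : S x ≤ S 0 := by
    rcases le_total 0 x with h | h
    · refine antitoneOn_of_deriv_nonpos (convex_Ici 0) hSc.continuousOn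
        (fun y _ => (hSd y).differentiableAt.differentiableWithinAt) ?_ (mem_Ici.2 le_rfl) h h
      intro y hy
      rw [interior_Ici, mem_Ioi] at hy
      rw [(hSd y).deriv]
      nlinarith [sq_nonneg (u n y), mul_nonneg hy.le (sq_nonneg (u n y))]
    · refine monotoneOn_of_deriv_nonneg (convex_Iic 0) hSc.continuousOn
        (fun y _ => (hSd y).differentiableAt.differentiableWithinAt) ?_ h (mem_Iic.2 le_rfl) h
      intro y hy
      rw [interior_Iic, mem_Iio] at hy
      rw [(hSd y).deriv]
      nlinarith [sq_nonneg (u n y), mul_nonneg (neg_nonneg.2 hy.le) (sq_nonneg (u n y))]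
  have h0 : S 0 ≤ 2 ^ n * (Nat.factorial n : ℝ) * (4 * n + 3) := by
    have h1 := hermitePoly_at_zero n
    have h2 := hermitePoly_at_zero (n + 1)
    have h3 : (Nat.factorial (n + 1) : ℝ) = (n + 1) * (Nat.factorial n : ℝ) := by
      rw [Nat.factorial_succ]; push_cast; ring
    rw [h3, pow_succ (2 : ℝ)] at h2
    have h4 := mul_le_mul_of_nonneg_left h1 (by positivity : (0 : ℝ) ≤ 2 * n + 1)
    simp only [hS, hu]
    norm_num
    nlinarith
  have h5 : u n x ^ 2 ≤ S x := by
    simp only [hS]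
    nlinarith [sq_nonneg (x * u n x - u (n + 1) x), mul_nonneg (sub_nonneg.2 hx)
      (sq_nonneg (u n x))]
  exact h5.trans (hle.trans h0)

theorem hermiteFun_bound (x : ℝ) : ∃ C : ℝ, 0 ≤ C ∧ ∀ n : ℕ, |hermiteFun n x| ≤ C * (n + 1) := by
  have key : ∀ n : ℕ, x ^ 2 ≤ 2 * n → |hermiteFun n x| ≤ 2 * (n + 1) := by
    intro n hn
    have h1 := hermite_energy n x hn
    refine abs_le_of_sq_le_sq ?_ (by positivity)
    set A : ℝ := 2 ^ n * (Nat.factorial n : ℝ) with hA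
    have hApos : 0 < A := by positivity
    have hpi : 1 ≤ Real.sqrt Real.pi := by
      rw [Real.one_le_sqrt]; linarith [Real.pi_gt_three]
    have h2 : hermiteFun n x ^ 2
        = (A * Real.sqrt Real.pi)⁻¹ * (Real.exp (-x ^ 2 / 2) * hermitePoly n x) ^ 2 := by
      unfold hermiteFun
      rw [mul_assoc, mul_pow, inv_pow, Real.sq_sqrt (by positivity)]
    rw [h2, inv_mul_le_iff₀ (by positivity)]
    refine h1.trans ?_
    have h3 : A ≤ A * Real.sqrt Real.pi := le_mul_of_one_le_right hApos.le hpi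
    have h4 : (0 : ℝ) ≤ n := n.cast_nonneg
    refine mul_le_mul h3 (by nlinarith) (by positivity) (by positivity)
  obtain ⟨K, hK⟩ := exists_nat_ge (x ^ 2)
  have hC : 0 ≤ ∑ i ∈ Finset.range K, |hermiteFun i x| := Finset.sum_nonneg fun _ _ => abs_nonneg _
  refine ⟨2 + ∑ i ∈ Finset.range K, |hermiteFun i x|, by positivity, fun n => ?_⟩
  have hn0 : (0 : ℝ) ≤ n := n.cast_nonneg
  by_cases hn : n < K
  · have h1 := Finset.single_le_sum (f := fun i => |hermiteFun i x|) (fun _ _ => abs_nonneg _)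
      (Finset.mem_range.2 hn)
    nlinarith
  · have h1 : (K : ℝ) ≤ n := by exact_mod_cast not_lt.1 hn
    have h2 := key n (by linarith)
    nlinarith

theorem weight_bound (α : ℝ) (hα : 0 < α) (k : ℕ) :
    ∃ C : ℝ, 0 ≤ C ∧ ∀ m : ℕ, ((m : ℝ) + 1) ^ k ≤ C * Real.exp ((m : ℝ) ^ (1 / (2 * α))) := by
  set γ : ℝ := 1 / (2 * α) with hγ
  have hγ0 : 0 < γ := by positivity
  have h1 : Tendsto (fun m : ℕ => (m : ℝ) ^ γ) atTop atTop :=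
    (tendsto_rpow_atTop hγ0).comp tendsto_natCast_atTop_atTop
  have h2 := ((isLittleO_rpow_exp_pos_mul_atTop ((k : ℝ) / γ) one_pos).comp_tendsto h1).bound
    (one_pos)
  obtain ⟨M, hM⟩ := eventually_atTop.1 h2
  refine ⟨2 ^ k + ∑ i ∈ Finset.range (M + 1), ((i : ℝ) + 1) ^ k, by positivity, fun m => ?_⟩
  have hs : 0 ≤ ∑ i ∈ Finset.range (M + 1), ((i : ℝ) + 1) ^ k :=
    Finset.sum_nonneg fun _ _ => by positivity
  have he : 1 ≤ Real.exp ((m : ℝ) ^ γ) := Real.one_le_exp (by positivity)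
  by_cases hm : m < M + 1
  · have h3 := Finset.single_le_sum (f := fun i : ℕ => ((i : ℝ) + 1) ^ k)
      (fun _ _ => by positivity) (Finset.mem_range.2 hm)
    have h4 : (0 : ℝ) ≤ 2 ^ k := by positivity
    nlinarith
  · have hmM : M + 1 ≤ m := not_lt.1 hm
    have h3 := hM m (by omega)
    have hm1 : (1 : ℝ) ≤ m := by exact_mod_cast (by omega : 1 ≤ m)
    simp only [Function.comp, one_mul, Real.norm_eq_abs, Real.abs_exp] at h3
    rw [← Real.rpow_mul (by positivity), mul_div_cancel₀ _ hγ0.ne', Real.rpow_natCast,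
      abs_of_nonneg (by positivity)] at h3
    calc ((m : ℝ) + 1) ^ k ≤ (2 * m) ^ k := by gcongr; linarith
      _ = 2 ^ k * (m : ℝ) ^ k := mul_pow _ _ _
      _ ≤ 2 ^ k * Real.exp ((m : ℝ) ^ γ) := by gcongr
      _ ≤ _ := by gcongr; linarith

theorem summable_pi_inv (d : ℕ) :
    Summable fun n : Fin d → ℕ => ∏ j, (((n j : ℝ) + 1) ^ 2)⁻¹ := by
  have h1 : Summable fun m : ℕ => (((m : ℝ) + 1) ^ 2)⁻¹ := by
    have := (summable_nat_add_iff (f := fun m : ℕ => ((m : ℝ) ^ 2)⁻¹) 1).2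
      (Real.summable_nat_pow_inv.2 one_lt_two)
    simpa using this
  refine summable_of_sum_le (c := (∑' m : ℕ, (((m : ℝ) + 1) ^ 2)⁻¹) ^ d)
    (fun n => Finset.prod_nonneg fun j _ => by positivity) fun s => ?_
  obtain ⟨M, hM⟩ : ∃ M : ℕ, ∀ n ∈ s, ∀ j, n j < M := by
    refine ⟨(s.sup fun n => ∑ j, n j) + 1, fun n hn j => Nat.lt_succ_of_le ?_⟩
    exact (Finset.single_le_sum (f := n) (fun _ _ => Nat.zero_le _) (Finset.mem_univ j)).trans
      (Finset.le_sup (f := fun n : Fin d → ℕ => ∑ j, n j) hn)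
  calc ∑ n ∈ s, ∏ j, (((n j : ℝ) + 1) ^ 2)⁻¹
      ≤ ∑ n ∈ Fintype.piFinset (fun _ : Fin d => Finset.range M), ∏ j, (((n j : ℝ) + 1) ^ 2)⁻¹ := by
        refine Finset.sum_le_sum_of_subset_of_nonneg ?_
          fun _ _ _ => Finset.prod_nonneg fun j _ => by positivity
        intro n hn
        rw [Fintype.mem_piFinset]
        exact fun j => Finset.mem_range.2 (hM n hn j)
    _ = ∏ _j : Fin d, ∑ m ∈ Finset.range M, (((m : ℝ) + 1) ^ 2)⁻¹ :=
        (Finset.prod_univ_sum (fun _ : Fin d => Finset.range M)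
          (fun _ m => (((m : ℝ) + 1) ^ 2)⁻¹)).symm
    _ ≤ ∏ _j : Fin d, ∑' m : ℕ, (((m : ℝ) + 1) ^ 2)⁻¹ := by
        refine Finset.prod_le_prod (fun _ _ => Finset.sum_nonneg fun _ _ => by positivity)
          fun _ _ => h1.sum_le_tsum _ (fun _ _ => by positivity)
    _ = _ := by simp

/-- The Hermite series of a sequence in `ℓ_{0,α}(ℕ₀^d)` converges absolutely at every point. -/
theorem hermite_summable {d : ℕ} {α : ℝ} (hα : 0 < α) (a : SeqSpace d α) (x : Fin d → ℝ) :
    Summable fun n => a n * (hermiteFunPi n x : ℂ) := by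
  choose C hC0 hC using fun j => hermiteFun_bound (x j)
  obtain ⟨W, hW0, hW⟩ := weight_bound α hα (3 * d)
  obtain ⟨A, hA⟩ := a.2 1 one_pos
  have hP : 0 ≤ ∏ j, C j := Finset.prod_nonneg fun j _ => hC0 j
  refine Summable.of_norm_bounded ((summable_pi_inv d).mul_left (A * W * ∏ j, C j)) fun n => ?_
  have h1 : ‖(hermiteFunPi n x : ℂ)‖ ≤ (∏ j, C j) * ∏ j, ((n j : ℝ) + 1) := by
    rw [Complex.norm_real, Real.norm_eq_abs, hermiteFunPi, Finset.abs_prod,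
      ← Finset.prod_mul_distrib]
    exact Finset.prod_le_prod (fun _ _ => abs_nonneg _) fun j _ => hC j (n j)
  have h2 : ‖a n‖ * weight 1 α n ≤ A := hA ⟨n, rfl⟩
  have h3 : ∏ j, ((n j : ℝ) + 1) ^ 3 ≤ W * weight 1 α n := by
    have h4 := hW (∑ j, n j)
    rw [weight, one_mul]
    refine le_trans ?_ h4
    calc ∏ j, ((n j : ℝ) + 1) ^ 3 ≤ ∏ _j : Fin d, (((∑ j, n j : ℕ) : ℝ) + 1) ^ 3 := by
          refine Finset.prod_le_prod (fun _ _ => by positivity) fun j _ => ?_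
          have : n j ≤ ∑ j, n j :=
            Finset.single_le_sum (f := n) (fun _ _ => Nat.zero_le _) (Finset.mem_univ j)
          have : (n j : ℝ) ≤ ((∑ j, n j : ℕ) : ℝ) := by exact_mod_cast this
          gcongr
      _ = _ := by rw [Finset.prod_const, Finset.card_univ, Fintype.card_fin, ← pow_mul]
  have hw := weight_pos 1 α n
  have hn : 0 ≤ ‖a n‖ := norm_nonneg _
  have h5 : ‖a n‖ * ∏ j, ((n j : ℝ) + 1) ^ 3 ≤ A * W :=
    calc ‖a n‖ * ∏ j, ((n j : ℝ) + 1) ^ 3 ≤ ‖a n‖ * (W * weight 1 α n) := by gcongr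
      _ = (‖a n‖ * weight 1 α n) * W := by ring
      _ ≤ A * W := by gcongr
  have h6 : ∏ j, ((n j : ℝ) + 1)
      = (∏ j, ((n j : ℝ) + 1) ^ 3) * ∏ j, (((n j : ℝ) + 1) ^ 2)⁻¹ := by
    rw [← Finset.prod_mul_distrib]
    refine Finset.prod_congr rfl fun j _ => ?_
    have : (n j : ℝ) + 1 ≠ 0 := by positivity
    field_simp
  have hq : 0 ≤ ∏ j, (((n j : ℝ) + 1) ^ 2)⁻¹ := Finset.prod_nonneg fun j _ => by positivity
  rw [norm_mul]
  calc ‖a n‖ * ‖(hermiteFunPi n x : ℂ)‖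
      ≤ ‖a n‖ * ((∏ j, C j) * ∏ j, ((n j : ℝ) + 1)) := by gcongr
    _ = (∏ j, C j) * (‖a n‖ * ∏ j, ((n j : ℝ) + 1) ^ 3) * ∏ j, (((n j : ℝ) + 1) ^ 2)⁻¹ := by
        rw [h6]; ring
    _ ≤ (∏ j, C j) * (A * W) * ∏ j, (((n j : ℝ) + 1) ^ 2)⁻¹ := by gcongr
    _ = _ := by ring

/-- The map `T_h : a ↦ ∑ a_n h_n` from `ℓ_{0,α}(ℕ₀^d)` to functions on `ℝ^d`. -/
def hermiteSeries (d : ℕ) (α : ℝ) (hα : 0 < α) : SeqSpace d α →ₗ[ℂ] ((Fin d → ℝ) → ℂ) where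
  toFun a x := ∑' n, a n * (hermiteFunPi n x : ℂ)
  map_add' a b := by
    funext x
    rw [Pi.add_apply, ← (hermite_summable hα a x).tsum_add (hermite_summable hα b x)]
    exact tsum_congr fun n => add_mul _ _ _
  map_smul' c a := by
    funext x
    rw [Pi.smul_apply, smul_eq_mul, RingHom.id_apply, ← tsum_mul_left]
    exact tsum_congr fun n => mul_assoc _ _ _

/-- The Pilipović space `ℋ_{0,α}(ℝ^d)` of all functions `∑ a_n h_n` with `a ∈ ℓ_{0,α}(ℕ₀^d)`. -/
def PilipovicSpace (d : ℕ) (α : ℝ) (hα : 0 < α) : Type :=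
  ↥(LinearMap.range (hermiteSeries d α hα))

instance (d : ℕ) (α : ℝ) (hα : 0 < α) : AddCommGroup (PilipovicSpace d α hα) :=
  inferInstanceAs (AddCommGroup ↥(LinearMap.range (hermiteSeries d α hα)))

instance (d : ℕ) (α : ℝ) (hα : 0 < α) : Module ℂ (PilipovicSpace d α hα) :=
  inferInstanceAs (Module ℂ ↥(LinearMap.range (hermiteSeries d α hα)))

instance (d : ℕ) (α : ℝ) (hα : 0 < α) :
    CoeFun (PilipovicSpace d α hα) (fun _ => (Fin d → ℝ) → ℂ) := ⟨Subtype.val⟩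

/-- The topology carried over from `ℓ_{0,α}(ℕ₀^d)` by `T_h`. -/
instance (d : ℕ) (α : ℝ) (hα : 0 < α) : TopologicalSpace (PilipovicSpace d α hα) :=
  TopologicalSpace.coinduced
    (fun a => (⟨hermiteSeries d α hα a, a, rfl⟩ : PilipovicSpace d α hα)) inferInstance

/-- `ℋ_{0,α,even}(ℝ^d)`: the functions in `ℋ_{0,α}(ℝ^d)` that are even in each variable, with the
subspace topology. -/
def evenPilipovic (d : ℕ) (α : ℝ) (hα : 0 < α) : Submodule ℂ (PilipovicSpace d α hα) where
  carrier := {f | ∀ (x : Fin d → ℝ) (j : Fin d), f (Function.update x j (-x j)) = f x}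
  zero_mem' := fun _ _ => rfl
  add_mem' := fun hf hg x j => congrArg₂ (· + ·) (hf x j) (hg x j)
  smul_mem' := fun c _ hf x j => congrArg (c * ·) (hf x j)

/-! ## The Laguerre operator and the spaces on the orthant -/

/-- The open orthant `ℝ^d_+ = (0,∞)^d`. -/
def orthant (d : ℕ) : Set (Fin d → ℝ) := {x | ∀ j, 0 < x j}

/-- The closed orthant `[0,∞)^d`. -/
def closedOrthant (d : ℕ) : Set (Fin d → ℝ) := {x | ∀ j, 0 ≤ x j}

theorem isOpen_orthant (d : ℕ) : IsOpen (orthant d) := by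
  have : orthant d = ⋂ j, {x | 0 < x j} := by ext; simp [orthant]
  rw [this]
  exact isOpen_iInter_of_finite fun j => isOpen_lt continuous_const (continuous_apply j)

/-- Extension by zero of a function on `ℝ^d_+` to `ℝ^d`. It is only used so that derivatives can be
taken at points of the open set `ℝ^d_+`, where they do not depend on the extension. -/
def zeroExt (d : ℕ) : (↥(orthant d) → ℂ) →ₗ[ℂ] ((Fin d → ℝ) → ℂ) :=
  Function.ExtendByZero.linearMap ℂ Subtype.val

/-- The value at a point of the closed orthant of the continuous extension of `f`. -/
def closedExt {d : ℕ} (f : ↥(orthant d) → ℂ) : (Fin d → ℝ) → ℂ :=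
  extendFrom (orthant d) (zeroExt d f)

/-- `∂F/∂x_j`. -/
def partialD {d : ℕ} (j : Fin d) (F : (Fin d → ℝ) → ℂ) (x : Fin d → ℝ) : ℂ :=
  fderiv ℝ F x (Pi.single j 1)

/-- The Laguerre operator `E F = - ∑_j (x_j ∂_j² F + ∂_j F - (x_j / 4) F + (1/2) F)`. -/
def laguerreOp {d : ℕ} (F : (Fin d → ℝ) → ℂ) (x : Fin d → ℝ) : ℂ :=
  -∑ j, ((x j : ℂ) * partialD j (partialD j F) x + partialD j F x - (x j : ℂ) / 4 * F x
    + 1 / 2 * F x)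

/-- `f ∈ 𝒮(ℝ^d_+)`: `f` is smooth on `ℝ^d_+`, every derivative of `f` extends continuously to the
closed orthant, and `sup x^β |∂^p f(x)| < ∞` for all `β`, `p`. The total derivative of order `m`
stands for all partial derivatives of order `m`. -/
structure IsOrthantSchwartz {d : ℕ} (f : ↥(orthant d) → ℂ) : Prop where
  smooth : ContDiffOn ℝ ∞ (zeroExt d f) (orthant d)
  extends_cont : ∀ m : ℕ, ∃ G : (Fin d → ℝ) → ((Fin d → ℝ) [×m]→L[ℝ] ℂ),
    ContinuousOn G (closedOrthant d) ∧ EqOn G (iteratedFDeriv ℝ m (zeroExt d f)) (orthant d)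
  decay : ∀ (m : ℕ) (β : Fin d → ℕ), ∃ C : ℝ, ∀ x ∈ orthant d,
    (∏ j, x j ^ β j) * ‖iteratedFDeriv ℝ m (zeroExt d f) x‖ ≤ C

/-- `η_h^α(f) = sup_{N ≥ 0} ‖E^N f‖_{L²(ℝ^d_+)} / (h^N N!^α)`, with values in `[0,∞]`. -/
def eta {d : ℕ} (α h : ℝ) (f : ↥(orthant d) → ℂ) : ℝ≥0∞ :=
  ⨆ N : ℕ, eLpNorm (laguerreOp^[N] (zeroExt d f)) 2 (volume.restrict (orthant d))
    / ENNReal.ofReal (h ^ N * (Nat.factorial N : ℝ) ^ α)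

theorem IsOrthantSchwartz.zero (d : ℕ) : IsOrthantSchwartz (0 : ↥(orthant d) → ℂ) := by
  have h0 : zeroExt d 0 = 0 := map_zero _
  refine ⟨?_, fun m => ⟨0, continuousOn_const, ?_⟩, fun m β => ⟨0, fun x _ => ?_⟩⟩
  · rw [h0]; exact contDiffOn_const
  · intro x _
    rw [h0, iteratedFDeriv_zero]
  · rw [h0, iteratedFDeriv_zero]; simp

theorem IsOrthantSchwartz.contDiffAt {d : ℕ} {f : ↥(orthant d) → ℂ} (hf : IsOrthantSchwartz f)
    {x : Fin d → ℝ} (hx : x ∈ orthant d) (m : ℕ) : ContDiffAt ℝ m (zeroExt d f) x :=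
  ((hf.smooth x hx).contDiffAt ((isOpen_orthant d).mem_nhds hx)).of_le
    (by exact_mod_cast le_top)

theorem prod_pow_nonneg {d : ℕ} {x : Fin d → ℝ} (hx : x ∈ orthant d) (β : Fin d → ℕ) :
    0 ≤ ∏ j, x j ^ β j := Finset.prod_nonneg fun j _ => pow_nonneg (hx j).le _

theorem IsOrthantSchwartz.add {d : ℕ} {f g : ↥(orthant d) → ℂ} (hf : IsOrthantSchwartz f)
    (hg : IsOrthantSchwartz g) : IsOrthantSchwartz (f + g) := by
  have h0 : zeroExt d (f + g) = zeroExt d f + zeroExt d g := map_add _ _ _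
  have key : ∀ m : ℕ, ∀ x ∈ orthant d, iteratedFDeriv ℝ m (zeroExt d (f + g)) x
      = iteratedFDeriv ℝ m (zeroExt d f) x + iteratedFDeriv ℝ m (zeroExt d g) x := by
    intro m x hx
    rw [h0]
    exact iteratedFDeriv_add_apply (hf.contDiffAt hx m) (hg.contDiffAt hx m)
  refine ⟨by rw [h0]; exact hf.smooth.add hg.smooth, fun m => ?_, fun m β => ?_⟩
  · obtain ⟨F, hF, hF'⟩ := hf.extends_cont m
    obtain ⟨G, hG, hG'⟩ := hg.extends_cont m
    refine ⟨F + G, hF.add hG, fun x hx => ?_⟩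
    rw [key m x hx, Pi.add_apply, hF' hx, hG' hx]
  · obtain ⟨A, hA⟩ := hf.decay m β
    obtain ⟨B, hB⟩ := hg.decay m β
    refine ⟨A + B, fun x hx => ?_⟩
    rw [key m x hx]
    have h1 := mul_le_mul_of_nonneg_left (norm_add_le (iteratedFDeriv ℝ m (zeroExt d f) x)
      (iteratedFDeriv ℝ m (zeroExt d g) x)) (prod_pow_nonneg hx β)
    linarith [hA x hx, hB x hx]

theorem IsOrthantSchwartz.smul {d : ℕ} {f : ↥(orthant d) → ℂ} (c : ℂ)
    (hf : IsOrthantSchwartz f) : IsOrthantSchwartz (c • f) := by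
  have h0 : zeroExt d (c • f) = c • zeroExt d f := map_smul _ _ _
  have key : ∀ m : ℕ, ∀ x ∈ orthant d, iteratedFDeriv ℝ m (zeroExt d (c • f)) x
      = c • iteratedFDeriv ℝ m (zeroExt d f) x := by
    intro m x hx
    rw [h0]
    exact iteratedFDeriv_const_smul_apply (hf.contDiffAt hx m)
  refine ⟨by rw [h0]; exact hf.smooth.const_smul c, fun m => ?_, fun m β => ?_⟩
  · obtain ⟨F, hF, hF'⟩ := hf.extends_cont m
    refine ⟨c • F, hF.const_smul c, fun x hx => ?_⟩
    rw [key m x hx, Pi.smul_apply, hF' hx]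
  · obtain ⟨A, hA⟩ := hf.decay m β
    refine ⟨‖c‖ * A, fun x hx => ?_⟩
    rw [key m x hx, norm_smul, mul_left_comm]
    exact mul_le_mul_of_nonneg_left (hA x hx) (norm_nonneg c)

theorem partialD_contDiffOn {d : ℕ} (j : Fin d) {F : (Fin d → ℝ) → ℂ}
    (hF : ContDiffOn ℝ ∞ F (orthant d)) : ContDiffOn ℝ ∞ (partialD j F) (orthant d) :=
  (hF.fderiv_of_isOpen (isOpen_orthant d) (by simp)).clm_apply contDiffOn_const

theorem laguerreOp_contDiffOn {d : ℕ} {F : (Fin d → ℝ) → ℂ}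
    (hF : ContDiffOn ℝ ∞ F (orthant d)) : ContDiffOn ℝ ∞ (laguerreOp F) (orthant d) := by
  have hc : ∀ j : Fin d, ContDiffOn ℝ ∞ (fun x : Fin d → ℝ => (x j : ℂ)) (orthant d) :=
    fun j => (Complex.ofRealCLM.contDiff.comp (contDiff_apply ℝ ℝ j)).contDiffOn
  refine ContDiffOn.neg (ContDiffOn.sum fun j _ => ?_)
  exact ((((hc j).mul (partialD_contDiffOn j (partialD_contDiffOn j hF))).add
    (partialD_contDiffOn j hF)).sub (((hc j).div_const 4).mul hF)).add (contDiffOn_const.mul hF)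

theorem laguerreOp_iter_contDiffOn {d : ℕ} {F : (Fin d → ℝ) → ℂ}
    (hF : ContDiffOn ℝ ∞ F (orthant d)) (N : ℕ) :
    ContDiffOn ℝ ∞ (laguerreOp^[N] F) (orthant d) := by
  induction N with
  | zero => exact hF
  | succ N ih => rw [Function.iterate_succ_apply']; exact laguerreOp_contDiffOn ih

theorem differentiableAt_of_smooth {d : ℕ} {F : (Fin d → ℝ) → ℂ}
    (hF : ContDiffOn ℝ ∞ F (orthant d)) {x : Fin d → ℝ} (hx : x ∈ orthant d) :
    DifferentiableAt ℝ F x :=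
  (hF.differentiableOn (by simp)).differentiableAt ((isOpen_orthant d).mem_nhds hx)

theorem partialD_congr {d : ℕ} (j : Fin d) {F G : (Fin d → ℝ) → ℂ} (h : EqOn F G (orthant d)) :
    EqOn (partialD j F) (partialD j G) (orthant d) := by
  intro x hx
  unfold partialD
  rw [(h.eventuallyEq_of_mem ((isOpen_orthant d).mem_nhds hx)).fderiv_eq]

theorem laguerreOp_congr {d : ℕ} {F G : (Fin d → ℝ) → ℂ} (h : EqOn F G (orthant d)) :
    EqOn (laguerreOp F) (laguerreOp G) (orthant d) := by
  intro x hx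
  unfold laguerreOp
  simp only [partialD_congr _ (partialD_congr _ h) hx, partialD_congr _ h hx, h hx]

theorem partialD_add {d : ℕ} (j : Fin d) {F G : (Fin d → ℝ) → ℂ}
    (hF : ContDiffOn ℝ ∞ F (orthant d)) (hG : ContDiffOn ℝ ∞ G (orthant d)) :
    EqOn (partialD j (F + G)) (partialD j F + partialD j G) (orthant d) := by
  intro x hx
  simp only [partialD, Pi.add_apply]
  rw [fderiv_add (differentiableAt_of_smooth hF hx) (differentiableAt_of_smooth hG hx)]
  rfl

theorem partialD_smul {d : ℕ} (j : Fin d) (c : ℂ) {F : (Fin d → ℝ) → ℂ}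
    (hF : ContDiffOn ℝ ∞ F (orthant d)) :
    EqOn (partialD j (c • F)) (c • partialD j F) (orthant d) := by
  intro x hx
  simp only [partialD, Pi.smul_apply]
  rw [fderiv_const_smul (differentiableAt_of_smooth hF hx)]
  rfl

theorem laguerreOp_add {d : ℕ} {F G : (Fin d → ℝ) → ℂ}
    (hF : ContDiffOn ℝ ∞ F (orthant d)) (hG : ContDiffOn ℝ ∞ G (orthant d)) :
    EqOn (laguerreOp (F + G)) (laguerreOp F + laguerreOp G) (orthant d) := by
  intro x hx
  have h2 : ∀ j, partialD j (partialD j (F + G)) x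
      = partialD j (partialD j F) x + partialD j (partialD j G) x := fun j =>
    (partialD_congr j (partialD_add j hF hG) hx).trans
      (partialD_add j (partialD_contDiffOn j hF) (partialD_contDiffOn j hG) hx)
  have h1 : ∀ j, partialD j (F + G) x = partialD j F x + partialD j G x :=
    fun j => partialD_add j hF hG hx
  simp only [laguerreOp, Pi.add_apply, h1, h2]
  rw [← neg_add, ← Finset.sum_add_distrib]
  congr 1
  exact Finset.sum_congr rfl fun j _ => by ring

theorem laguerreOp_smul {d : ℕ} (c : ℂ) {F : (Fin d → ℝ) → ℂ}
    (hF : ContDiffOn ℝ ∞ F (orthant d)) :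
    EqOn (laguerreOp (c • F)) (c • laguerreOp F) (orthant d) := by
  intro x hx
  have h2 : ∀ j, partialD j (partialD j (c • F)) x = c * partialD j (partialD j F) x := fun j =>
    (partialD_congr j (partialD_smul j c hF) hx).trans
      (partialD_smul j c (partialD_contDiffOn j hF) hx)
  have h1 : ∀ j, partialD j (c • F) x = c * partialD j F x := fun j => partialD_smul j c hF hx
  simp only [laguerreOp, Pi.smul_apply, smul_eq_mul, h1, h2]
  rw [mul_neg, Finset.mul_sum]
  congr 1
  exact Finset.sum_congr rfl fun j _ => by ring

theorem laguerreOp_iter_add {d : ℕ} {F G : (Fin d → ℝ) → ℂ}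
    (hF : ContDiffOn ℝ ∞ F (orthant d)) (hG : ContDiffOn ℝ ∞ G (orthant d)) (N : ℕ) :
    EqOn (laguerreOp^[N] (F + G)) (laguerreOp^[N] F + laguerreOp^[N] G) (orthant d) := by
  induction N with
  | zero => exact fun _ _ => rfl
  | succ N ih =>
    simp only [Function.iterate_succ_apply']
    exact (laguerreOp_congr ih).trans (laguerreOp_add (laguerreOp_iter_contDiffOn hF N)
      (laguerreOp_iter_contDiffOn hG N))

theorem laguerreOp_iter_smul {d : ℕ} (c : ℂ) {F : (Fin d → ℝ) → ℂ}
    (hF : ContDiffOn ℝ ∞ F (orthant d)) (N : ℕ) :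
    EqOn (laguerreOp^[N] (c • F)) (c • laguerreOp^[N] F) (orthant d) := by
  induction N with
  | zero => exact fun _ _ => rfl
  | succ N ih =>
    simp only [Function.iterate_succ_apply']
    exact (laguerreOp_congr ih).trans (laguerreOp_smul c (laguerreOp_iter_contDiffOn hF N))

theorem aestronglyMeasurable_of_smooth {d : ℕ} {F : (Fin d → ℝ) → ℂ}
    (hF : ContDiffOn ℝ ∞ F (orthant d)) :
    AEStronglyMeasurable F (volume.restrict (orthant d)) :=
  hF.continuousOn.aestronglyMeasurable (isOpen_orthant d).measurableSet

theorem eLpNorm_congr_orthant {d : ℕ} {F G : (Fin d → ℝ) → ℂ} (h : EqOn F G (orthant d)) :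
    eLpNorm F 2 (volume.restrict (orthant d)) = eLpNorm G 2 (volume.restrict (orthant d)) :=
  eLpNorm_congr_ae ((ae_restrict_iff' (isOpen_orthant d).measurableSet).2
    (Eventually.of_forall fun _ hx => h hx))

theorem eta_add_le {d : ℕ} (α h : ℝ) {f g : ↥(orthant d) → ℂ} (hf : IsOrthantSchwartz f)
    (hg : IsOrthantSchwartz g) : eta α h (f + g) ≤ eta α h f + eta α h g := by
  refine iSup_le fun N => ?_
  rw [map_add, eLpNorm_congr_orthant (laguerreOp_iter_add hf.smooth hg.smooth N)]
  refine le_trans (ENNReal.div_le_div_right (eLpNorm_add_le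
    (aestronglyMeasurable_of_smooth (laguerreOp_iter_contDiffOn hf.smooth N))
    (aestronglyMeasurable_of_smooth (laguerreOp_iter_contDiffOn hg.smooth N)) (by norm_num)) _) ?_
  rw [ENNReal.add_div]
  exact add_le_add (le_iSup (fun N : ℕ => eLpNorm (laguerreOp^[N] (zeroExt d f)) 2
      (volume.restrict (orthant d)) / ENNReal.ofReal (h ^ N * (Nat.factorial N : ℝ) ^ α)) N)
    (le_iSup (fun N : ℕ => eLpNorm (laguerreOp^[N] (zeroExt d g)) 2
      (volume.restrict (orthant d)) / ENNReal.ofReal (h ^ N * (Nat.factorial N : ℝ) ^ α)) N)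

theorem eta_smul {d : ℕ} (α h : ℝ) (c : ℂ) {f : ↥(orthant d) → ℂ} (hf : IsOrthantSchwartz f) :
    eta α h (c • f) = ‖c‖ₑ * eta α h f := by
  unfold eta
  rw [ENNReal.mul_iSup]
  refine iSup_congr fun N => ?_
  rw [map_smul, eLpNorm_congr_orthant (laguerreOp_iter_smul c hf.smooth N), eLpNorm_const_smul,
    mul_div_assoc]

/-- The functions `f ∈ 𝒮(ℝ^d_+)` with `η_h^α(f) < ∞` for every `h > 0`, as a vector space. -/
def pSub (d : ℕ) (α : ℝ) : Submodule ℂ (↥(orthant d) → ℂ) where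
  carrier := {f | IsOrthantSchwartz f ∧ ∀ h : ℝ, 0 < h → eta α h f < ⊤}
  zero_mem' := by
    refine ⟨IsOrthantSchwartz.zero d, fun h _ => ?_⟩
    have := eta_smul α h 0 (IsOrthantSchwartz.zero d)
    simp only [zero_smul, enorm_zero, zero_mul] at this
    rw [this]; exact ENNReal.zero_lt_top
  add_mem' := fun {f g} hf hg => ⟨hf.1.add hg.1, fun h hh =>
    (eta_add_le α h hf.1 hg.1).trans_lt (ENNReal.add_lt_top.2 ⟨hf.2 h hh, hg.2 h hh⟩)⟩
  smul_mem' := fun c f hf => ⟨hf.1.smul c, fun h hh => by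
    rw [eta_smul α h c hf.1]
    exact ENNReal.mul_lt_top enorm_lt_top (hf.2 h hh)⟩

/-- The space `𝐠^α_α(ℝ^d_+) = ⋂_{h>0} 𝐆^{α,h}_{α,h}(ℝ^d_+)`. -/
def PSpace (d : ℕ) (α : ℝ) : Type := ↥(pSub d α)

instance (d : ℕ) (α : ℝ) : AddCommGroup (PSpace d α) :=
  inferInstanceAs (AddCommGroup ↥(pSub d α))

instance (d : ℕ) (α : ℝ) : Module ℂ (PSpace d α) :=
  inferInstanceAs (Module ℂ ↥(pSub d α))

instance (d : ℕ) (α : ℝ) : CoeFun (PSpace d α) (fun _ => ↥(orthant d) → ℂ) := ⟨Subtype.val⟩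

/-- The norm `η_h^α` on `𝐠^α_α(ℝ^d_+)`. -/
def etaNorm (d : ℕ) (α : ℝ) (h : {h : ℝ // 0 < h}) : Seminorm ℂ (PSpace d α) :=
  Seminorm.of (fun f => (eta α h.1 (f : ↥(orthant d) → ℂ)).toReal)
    (by
      intro f g
      rw [← ENNReal.toReal_add (f.2.2 h.1 h.2).ne (g.2.2 h.1 h.2).ne]
      exact ENNReal.toReal_mono
        (ENNReal.add_ne_top.2 ⟨(f.2.2 h.1 h.2).ne, (g.2.2 h.1 h.2).ne⟩)
        (eta_add_le α h.1 f.2.1 g.2.1))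
    (by
      intro c f
      have := congrArg ENNReal.toReal (eta_smul α h.1 c f.2.1)
      rw [ENNReal.toReal_mul, toReal_enorm] at this
      exact this)

/-- The projective limit topology of the spaces `𝐆^{α,h}_{α,h}(ℝ^d_+)`, `h > 0`. -/
instance (d : ℕ) (α : ℝ) : TopologicalSpace (PSpace d α) :=
  haveI : Nonempty {h : ℝ // 0 < h} := ⟨⟨1, one_pos⟩⟩
  SeminormFamily.moduleFilterBasis (𝕜 := ℂ) (etaNorm d α) |>.topology

/-! ## The substitutions -/

/-- `v(x) = (x_1², …, x_d²)`, from `ℝ^d` to the closed orthant. -/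
def vMap {d : ℕ} (x : Fin d → ℝ) : Fin d → ℝ := fun j => x j ^ 2

/-- `w(x) = (√x_1, …, √x_d)`. -/
def wMap {d : ℕ} (x : Fin d → ℝ) : Fin d → ℝ := fun j => Real.sqrt (x j)

end LagPil

end

noncomputable section

namespace LagPil

/-! Both spaces are copies of the sequence space `SeqSpace d (α / 2)`, and the substitution `x ↦ x²`
becomes a harmless change of basis between them.

On the orthant, let `l_n(x) = ∏ e^{-x_j/2} L_{n_j}(x_j)` (`lagPi`). These functions are orthonormal
in `L²` and satisfy `E l_n = |n| l_n`. By symmetry of `E` (`lagCoeff_laguerreOp`) the coefficients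
`a_n` of `f` satisfy `|n|^N |a_n| ≤ ‖E^N f‖ ≤ η_h(f) h^N N!^α`; summing an exponential series over
`N` turns this into `|a_n| ≤ C e^{-k|n|^{1/α}}` for every `k` (`mul_exp_le_of_forall_pow_le`).
Conversely, `t^N ≤ h^N N!^α e^{c t^{1/α}}` and the polynomial bounds on `l_n` and its derivatives
show that a series with such coefficients lies in `PSpace` (`eta_lagSeries_le`). The exponent `1/α`
is `1/(2β)` for `β = α/2`. Both passages are continuous. That `f` is the sum of its Laguerre series
is completeness: the generating function expands `e^{-s·x}` for `Re s_j > 0`, so a rapidly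
decreasing `G` without Laguerre coefficients has vanishing Laplace integrals, and Fourier inversion
for `G(x) e^{-∑ x_j}` gives `G = 0` (`eq_zero_of_lagCoeff_eq_zero`).

For the change of basis, `H_{2n}(x) = (-4)^n n! L_n^{(-1/2)}(x²)`, and the addition formula
`lag_add` passes between the parameters `-1/2` and `0`. Hence `e^{-x²/2} L_n(x²)` is a finite
combination of `h_0, h_2, …, h_{2n}`, and the even part of `h_m` is a finite combination of the
functions `e^{-x²/2} L_k(x²)` with `2k ≤ m`. The entries grow polynomially and indices at most
double, so `|n|^{1/(2β)}` grows by at most the factor `2^{1/(2β)}`. Since every `h > 0` is allowed,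
such matrices act continuously on the sequence space (`IsTriangular.continuous_map`).

The two matrices are never multiplied together. That the resulting maps are mutually inverse is
checked on functions, where it reduces to `v ∘ w = id` and to an even function being its own even
part. -/

/-! ## Laguerre polynomials and Laguerre functions of one variable -/

/-- The Laguerre polynomial `L_n^{(a)}`, by its three-term recursion. -/
def lag (a : ℝ) : ℕ → ℝ → ℝ
  | 0, _ => 1
  | 1, x => a + 1 - x
  | n + 2, x => ((2 * n + 3 + a - x) * lag a (n + 1) x - (n + 1 + a) * lag a n x) / (n + 2)

theorem lag_zero (a x : ℝ) : lag a 0 x = 1 := by simp [lag]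

theorem lag_one (a x : ℝ) : lag a 1 x = a + 1 - x := by simp [lag]

theorem lag_rec (a : ℝ) (n : ℕ) (x : ℝ) : (n + 2) * lag a (n + 2) x
    = (2 * n + 3 + a - x) * lag a (n + 1) x - (n + 1 + a) * lag a n x := by
  rw [lag]
  field_simp

theorem lag_contDiff (a : ℝ) (n : ℕ) : ContDiff ℝ ∞ (lag a n) := by
  induction n using Nat.twoStepInduction with
  | zero =>
    rw [show lag a 0 = fun _ => 1 from funext (lag_zero a)]
    exact contDiff_const
  | one =>
    rw [show lag a 1 = fun x => a + 1 - x from funext (lag_one a)]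
    exact contDiff_const.sub contDiff_id
  | more n ih1 ih2 =>
    rw [show lag a (n + 2) = fun x => ((2 * n + 3 + a - x) * lag a (n + 1) x
      - (n + 1 + a) * lag a n x) / (n + 2) from funext fun x => by rw [lag]]
    exact (((contDiff_const.sub contDiff_id).mul ih2).sub (contDiff_const.mul ih1)).div_const _

/-- For `n = 0` the truncated index `n - 1` does no harm, because its coefficient is `n`. The same
convention is used in all later identities containing `n - 1`. -/
theorem lag_three_term (n : ℕ) (x : ℝ) : x * lag 0 n x
    = (2 * n + 1) * lag 0 n x - (n + 1) * lag 0 (n + 1) x - n * lag 0 (n - 1) x := by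
  cases n with
  | zero => simp [lag_zero, lag_one]
  | succ n =>
    have := lag_rec 0 n x
    push_cast
    linarith

/-- The three-term recursion telescopes. Once the derivative of `L_n` is known to be minus this sum,
this is the classical `x L_n' = n L_n - n L_{n-1}`. -/
theorem mul_sum_lag (n : ℕ) (x : ℝ) : x * ∑ k ∈ Finset.range n, lag 0 k x
    = n * lag 0 (n - 1) x - n * lag 0 n x := by
  induction n with
  | zero => simp
  | succ n ih =>
    rw [Finset.sum_range_succ, mul_add, ih, lag_three_term]
    push_cast
    ring

/-- Differentiating the recursion leaves `x` times a sum of lower polynomials, which `mul_sum_lag`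
removes. Writing the derivative as a sum with coefficients `-1` keeps it inside the family, so
bounds on the functions pass to all derivatives. -/
theorem lag_hasDerivAt (n : ℕ) (x : ℝ) :
    HasDerivAt (lag 0 n) (-∑ k ∈ Finset.range n, lag 0 k x) x := by
  induction n using Nat.twoStepInduction with
  | zero =>
    rw [show lag 0 0 = fun _ => 1 from funext (lag_zero 0)]
    simpa using hasDerivAt_const x (1 : ℝ)
  | one =>
    rw [show lag 0 1 = fun x => 0 + 1 - x from funext (lag_one 0)]
    simpa [lag_zero] using (hasDerivAt_id' x).const_sub 1
  | more n ih1 ih2 =>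
    rw [show lag 0 (n + 2) = fun x => ((2 * n + 3 + 0 - x) * lag 0 (n + 1) x
      - (n + 1 + 0) * lag 0 n x) / (n + 2) from funext fun x => by rw [lag]]
    refine (((((hasDerivAt_id' x).const_sub (2 * n + 3 + 0 : ℝ)).fun_mul ih2).fun_sub
      (ih1.const_mul (n + 1 + 0 : ℝ))).div_const _).congr_deriv ?_
    have h := mul_sum_lag (n + 1) x
    rw [div_eq_iff (by positivity)]
    simp only [Finset.sum_range_succ, Nat.add_sub_cancel] at h ⊢
    push_cast at h
    linarith

/-- The Laguerre function `e^{-x/2} L_n(x)`. -/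
def lagFun (n : ℕ) (x : ℝ) : ℝ := Real.exp (-x / 2) * lag 0 n x

/-- The derivative of the Laguerre function. -/
def lagFunD (n : ℕ) (x : ℝ) : ℝ := -(1 / 2) * lagFun n x - ∑ k ∈ Finset.range n, lagFun k x

theorem lagFun_contDiff (n : ℕ) : ContDiff ℝ ∞ (lagFun n) :=
  (by fun_prop : ContDiff ℝ ∞ fun x : ℝ => Real.exp (-x / 2)).mul (lag_contDiff 0 n)

theorem lagFun_continuous (n : ℕ) : Continuous (lagFun n) := (lagFun_contDiff n).continuous

theorem lagFunD_continuous (n : ℕ) : Continuous (lagFunD n) :=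
  (continuous_const.mul (lagFun_continuous n)).sub
    (continuous_finsetSum _ fun k _ => lagFun_continuous k)

theorem lagFun_hasDerivAt (n : ℕ) (x : ℝ) : HasDerivAt (lagFun n) (lagFunD n x) x := by
  have h1 : HasDerivAt (fun t : ℝ => Real.exp (-t / 2)) (Real.exp (-x / 2) * (-1 / 2)) x :=
    ((hasDerivAt_neg x).div_const 2).exp
  refine (h1.mul (lag_hasDerivAt n x)).congr_deriv ?_
  simp only [lagFunD, lagFun, ← Finset.mul_sum]
  ring

theorem lagFunD_hasDerivAt (n : ℕ) (x : ℝ) : HasDerivAt (lagFunD n)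
    (-(1 / 2) * lagFunD n x - ∑ k ∈ Finset.range n, lagFunD k x) x :=
  ((lagFun_hasDerivAt n x).const_mul _).fun_sub
    (HasDerivAt.fun_sum fun k _ => lagFun_hasDerivAt k x)

theorem lagFun_three_term (n : ℕ) (x : ℝ) : x * lagFun n x
    = (2 * n + 1) * lagFun n x - (n + 1) * lagFun (n + 1) x - n * lagFun (n - 1) x := by
  have := lag_three_term n x
  simp only [lagFun]
  linear_combination Real.exp (-x / 2) * this

theorem mul_sum_lagFun (n : ℕ) (x : ℝ) : x * ∑ k ∈ Finset.range n, lagFun k x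
    = n * lagFun (n - 1) x - n * lagFun n x := by
  have := mul_sum_lag n x
  simp only [lagFun, ← Finset.mul_sum]
  linear_combination Real.exp (-x / 2) * this

theorem mul_sum_lagFunD (n : ℕ) (x : ℝ) : x * ∑ k ∈ Finset.range n, lagFunD k x
    = n * lagFun (n - 1) x - ∑ k ∈ Finset.range n, lagFun k x
      - 1 / 2 * (x * ∑ k ∈ Finset.range n, lagFun k x) := by
  induction n with
  | zero => simp
  | succ n ih =>
    have h := mul_sum_lagFun n x
    rw [Finset.sum_range_succ, mul_add, ih, Finset.sum_range_succ, lagFunD]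
    push_cast
    linear_combination -h

/-- The Laguerre equation. -/
theorem lagFun_ode (n : ℕ) (x : ℝ) :
    x * (-(1 / 2) * lagFunD n x - ∑ k ∈ Finset.range n, lagFunD k x) + lagFunD n x
      - x / 4 * lagFun n x + 1 / 2 * lagFun n x = -(n * lagFun n x) := by
  have h1 := mul_sum_lagFun n x
  have h2 := mul_sum_lagFunD n x
  simp only [lagFunD] at h2 ⊢
  linear_combination h1 - h2

/-! ### Decay and orthonormality -/

theorem pow_mul_exp_le (n : ℕ) (c : ℝ) (hc : 0 < c) :
    ∃ C : ℝ, 0 ≤ C ∧ ∀ x : ℝ, 0 ≤ x → (1 + x) ^ n ≤ C * Real.exp (c * x) := by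
  -- `M = K + 1` is at least `1`, which gives `1 + x ≤ M e^{x/M}`, and at least `n / c`, which makes
  -- the `n`-th power grow no faster than `e^{cx}`.
  obtain ⟨K, hK⟩ := exists_nat_ge ((n : ℝ) / c)
  set M : ℝ := (K : ℝ) + 1 with hM
  have hM0 : 0 < M := by positivity
  refine ⟨M ^ n, by positivity, fun x hx => ?_⟩
  have h1 : 1 + x ≤ M * Real.exp (x / M) := by
    have h2 := Real.add_one_le_exp (x / M)
    have h3 : M * (x / M + 1) ≤ M * Real.exp (x / M) := by gcongr
    have h4 : M * (x / M + 1) = x + M := by field_simp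
    have : (0 : ℝ) ≤ K := K.cast_nonneg
    linarith
  calc (1 + x) ^ n ≤ (M * Real.exp (x / M)) ^ n := by gcongr
    _ = M ^ n * Real.exp (n * (x / M)) := by rw [mul_pow, ← Real.exp_nat_mul]
    _ ≤ M ^ n * Real.exp (c * x) := by
        refine mul_le_mul_of_nonneg_left (Real.exp_le_exp.2 ?_) (by positivity)
        have h3 : (n : ℝ) ≤ M * c := by
          rw [div_le_iff₀ hc] at hK
          nlinarith
        have h4 : (n : ℝ) / M ≤ c := by rw [div_le_iff₀ hM0]; linarith
        calc (n : ℝ) * (x / M) = n / M * x := by ring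
          _ ≤ c * x := by gcongr

theorem lag_bound (a : ℝ) (n : ℕ) :
    ∃ C : ℝ, 0 ≤ C ∧ ∀ x : ℝ, 0 ≤ x → |lag a n x| ≤ C * (1 + x) ^ n := by
  induction n using Nat.twoStepInduction with
  | zero => exact ⟨1, zero_le_one, fun x _ => by simp [lag_zero]⟩
  | one =>
    refine ⟨|a + 1| + 1, by positivity, fun x hx => ?_⟩
    rw [lag_one, pow_one]
    have h1 := abs_sub (a + 1) x
    rw [abs_of_nonneg hx] at h1
    nlinarith [abs_nonneg (a + 1), mul_nonneg (abs_nonneg (a + 1)) hx]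
  | more n ih1 ih2 =>
    obtain ⟨A, hA0, hA⟩ := ih1
    obtain ⟨B, hB0, hB⟩ := ih2
    refine ⟨(|2 * n + 3 + a| + 1) * B + |n + 1 + a| * A, by positivity, fun x hx => ?_⟩
    rw [lag, abs_div]
    refine (div_le_self (abs_nonneg _) ?_).trans ((abs_sub _ _).trans ?_)
    · rw [abs_of_nonneg (by positivity)]
      linarith [(Nat.cast_nonneg n : (0 : ℝ) ≤ n)]
    · rw [abs_mul, abs_mul, add_mul]
      have h0 : |2 * n + 3 + a - x| ≤ (|2 * n + 3 + a| + 1) * (1 + x) := by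
        have h1 := abs_sub (2 * n + 3 + a) x
        rw [abs_of_nonneg hx] at h1
        nlinarith [abs_nonneg (2 * n + 3 + a), mul_nonneg (abs_nonneg (2 * n + 3 + a)) hx]
      have h2 : (1 + x) ^ n ≤ (1 + x) ^ (n + 2) := pow_le_pow_right₀ (by linarith) (by omega)
      refine add_le_add ?_ ?_
      · calc |2 * n + 3 + a - x| * |lag a (n + 1) x|
            ≤ ((|2 * n + 3 + a| + 1) * (1 + x)) * (B * (1 + x) ^ (n + 1)) := by
              gcongr
              exact hB x hx
          _ = _ := by ring
      · rw [mul_assoc]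
        gcongr
        exact (hA x hx).trans (by gcongr)

theorem lagFun_decay (n : ℕ) :
    ∃ C : ℝ, 0 ≤ C ∧ ∀ x : ℝ, 0 ≤ x → |lagFun n x| ≤ C * Real.exp (-(1 / 4) * x) := by
  obtain ⟨A, hA0, hA⟩ := lag_bound 0 n
  -- Half of the decay of `e^{-x/2}` is spent on the polynomial; the rate `1/4` remains.
  obtain ⟨B, hB0, hB⟩ := pow_mul_exp_le n (1 / 4) (by norm_num)
  refine ⟨A * B, by positivity, fun x hx => ?_⟩
  rw [lagFun, abs_mul, Real.abs_exp]
  calc Real.exp (-x / 2) * |lag 0 n x|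
      ≤ Real.exp (-x / 2) * (A * (B * Real.exp (1 / 4 * x))) := by
        gcongr
        exact (hA x hx).trans (by gcongr; exact hB x hx)
    _ = A * B * (Real.exp (-x / 2) * Real.exp (1 / 4 * x)) := by ring
    _ = _ := by rw [← Real.exp_add]; ring_nf

theorem lagFunD_decay (n : ℕ) :
    ∃ C : ℝ, 0 ≤ C ∧ ∀ x : ℝ, 0 ≤ x → |lagFunD n x| ≤ C * Real.exp (-(1 / 4) * x) := by
  choose A hA0 hA using lagFun_decay
  refine ⟨1 / 2 * A n + ∑ k ∈ Finset.range n, A k,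
    add_nonneg (by linarith [hA0 n]) (Finset.sum_nonneg fun k _ => hA0 k), fun x hx => ?_⟩
  rw [lagFunD]
  refine (abs_sub _ _).trans ?_
  rw [add_mul, Finset.sum_mul]
  refine add_le_add ?_ ((Finset.abs_sum_le_sum_abs _ _).trans
    (Finset.sum_le_sum fun k _ => hA k x hx))
  rw [abs_mul, abs_neg, abs_of_pos (by norm_num : (0 : ℝ) < 1 / 2), mul_assoc]
  gcongr
  exact hA n x hx

theorem integrableOn_mul_of_decay {u v : ℝ → ℝ} (hu : Continuous u) (hv : Continuous v)
    {A B : ℝ} (hA : ∀ x : ℝ, 0 ≤ x → |u x| ≤ A * Real.exp (-(1 / 4) * x))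
    (hB : ∀ x : ℝ, 0 ≤ x → |v x| ≤ B * Real.exp (-(1 / 4) * x)) (p : ℕ) :
    IntegrableOn (fun x => (1 + x) ^ p * (u x * v x)) (Ioi 0) := by
  obtain ⟨C, hC0, hC⟩ := pow_mul_exp_le p (1 / 4) (by norm_num)
  refine Integrable.mono' ((exp_neg_integrableOn_Ioi 0
    (by norm_num : (0 : ℝ) < 1 / 4)).const_mul (C * (A * B)))
    ((by fun_prop : Continuous _).aestronglyMeasurable) ?_
  refine (ae_restrict_iff' measurableSet_Ioi).2 (Eventually.of_forall fun x hx => ?_)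
  have hx' : (0 : ℝ) ≤ x := le_of_lt hx
  rw [Real.norm_eq_abs, abs_mul, abs_mul, abs_of_nonneg (by positivity : (0 : ℝ) ≤ (1 + x) ^ p)]
  have hA' := hA x hx'
  have hB' := hB x hx'
  calc (1 + x) ^ p * (|u x| * |v x|) ≤ (C * Real.exp (1 / 4 * x)) *
        ((A * Real.exp (-(1 / 4) * x)) * (B * Real.exp (-(1 / 4) * x))) := by
        gcongr
        · exact hC x hx'
        · exact (abs_nonneg _).trans hA'
    _ = C * (A * B) * (Real.exp (1 / 4 * x) * Real.exp (-(1 / 4) * x)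
          * Real.exp (-(1 / 4) * x)) := by ring
    _ = _ := by rw [← Real.exp_add]; ring_nf; simp

theorem lagFun_mul_integrable (n m p : ℕ) :
    IntegrableOn (fun x => (1 + x) ^ p * (lagFun n x * lagFun m x)) (Ioi 0) := by
  obtain ⟨A, _, hA⟩ := lagFun_decay n
  obtain ⟨B, _, hB⟩ := lagFun_decay m
  exact integrableOn_mul_of_decay (lagFun_continuous n) (lagFun_continuous m) hA hB p

theorem tendsto_of_decay {u : ℝ → ℝ} {A : ℝ}
    (hA : ∀ x : ℝ, 0 ≤ x → |u x| ≤ A * Real.exp (-(1 / 4) * x)) : Tendsto u atTop (𝓝 0) := by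
  have h1 : Tendsto (fun x : ℝ => A * Real.exp (-(1 / 4) * x)) atTop (𝓝 0) := by
    have : Tendsto (fun x : ℝ => -(1 / 4) * x) atTop atBot :=
      tendsto_id.const_mul_atTop_of_neg (by norm_num)
    simpa using (Real.tendsto_exp_atBot.comp this).const_mul A
  refine squeeze_zero_norm' ?_ h1
  filter_upwards [eventually_ge_atTop 0] with x hx using hA x hx

/-- The weighted Wronskian `W = x (u' v - u v')` of two solutions has derivative `(m - n) u v` by
the Laguerre equation. It vanishes at `0` because of the factor `x` and at infinity by exponential
decay. -/
theorem lagFun_orthogonal {n m : ℕ} (hnm : n ≠ m) :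
    ∫ x in Ioi 0, lagFun n x * lagFun m x = 0 := by
  set W : ℝ → ℝ := fun x => x * (lagFunD n x * lagFun m x - lagFun n x * lagFunD m x) with hW
  have hd : ∀ x, HasDerivAt W (((m : ℝ) - n) * (lagFun n x * lagFun m x)) x := by
    intro x
    refine ((hasDerivAt_id' x).fun_mul (((lagFunD_hasDerivAt n x).fun_mul
      (lagFun_hasDerivAt m x)).fun_sub ((lagFun_hasDerivAt n x).fun_mul
      (lagFunD_hasDerivAt m x)))).congr_deriv ?_
    have h1 := lagFun_ode n x
    have h2 := lagFun_ode m x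
    linear_combination lagFun m x * h1 - lagFun n x * h2
  have hlim : Tendsto W atTop (𝓝 0) := by
    obtain ⟨A, hA0, hA⟩ := lagFun_decay n
    obtain ⟨A', hA0', hA'⟩ := lagFunD_decay n
    obtain ⟨B, hB0, hB⟩ := lagFun_decay m
    obtain ⟨B', hB0', hB'⟩ := lagFunD_decay m
    obtain ⟨C, hC0, hC⟩ := pow_mul_exp_le 1 (1 / 4) (by norm_num)
    refine tendsto_of_decay (A := C * (A' * B + A * B')) fun x hx => ?_
    have hA := hA x hx
    have hA' := hA' x hx
    have hB := hB x hx
    have hB' := hB' x hx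
    set e := Real.exp (-(1 / 4) * x) with he
    have hx1 : x ≤ C * Real.exp (1 / 4 * x) := by have := hC x hx; rw [pow_one] at this; linarith
    have he0 : 0 < e := Real.exp_pos _
    rw [hW]
    simp only
    rw [abs_mul, abs_of_nonneg hx]
    calc x * |lagFunD n x * lagFun m x - lagFun n x * lagFunD m x|
        ≤ (C * Real.exp (1 / 4 * x)) * ((A' * e) * (B * e) + (A * e) * (B' * e)) := by
          gcongr
          refine (abs_sub _ _).trans ?_
          rw [abs_mul, abs_mul]
          gcongr
      _ = C * (A' * B + A * B') * ((Real.exp (1 / 4 * x) * e) * e) := by ring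
      _ = _ := by rw [he, ← Real.exp_add, ← Real.exp_add]; ring_nf
  have hint : IntegrableOn (fun x => ((m : ℝ) - n) * (lagFun n x * lagFun m x)) (Ioi 0) := by
    have := (lagFun_mul_integrable n m 0).const_mul ((m : ℝ) - n)
    simpa [IntegrableOn] using this
  have h := integral_Ioi_of_hasDerivAt_of_tendsto' (fun x _ => hd x) hint hlim
  rw [integral_const_mul] at h
  simp only [hW, zero_mul, sub_zero] at h
  rcases mul_eq_zero.1 h with h | h
  · exact absurd (by exact_mod_cast (sub_eq_zero.1 h).symm) hnm
  · exact h

/-- The product `x l_n l_{n+1}` is expanded twice by the three-term recursion, once for each factor.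
After integration orthogonality leaves only `(n + 1) ‖l_{n+1}‖² = (n + 1) ‖l_n‖²`. -/
theorem lagFun_norm (n : ℕ) : ∫ x in Ioi 0, lagFun n x * lagFun n x = 1 := by
  have hi : ∀ n m, Integrable (fun x => lagFun n x * lagFun m x) (volume.restrict (Ioi 0)) := by
    intro n m
    simpa [IntegrableOn] using lagFun_mul_integrable n m 0
  induction n with
  | zero =>
    have : ∀ x, lagFun 0 x * lagFun 0 x = Real.exp (-x) := fun x => by
      simp only [lagFun, lag_zero, mul_one]
      rw [← Real.exp_add]; ring_nf
    simp only [this, integral_exp_neg_Ioi_zero]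
  | succ n ih =>
    have key : ∀ x, ((n : ℝ) + 1) * (lagFun (n + 1) x * lagFun (n + 1) x)
        = ((n : ℝ) + 1) * (lagFun n x * lagFun n x)
          + ((2 * n + 1) * (lagFun n x * lagFun (n + 1) x)
          - n * (lagFun (n - 1) x * lagFun (n + 1) x)
          + (n + 2) * (lagFun n x * lagFun (n + 2) x)
          - (2 * n + 3) * (lagFun n x * lagFun (n + 1) x)) := by
      intro x
      have h1 := lagFun_three_term n x
      have h2 := lagFun_three_term (n + 1) x
      push_cast at h2
      linear_combination lagFun (n + 1) x * h1 - lagFun n x * h2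
    have h3 := congrArg (fun f : ℝ → ℝ => ∫ x in Ioi 0, f x) (funext key)
    have e1 := (hi n (n + 1)).const_mul (2 * (n : ℝ) + 1)
    have e2 := (hi (n - 1) (n + 1)).const_mul (n : ℝ)
    have e3 := (hi n (n + 2)).const_mul ((n : ℝ) + 2)
    have e4 := (hi n (n + 1)).const_mul (2 * (n : ℝ) + 3)
    rw [integral_add ((hi n n).const_mul _) (by fun_prop),
      integral_sub (by fun_prop) e4, integral_add (by fun_prop) e3, integral_sub e1 e2] at h3
    simp only [integral_const_mul, ih] at h3
    rw [lagFun_orthogonal (by omega : n ≠ n + 1), lagFun_orthogonal (by omega : n - 1 ≠ n + 1),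
      lagFun_orthogonal (by omega : n ≠ n + 2)] at h3
    have hn : (n : ℝ) + 1 ≠ 0 := by positivity
    have h4 : ((n : ℝ) + 1) * (∫ x in Ioi 0, lagFun (n + 1) x * lagFun (n + 1) x) = n + 1 := by
      rw [h3]; ring
    exact mul_left_cancel₀ hn (by rw [h4, mul_one])

theorem lagFun_inner (n m : ℕ) :
    ∫ x in Ioi 0, lagFun n x * lagFun m x = if n = m then 1 else 0 := by
  split_ifs with h
  · rw [h, lagFun_norm]
  · exact lagFun_orthogonal h

/-! ### Bounds that are polynomial in the degree -/

/-- Here `l_n(x)² = -2 ∫_x^∞ l_n l_n'`, where `-2 l_n l_n' = l_n² + 2 ∑_{k<n} l_n l_k`. Applying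
`2ab ≤ a² + b²` and the unit norms gives `1 + 2n`. This is not sharp, but polynomial growth in `n`
is all that is needed. -/
theorem lagFun_sq_le (n : ℕ) {x : ℝ} (hx : 0 ≤ x) : lagFun n x ^ 2 ≤ 2 * n + 1 := by
  have hi : ∀ n m, IntegrableOn (fun x => lagFun n x * lagFun m x) (Ioi 0) := by
    intro n m
    simpa [IntegrableOn] using lagFun_mul_integrable n m 0
  have hd : ∀ y, HasDerivAt (fun t => lagFun n t ^ 2) (2 * (lagFun n y * lagFunD n y)) y := by
    intro y
    refine ((lagFun_hasDerivAt n y).fun_pow 2).congr_deriv ?_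
    push_cast; ring
  obtain ⟨A, hA0, hA⟩ := lagFun_decay n
  obtain ⟨B, hB0, hB⟩ := lagFunD_decay n
  have hlim : Tendsto (fun t => lagFun n t ^ 2) atTop (𝓝 0) := by
    simpa using (tendsto_of_decay hA).pow 2
  have hint0 := (integrableOn_mul_of_decay (lagFun_continuous n) (lagFunD_continuous n) hA hB
    0).const_mul 2
  simp only [pow_zero, one_mul] at hint0
  have hint : IntegrableOn (fun y => 2 * (lagFun n y * lagFunD n y)) (Ioi x) :=
    IntegrableOn.mono_set hint0 (Ioi_subset_Ioi hx)
  have h1 := integral_Ioi_of_hasDerivAt_of_tendsto' (fun y _ => hd y) hint hlim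
  set G : ℝ → ℝ := fun y => lagFun n y * lagFun n y
    + ∑ k ∈ Finset.range n, (lagFun n y * lagFun n y + lagFun k y * lagFun k y) with hG
  have hG0 : ∀ y, 0 ≤ G y := fun y => add_nonneg (mul_self_nonneg _)
    (Finset.sum_nonneg fun k _ => add_nonneg (mul_self_nonneg _) (mul_self_nonneg _))
  have hGi : IntegrableOn G (Ioi 0) :=
    (hi n n).add (integrable_finsetSum _ fun k _ => (hi n n).add (hi k k))
  have h2 : ∀ y, -(2 * (lagFun n y * lagFunD n y)) ≤ G y := by
    intro y
    have e : -(2 * (lagFun n y * lagFunD n y)) = lagFun n y * lagFun n y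
        + ∑ k ∈ Finset.range n, 2 * (lagFun n y * lagFun k y) := by
      rw [← Finset.mul_sum, ← Finset.mul_sum, lagFunD]; ring
    rw [e]
    refine add_le_add le_rfl (Finset.sum_le_sum fun k _ => ?_)
    nlinarith [sq_nonneg (lagFun n y - lagFun k y)]
  have h3 : ∫ y in Ioi 0, G y = 2 * n + 1 := by
    have hi2 : ∀ k, IntegrableOn (fun y => lagFun n y * lagFun n y + lagFun k y * lagFun k y)
        (Ioi 0) := fun k => (hi n n).add (hi k k)
    rw [hG, integral_add (hi n n) (integrable_finsetSum _ fun k _ => hi2 k),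
      integral_finsetSum _ fun k _ => hi2 k]
    have : ∀ k, ∫ y in Ioi 0, (lagFun n y * lagFun n y + lagFun k y * lagFun k y) = 2 := by
      intro k
      rw [integral_add (hi n n) (hi k k), lagFun_norm, lagFun_norm]; norm_num
    simp only [this, lagFun_norm, Finset.sum_const, Finset.card_range, nsmul_eq_mul]
    ring
  calc lagFun n x ^ 2 = ∫ y in Ioi x, -(2 * (lagFun n y * lagFunD n y)) := by
        rw [integral_neg, h1]; ring
    _ ≤ ∫ y in Ioi x, G y := integral_mono hint.neg (hGi.mono_set (Ioi_subset_Ioi hx)) h2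
    _ ≤ ∫ y in Ioi 0, G y := setIntegral_mono_set hGi (Eventually.of_forall hG0)
        (Ioi_subset_Ioi hx).eventuallyLE
    _ = 2 * n + 1 := h3

/-- Each factor `x` is traded, by the three-term recursion, for coefficients of total size `4n + 2`
and a shift of the degree by at most one. The sum `n + b` in the constant leaves room for the `b`
shifts. -/
theorem lagFun_weighted_le (b n : ℕ) {x : ℝ} (hx : 0 ≤ x) :
    x ^ b * |lagFun n x| ≤ (4 * (n + b : ℕ) + 2) ^ (b + 1) := by
  induction b generalizing n with
  | zero =>
    have h := lagFun_sq_le n hx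
    have hn : (0 : ℝ) ≤ n := n.cast_nonneg
    have : |lagFun n x| ≤ 4 * n + 2 := abs_le_of_sq_le_sq (by nlinarith) (by positivity)
    simpa using this
  | succ b ih =>
    have h := lagFun_three_term n x
    set B : ℝ := (4 * (n + (b + 1) : ℕ) + 2) ^ (b + 1) with hB
    have hle : ∀ m, m ≤ n + 1 → x ^ b * |lagFun m x| ≤ B := by
      intro m hm
      refine (ih m).trans ?_
      rw [hB]
      gcongr 1
      have : ((m + b : ℕ) : ℝ) ≤ ((n + (b + 1) : ℕ) : ℝ) := by exact_mod_cast (by omega)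
      linarith
    have h0 : 0 ≤ B := by positivity
    have hn : (0 : ℝ) ≤ n := n.cast_nonneg
    have hb : (0 : ℝ) ≤ b := b.cast_nonneg
    have h1 : x * |lagFun n x| ≤ (2 * n + 1) * |lagFun n x| + (n + 1) * |lagFun (n + 1) x|
        + n * |lagFun (n - 1) x| := by
      rw [show x * |lagFun n x| = |x * lagFun n x| by rw [abs_mul, abs_of_nonneg hx], h]
      refine (abs_sub _ _).trans (add_le_add ((abs_sub _ _).trans ?_) ?_)
      · rw [abs_mul, abs_mul, abs_of_nonneg (by positivity : (0 : ℝ) ≤ 2 * n + 1),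
          abs_of_nonneg (by positivity : (0 : ℝ) ≤ (n : ℝ) + 1)]
      · rw [abs_mul, abs_of_nonneg hn]
    have h2 := hle n (by omega)
    have h3 := hle (n + 1) le_rfl
    have h4 := hle (n - 1) (by omega)
    calc x ^ (b + 1) * |lagFun n x| = x ^ b * (x * |lagFun n x|) := by ring
      _ ≤ x ^ b * ((2 * n + 1) * |lagFun n x| + (n + 1) * |lagFun (n + 1) x|
        + n * |lagFun (n - 1) x|) := by gcongr
      _ = (2 * n + 1) * (x ^ b * |lagFun n x|) + (n + 1) * (x ^ b * |lagFun (n + 1) x|)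
        + n * (x ^ b * |lagFun (n - 1) x|) := by ring
      _ ≤ (2 * n + 1) * B + (n + 1) * B + n * B := by gcongr
      _ = (4 * n + 2) * B := by ring
      _ ≤ (4 * (n + (b + 1) : ℕ) + 2) * B := by
          gcongr
          exact_mod_cast (by omega)
      _ = _ := by rw [hB]; ring

theorem lagFun_one_add_pow_le (p : ℕ) : ∃ C : ℝ, 0 ≤ C ∧ ∃ q : ℕ, ∀ (n : ℕ) (x : ℝ), 0 ≤ x →
    (1 + x) ^ p * |lagFun n x| ≤ C * ((n : ℝ) + 1) ^ q := by
  refine ⟨2 ^ p * (2 * (4 * p + 4) ^ (p + 1)), by positivity, p + 1, fun n x hx => ?_⟩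
  have h1 : (1 + x) ^ p ≤ 2 ^ p * (1 + x ^ p) := by
    have := add_pow_le (zero_le_one' ℝ) hx p
    rw [one_pow] at this
    refine this.trans ?_
    gcongr
    · norm_num
    · omega
  have hn : (0 : ℝ) ≤ n := n.cast_nonneg
  have hp : (0 : ℝ) ≤ p := p.cast_nonneg
  have hle : ∀ b ≤ p, x ^ b * |lagFun n x| ≤ ((4 * p + 4) * (n + 1)) ^ (p + 1) := by
    intro b hb
    refine (lagFun_weighted_le b n hx).trans ?_
    have hb' : (b : ℝ) ≤ p := by exact_mod_cast hb
    have h2 : 4 * ((n + b : ℕ) : ℝ) + 2 ≤ (4 * p + 4) * (n + 1) := by push_cast; nlinarith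
    refine (pow_le_pow_left₀ (by positivity) h2 _).trans ?_
    refine pow_le_pow_right₀ ?_ (by omega)
    nlinarith
  have h3 := hle 0 (Nat.zero_le _)
  have h4 := hle p le_rfl
  rw [pow_zero, one_mul] at h3
  calc (1 + x) ^ p * |lagFun n x| ≤ 2 ^ p * (1 + x ^ p) * |lagFun n x| := by gcongr
    _ = 2 ^ p * (|lagFun n x| + x ^ p * |lagFun n x|) := by ring
    _ ≤ 2 ^ p * (((4 * p + 4) * (n + 1)) ^ (p + 1) + ((4 * p + 4) * (n + 1)) ^ (p + 1)) := by
        gcongr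
    _ = _ := by rw [mul_pow]; ring

/-! ## The connection between Laguerre functions and even Hermite functions -/

/-- The coefficients `(s)_m / m!` of the binomial series `(1 - r)^{-s}`. -/
def binC (s : ℝ) : ℕ → ℝ
  | 0 => 1
  | m + 1 => (s + m) / (m + 1) * binC s m

theorem binC_abs_le {s : ℝ} (hs : |s| ≤ 1) (m : ℕ) : |binC s m| ≤ 1 := by
  induction m with
  | zero => simp [binC]
  | succ m ih =>
    rw [binC, abs_mul, abs_div]
    have h0 : (0 : ℝ) < (m : ℝ) + 1 := by positivity
    have h1 : |s + m| / |(m : ℝ) + 1| ≤ 1 := by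
      rw [abs_of_pos h0, div_le_one h0]
      refine (abs_add_le _ _).trans ?_
      rw [abs_of_nonneg (Nat.cast_nonneg m : (0 : ℝ) ≤ m)]
      linarith
    exact mul_le_one₀ h1 (abs_nonneg _) ih

open PowerSeries in
-- The equation is `(1 - r)² F' = (a + 1 - x - (a + 1) r) F`, which characterises the generating
-- function `(1 - r)^{-a-1} e^{-xr/(1-r)}` up to its constant term. Comparing coefficients gives the
-- defining recursion of `lag`, so identities can be proved by formal power series alone.
theorem eq_lag_of_ode (a x : ℝ) (F : PowerSeries ℝ) (h0 : coeff 0 F = 1)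
    (h : d⁄dX ℝ F - C 2 * (X * d⁄dX ℝ F) + X * (X * d⁄dX ℝ F)
      = C (a + 1 - x) * F - C (a + 1) * (X * F)) (n : ℕ) : coeff n F = lag a n x := by
  have h1 : coeff 1 F = a + 1 - x := by
    have := congrArg (coeff 0) h
    simp only [LinearMap.map_add, LinearMap.map_sub, coeff_C_mul, coeff_zero_X_mul, coeff_derivative, h0] at this
    simpa using this
  have h2 : ∀ n, coeff (n + 2) F = ((2 * n + 3 + a - x) * coeff (n + 1) F
      - (n + 1 + a) * coeff n F) / (n + 2) := by
    intro n
    have := congrArg (coeff (n + 1)) h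
    rw [eq_div_iff (by positivity)]
    cases n with
    | zero =>
      simp only [LinearMap.map_add, LinearMap.map_sub, coeff_C_mul, coeff_succ_X_mul, coeff_zero_X_mul,
        coeff_derivative] at this
      push_cast at this ⊢
      linarith
    | succ n =>
      simp only [LinearMap.map_add, LinearMap.map_sub, coeff_C_mul, coeff_succ_X_mul,
        coeff_derivative] at this
      push_cast at this ⊢
      linarith
  induction n using Nat.twoStepInduction with
  | zero => rw [h0, lag_zero]
  | one => rw [h1, lag_one]
  | more n ih1 ih2 => rw [h2, ih1, ih2, lag]

open PowerSeries in
theorem lag_ode (a x : ℝ) : d⁄dX ℝ (mk fun n => lag a n x)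
      - C 2 * (X * d⁄dX ℝ (mk fun n => lag a n x)) + X * (X * d⁄dX ℝ (mk fun n => lag a n x))
      = C (a + 1 - x) * (mk fun n => lag a n x) - C (a + 1) * (X * (mk fun n => lag a n x)) := by
  ext n
  rcases n with _ | _ | n
  · simp only [LinearMap.map_add, LinearMap.map_sub, coeff_C_mul, coeff_zero_X_mul, coeff_derivative, coeff_mk]
    simp [lag_zero, lag_one]
  · have := lag_rec a 0 x
    simp only [LinearMap.map_add, LinearMap.map_sub, coeff_C_mul, coeff_succ_X_mul, coeff_zero_X_mul,
        coeff_derivative, coeff_mk]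
    push_cast at this ⊢
    linarith
  · have := lag_rec a (n + 1) x
    simp only [LinearMap.map_add, LinearMap.map_sub, coeff_C_mul, coeff_succ_X_mul, coeff_derivative, coeff_mk]
    push_cast at this ⊢
    linarith

open PowerSeries in
theorem binC_ode (s : ℝ) :
    d⁄dX ℝ (mk (binC s)) - X * d⁄dX ℝ (mk (binC s)) = C s * mk (binC s) := by
  ext n
  rcases n with _ | n
  · simp only [LinearMap.map_sub, coeff_C_mul, coeff_zero_X_mul, coeff_derivative, coeff_mk, binC]
    simp
  · simp only [LinearMap.map_sub, coeff_C_mul, coeff_succ_X_mul, coeff_derivative, coeff_mk, binC]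
    push_cast
    field_simp
    ring

open PowerSeries in
-- Multiplying the generating function for the parameter `a` by `(1 - r)^{-s}` gives the one for `a
-- + s`. Formally, the product rule shows that the product solves the equation for `a + s`, and
-- coefficients are compared.
theorem lag_add (a s : ℝ) (n : ℕ) (x : ℝ) :
    lag (a + s) n x = ∑ j ∈ Finset.range (n + 1), binC s (n - j) * lag a j x := by
  have hF := lag_ode a x
  have hB := binC_ode s
  have h := eq_lag_of_ode (a + s) x (mk (fun n => lag a n x) * mk (binC s))
    (by simp [coeff_mul, binC, lag_zero]) (by
      rw [Derivation.leibniz, smul_eq_mul, smul_eq_mul,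
        show C (a + s + 1 - x) = C (a + 1 - x) + C s by rw [← map_add]; ring_nf,
        show C (a + s + 1) = C (a + 1) + C s by rw [← map_add]; ring_nf]
      have h2 : (C 2 : PowerSeries ℝ) = 2 := map_ofNat C 2
      rw [h2] at hF ⊢
      linear_combination mk (binC s) * hF + (1 - X) * mk (fun n => lag a n x) * hB) n
  rw [← h, coeff_mul, Finset.Nat.sum_antidiagonal_eq_sum_range_succ_mk]
  exact Finset.sum_congr rfl fun j _ => by simp only [coeff_mk]; ring

/-- Eliminating the odd indices from three consecutive Hermite recursions gives a recursion in steps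
of two (`h4`), which is the Laguerre recursion with parameter `-1/2` in the variable `x²`. -/
theorem hermitePoly_even (n : ℕ) (x : ℝ) :
    hermitePoly (2 * n) x = (-4) ^ n * (Nat.factorial n : ℝ) * lag (-1 / 2) n (x ^ 2) := by
  have h4 : ∀ m : ℕ, hermitePoly (m + 4) x = (4 * x ^ 2 - 4 * m - 10) * hermitePoly (m + 2) x
      - 4 * (m + 2) * (m + 1) * hermitePoly m x := by
    intro m
    have h1 := hermitePoly_rec m x
    have h2 := hermitePoly_rec (m + 1) x
    have h3 := hermitePoly_rec (m + 2) x
    push_cast at h2 h3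
    linear_combination h3 + 2 * x * h2 + 2 * (m + 2) * h1
  induction n using Nat.twoStepInduction with
  | zero => simp [hermitePoly_zero, lag_zero]
  | one =>
    rw [hermitePoly_rec, hermitePoly_one, hermitePoly_zero, lag_one]
    norm_num
    ring
  | more n ih1 ih2 =>
    have h := h4 (2 * n)
    rw [show 2 * (n + 2) = 2 * n + 4 by ring, h, ih1, show 2 * n + 2 = 2 * (n + 1) by ring, ih2,
      Nat.factorial_succ (n + 1), Nat.factorial_succ n]
    have hr := lag_rec (-1 / 2) n (x ^ 2)
    push_cast
    linear_combination -(16 * (-4) ^ n * (n + 1) * (Nat.factorial n : ℝ)) * hr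

/-- The ratio of `h_{2n}(x)` and `e^{-x²/2} L_n^{(-1/2)}(x²)`. -/
def hermiteRatio (n : ℕ) : ℝ := (Real.sqrt (2 ^ (2 * n) * (Nat.factorial (2 * n) : ℝ)
  * Real.sqrt Real.pi))⁻¹ * ((-4) ^ n * (Nat.factorial n : ℝ))

theorem hermiteRatio_ne_zero (n : ℕ) : hermiteRatio n ≠ 0 := by
  have : 0 < Real.sqrt (2 ^ (2 * n) * (Nat.factorial (2 * n) : ℝ) * Real.sqrt Real.pi) := by
    have := Real.pi_pos
    positivity
  unfold hermiteRatio
  have h2 : ((-4 : ℝ)) ^ n ≠ 0 := by simp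
  positivity

/-- This and the next estimate say that the central binomial coefficient lies between `4^n / (2n +
1)` and `4^n`. They make `hermiteRatio` and its inverse polynomially bounded, so the normalisation
of the Hermite functions costs nothing essential. -/
theorem factorial_two_mul_le (n : ℕ) :
    (Nat.factorial (2 * n) : ℝ) ≤ 4 ^ n * (Nat.factorial n : ℝ) ^ 2 := by
  induction n with
  | zero => simp
  | succ n ih =>
    rw [show 2 * (n + 1) = 2 * n + 1 + 1 by ring, Nat.factorial_succ, Nat.factorial_succ,
      Nat.factorial_succ]
    push_cast
    calc ((2 * n + 1 + 1 : ℝ)) * ((2 * n + 1) * (Nat.factorial (2 * n) : ℝ))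
        ≤ (2 * n + 1 + 1) * ((2 * n + 1 + 1) * (4 ^ n * (Nat.factorial n : ℝ) ^ 2)) := by
          gcongr; linarith
      _ = _ := by ring

theorem four_pow_mul_factorial_le (n : ℕ) :
    4 ^ n * (Nat.factorial n : ℝ) ^ 2 ≤ (2 * n + 1) * (Nat.factorial (2 * n) : ℝ) := by
  induction n with
  | zero => simp
  | succ n ih =>
    rw [show 2 * (n + 1) = 2 * n + 1 + 1 by ring, Nat.factorial_succ, Nat.factorial_succ (2 * n + 1),
      Nat.factorial_succ (2 * n)]
    push_cast
    have hf : (0 : ℝ) ≤ (Nat.factorial (2 * n) : ℝ) := by positivity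
    have hn : (0 : ℝ) ≤ n := n.cast_nonneg
    calc (4 : ℝ) ^ (n + 1) * (((n : ℝ) + 1) * (Nat.factorial n : ℝ)) ^ 2
        = 4 * (n + 1) ^ 2 * (4 ^ n * (Nat.factorial n : ℝ) ^ 2) := by ring
      _ ≤ 4 * (n + 1) ^ 2 * ((2 * n + 1) * (Nat.factorial (2 * n) : ℝ)) := by gcongr
      _ ≤ _ := by
        nlinarith [mul_nonneg (mul_nonneg (by positivity : (0 : ℝ) ≤ (n + 1) * (2 * n + 1)) hf)
          zero_le_one]

theorem hermiteRatio_sq (n : ℕ) : hermiteRatio n ^ 2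
    = (4 ^ n * (Nat.factorial n : ℝ) ^ 2) / ((Nat.factorial (2 * n) : ℝ) * Real.sqrt Real.pi) := by
  have hpi := Real.sqrt_pos.2 Real.pi_pos
  have hf : (0 : ℝ) < (Nat.factorial (2 * n) : ℝ) := by positivity
  rw [hermiteRatio, mul_pow, inv_pow, Real.sq_sqrt (by positivity), pow_mul, mul_pow,
    ← pow_mul (-4 : ℝ), mul_comm n 2, pow_mul (-4 : ℝ)]
  rw [show (2 : ℝ) ^ 2 = 4 by norm_num, show (-4 : ℝ) ^ 2 = 4 * 4 by norm_num, mul_pow]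
  field_simp

theorem hermiteRatio_abs_le (n : ℕ) : |hermiteRatio n| ≤ 2 * n + 1 := by
  have hpi : 1 ≤ Real.sqrt Real.pi := by
    rw [Real.one_le_sqrt]; linarith [Real.pi_gt_three]
  have hf : (0 : ℝ) < (Nat.factorial (2 * n) : ℝ) := by positivity
  have hn : (0 : ℝ) ≤ n := n.cast_nonneg
  refine abs_le_of_sq_le_sq ?_ (by positivity)
  rw [hermiteRatio_sq, div_le_iff₀ (by positivity)]
  refine (four_pow_mul_factorial_le n).trans ?_
  have : (2 * n + 1 : ℝ) * (Nat.factorial (2 * n) : ℝ)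
      ≤ (2 * n + 1) ^ 2 * (Nat.factorial (2 * n) : ℝ) := by
    gcongr; nlinarith
  refine this.trans ?_
  gcongr
  exact le_mul_of_one_le_right hf.le hpi

theorem hermiteRatio_inv_abs_le (n : ℕ) : |(hermiteRatio n)⁻¹| ≤ 2 := by
  have hpi : Real.sqrt Real.pi ≤ 2 := by
    rw [Real.sqrt_le_left (by norm_num)]; linarith [Real.pi_lt_four]
  have hpi0 := Real.sqrt_pos.2 Real.pi_pos
  have hf : (0 : ℝ) < (Nat.factorial (2 * n) : ℝ) := by positivity
  refine abs_le_of_sq_le_sq ?_ (by norm_num)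
  rw [inv_pow, hermiteRatio_sq, inv_div, div_le_iff₀ (by positivity)]
  have := factorial_two_mul_le n
  nlinarith [mul_le_mul this hpi hpi0.le (by positivity)]

theorem hermiteFun_even (n : ℕ) (x : ℝ) :
    hermiteFun (2 * n) x = hermiteRatio n * (Real.exp (-x ^ 2 / 2) * lag (-1 / 2) n (x ^ 2)) := by
  rw [hermiteFun, hermitePoly_even, hermiteRatio]
  ring

/-- This is the addition formula with shift `-1/2` from the parameter `0`; the opposite expansion
below uses the shift `1/2` from `-1/2`. For both shifts the binomial coefficients are bounded by
`1`. -/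
theorem hermiteFun_even_eq_sum (n : ℕ) (x : ℝ) : hermiteFun (2 * n) x
    = ∑ j ∈ Finset.range (n + 1), hermiteRatio n * binC (-1 / 2) (n - j) * lagFun j (x ^ 2) := by
  have h := lag_add 0 (-1 / 2) n (x ^ 2)
  rw [hermiteFun_even, ← zero_add (-1 / 2 : ℝ), h, zero_add, Finset.mul_sum, Finset.mul_sum]
  exact Finset.sum_congr rfl fun j _ => by rw [lagFun]; ring

theorem lagFun_sq_eq_sum (n : ℕ) (x : ℝ) : lagFun n (x ^ 2)
    = ∑ j ∈ Finset.range (n + 1), binC (1 / 2) (n - j) * (hermiteRatio j)⁻¹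
      * hermiteFun (2 * j) x := by
  have h := lag_add (-1 / 2) (1 / 2) n (x ^ 2)
  rw [show (-1 / 2 + 1 / 2 : ℝ) = 0 by norm_num] at h
  rw [lagFun, h, Finset.mul_sum]
  refine Finset.sum_congr rfl fun j _ => ?_
  rw [hermiteFun_even]
  have := hermiteRatio_ne_zero j
  field_simp

theorem hermitePoly_neg (n : ℕ) (x : ℝ) : hermitePoly n (-x) = (-1) ^ n * hermitePoly n x := by
  induction n using Nat.twoStepInduction with
  | zero => simp [hermitePoly_zero]
  | one => simp [hermitePoly_one]
  | more n ih1 ih2 =>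
    rw [hermitePoly_rec, hermitePoly_rec, ih1, ih2]
    ring

theorem hermiteFun_neg (n : ℕ) (x : ℝ) : hermiteFun n (-x) = (-1) ^ n * hermiteFun n x := by
  rw [hermiteFun, hermiteFun, hermitePoly_neg, neg_sq]
  ring

theorem sum_range_even {f : ℕ → ℝ} (hf : ∀ m, ¬Even m → f m = 0) (n : ℕ) :
    ∑ m ∈ Finset.range (2 * n + 1), f m = ∑ j ∈ Finset.range (n + 1), f (2 * j) := by
  induction n with
  | zero => simp
  | succ n ih =>
    rw [show 2 * (n + 1) + 1 = 2 * n + 1 + 1 + 1 by ring, Finset.sum_range_succ,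
      Finset.sum_range_succ, ih, Finset.sum_range_succ _ (n + 1),
      hf (2 * n + 1) (by simp), add_zero]
    rfl

/-- The coefficients of `e^{-x²/2} L_n(x²)` with respect to the Hermite functions `h_m`. -/
def lagToHerm (m n : ℕ) : ℝ :=
  if Even m ∧ m ≤ 2 * n then binC (1 / 2) (n - m / 2) * (hermiteRatio (m / 2))⁻¹ else 0

/-- The coefficients of the even part of `h_m` with respect to the functions `e^{-x²/2} L_k(x²)`. -/
def hermToLag (k m : ℕ) : ℝ :=
  if Even m ∧ 2 * k ≤ m then hermiteRatio (m / 2) * binC (-1 / 2) (m / 2 - k) else 0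

theorem lagFun_sq_expansion (n : ℕ) (x : ℝ) :
    ∑ m ∈ Finset.range (2 * n + 1), lagToHerm m n * hermiteFun m x = lagFun n (x ^ 2) := by
  rw [sum_range_even (fun m hm => by simp [lagToHerm, hm]), lagFun_sq_eq_sum]
  refine Finset.sum_congr rfl fun j hj => ?_
  have hj' : j ≤ n := Nat.lt_succ_iff.1 (Finset.mem_range.1 hj)
  rw [lagToHerm, if_pos ⟨even_two_mul j, by omega⟩, Nat.mul_div_cancel_left j two_pos]

theorem hermiteFun_even_expansion (m : ℕ) (x : ℝ) :
    ∑ k ∈ Finset.range (2 * m + 1), hermToLag k m * lagFun k (x ^ 2)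
      = (hermiteFun m x + hermiteFun m (-x)) / 2 := by
  rw [hermiteFun_neg]
  rcases Nat.even_or_odd' m with ⟨n, rfl | rfl⟩
  · rw [pow_mul, neg_one_sq, one_pow, one_mul, add_self_div_two, hermiteFun_even_eq_sum]
    -- The range is longer than necessary, so that it has the form `k ≤ 2m` shared by all
    -- `IsTriangular` matrices; the additional entries are zero.
    refine (Finset.sum_subset_zero_on_sdiff (Finset.range_subset_range.2 (by omega)) ?_ ?_).symm
    · intro k hk
      rw [Finset.mem_sdiff, Finset.mem_range, Finset.mem_range] at hk
      rw [hermToLag, if_neg (by omega), zero_mul]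
    · intro k hk
      rw [Finset.mem_range] at hk
      rw [hermToLag, if_pos ⟨even_two_mul n, by omega⟩, Nat.mul_div_cancel_left n two_pos]
  · rw [(odd_two_mul_add_one n).neg_one_pow]
    have : ∀ k, hermToLag k (2 * n + 1) = 0 := fun k => by
      rw [hermToLag, if_neg (by simp)]
    simp [this]

theorem lagToHerm_abs_le (m n : ℕ) : |lagToHerm m n| ≤ 2 * (n + 1) := by
  have hn : (0 : ℝ) ≤ n := n.cast_nonneg
  rw [lagToHerm]
  split_ifs
  · rw [abs_mul]
    have h1 := binC_abs_le (s := 1 / 2) (by norm_num [abs_of_pos]) (n - m / 2)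
    have h2 := hermiteRatio_inv_abs_le (m / 2)
    nlinarith [abs_nonneg (binC (1 / 2) (n - m / 2)), abs_nonneg (hermiteRatio (m / 2))⁻¹]
  · rw [abs_zero]; positivity

theorem hermToLag_abs_le (k m : ℕ) : |hermToLag k m| ≤ 2 * (m + 1) := by
  have hn : (0 : ℝ) ≤ m := m.cast_nonneg
  rw [hermToLag]
  split_ifs
  · rw [abs_mul]
    have h1 := binC_abs_le (s := -1 / 2) (by norm_num [abs_div]) (m / 2 - k)
    have h2 := hermiteRatio_abs_le (m / 2)
    have h3 : 2 * ((m / 2 : ℕ) : ℝ) ≤ m := by exact_mod_cast Nat.mul_div_le m 2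
    nlinarith [abs_nonneg (binC (-1 / 2) (m / 2 - k)), abs_nonneg (hermiteRatio (m / 2))]
  · rw [abs_zero]; positivity

theorem lagToHerm_eq_zero {m n : ℕ} (h : 2 * n < m) : lagToHerm m n = 0 := by
  rw [lagToHerm, if_neg (by omega)]

theorem hermToLag_eq_zero {k m : ℕ} (h : 2 * m < k) : hermToLag k m = 0 := by
  rw [hermToLag, if_neg (by omega)]

/-! ## The generating function of the Laguerre functions -/

theorem lagFun_abs_le (n : ℕ) {x : ℝ} (hx : 0 ≤ x) : |lagFun n x| ≤ 2 * n + 1 := by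
  have h := lagFun_sq_le n hx
  have hn : (0 : ℝ) ≤ n := n.cast_nonneg
  exact abs_le_of_sq_le_sq (by nlinarith) (by positivity)

theorem summable_lagFun_deriv_bound {ρ : ℝ} (h0 : 0 < ρ) (h1 : ρ < 1) :
    Summable fun n : ℕ => (2 * (n : ℝ) + 1) * (n * ρ ^ (n - 1)) := by
  have h2 := summable_pow_mul_geometric_of_norm_lt_one (R := ℝ) 2 (r := ρ)
    (by rwa [Real.norm_eq_abs, abs_of_pos h0])
  have h3 := summable_pow_mul_geometric_of_norm_lt_one (R := ℝ) 1 (r := ρ)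
    (by rwa [Real.norm_eq_abs, abs_of_pos h0])
  refine (((h2.mul_left 2).add h3).mul_left ρ⁻¹).congr fun n => ?_
  rcases n with _ | n
  · simp
  · rw [Nat.add_sub_cancel]
    field_simp
    ring

theorem summable_lagFun_norm {x : ℝ} (hx : 0 ≤ x) {r : ℂ} (hr : ‖r‖ < 1) :
    Summable fun n : ℕ => ‖r ^ n * (lagFun n x : ℂ)‖ := by
  have h2 := summable_pow_mul_geometric_of_norm_lt_one (R := ℝ) 1 (r := ‖r‖) (by simpa using hr)
  have h3 := summable_pow_mul_geometric_of_norm_lt_one (R := ℝ) 0 (r := ‖r‖) (by simpa using hr)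
  refine Summable.of_nonneg_of_le (fun n => norm_nonneg _) (fun n => ?_) ((h2.mul_left 2).add h3)
  rw [norm_mul, norm_pow, Complex.norm_real, Real.norm_eq_abs]
  have := mul_le_mul_of_nonneg_left (lagFun_abs_le n hx) (pow_nonneg (norm_nonneg r) n)
  simp only [pow_one, pow_zero]
  linarith

theorem lagFun_series_hasDerivAt {x : ℝ} (hx : 0 ≤ x) {r : ℂ} (hr : ‖r‖ < 1) :
    HasDerivAt (fun z : ℂ => ∑' n : ℕ, z ^ n * (lagFun n x : ℂ))
      (∑' n : ℕ, n * r ^ (n - 1) * (lagFun n x : ℂ)) r ∧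
    Summable fun n : ℕ => n * r ^ (n - 1) * (lagFun n x : ℂ) := by
  obtain ⟨ρ, hρ1, hρ2⟩ := exists_between hr
  have hρ0 : 0 < ρ := (norm_nonneg r).trans_lt hρ1
  have hb : ∀ (n : ℕ) (y : ℂ), y ∈ Metric.ball (0 : ℂ) ρ →
      ‖(n : ℂ) * y ^ (n - 1) * (lagFun n x : ℂ)‖ ≤ (2 * (n : ℝ) + 1) * (n * ρ ^ (n - 1)) := by
    intro n y hy
    rw [mem_ball_zero_iff] at hy
    rw [norm_mul, norm_mul, norm_pow, Complex.norm_real, Real.norm_eq_abs, Complex.norm_natCast,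
      mul_comm]
    have := lagFun_abs_le n hx
    gcongr
  have hs := summable_lagFun_deriv_bound hρ0 hρ2
  have hrb : r ∈ Metric.ball (0 : ℂ) ρ := by rwa [mem_ball_zero_iff]
  refine ⟨hasDerivAt_tsum_of_isPreconnected hs Metric.isOpen_ball
    (convex_ball (0 : ℂ) ρ).isPreconnected (fun n y _ => ?_) hb
    (Metric.mem_ball_self hρ0) (summable_lagFun_norm hx (by simp)).of_norm hrb,
    Summable.of_norm_bounded hs fun n => hb n r hrb⟩
  exact (hasDerivAt_pow n y).mul_const _

/-- The three-term recursion, multiplied by `r^n` and summed. The shifted series are expressed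
through `F` and `F'`: raising the degree gives `F'`, and lowering it gives `r² F' + r F`. -/
theorem lagFun_series_ode {x : ℝ} (hx : 0 ≤ x) {r : ℂ} (hr : ‖r‖ < 1) :
    (1 - r) ^ 2 * (∑' n : ℕ, n * r ^ (n - 1) * (lagFun n x : ℂ))
      = (1 - r - x) * ∑' n : ℕ, r ^ n * (lagFun n x : ℂ) := by
  have hF := (summable_lagFun_norm hx hr).of_norm.hasSum
  have hF' := (lagFun_series_hasDerivAt hx hr).2.hasSum
  set F := ∑' n : ℕ, r ^ n * (lagFun n x : ℂ)
  set F' := ∑' n : ℕ, n * r ^ (n - 1) * (lagFun n x : ℂ)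
  have hA : HasSum (fun n : ℕ => ((n : ℂ) + 1) * r ^ n * (lagFun (n + 1) x : ℂ)) F' := by
    have := (hasSum_nat_add_iff' 1).2 hF'
    simpa using this
  have hB : HasSum (fun n : ℕ => (n : ℂ) * r ^ n * (lagFun n x : ℂ)) (r * F') := by
    refine (hF'.mul_left r).congr_fun fun n => ?_
    rcases n with _ | n
    · simp
    · rw [Nat.add_sub_cancel]; ring
  have hC : HasSum (fun n : ℕ => (n : ℂ) * r ^ n * (lagFun (n - 1) x : ℂ))
      (r * (r * F') + r * F) := by
    refine (hasSum_nat_add_iff' 1).1 ?_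
    simp only [Finset.range_one, Finset.sum_singleton, Nat.cast_zero, zero_mul, sub_zero,
      Nat.add_sub_cancel]
    refine ((hB.mul_left r).add (hF.mul_left r)).congr_fun fun n => ?_
    push_cast
    ring
  have h0 := (((hA.sub (hB.mul_left 2)).sub hF).add (hF.mul_left (x : ℂ))).add hC
  have h1 := h0.unique (hasSum_zero.congr_fun fun n => ?_)
  · linear_combination h1
  · have h2 : (x : ℂ) * (lagFun n x : ℂ) = (2 * n + 1) * (lagFun n x : ℂ)
        - (n + 1) * (lagFun (n + 1) x : ℂ) - n * (lagFun (n - 1) x : ℂ) := by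
      exact_mod_cast congrArg (fun t : ℝ => (t : ℂ)) (lagFun_three_term n x)
    linear_combination r ^ n * h2

/-- By the differential equation, `F(z) (1 - z) e^{x(1+z)/(2(1-z))}` has derivative zero on the unit
disc, so it equals its value `1` at the origin. -/
theorem lagFun_generating {x : ℝ} (hx : 0 ≤ x) {r : ℂ} (hr : ‖r‖ < 1) :
    (1 - r) * ∑' n : ℕ, r ^ n * (lagFun n x : ℂ)
      = Complex.exp (-(x * ((1 + r) / (2 * (1 - r))))) := by
  have hne : ∀ z : ℂ, ‖z‖ < 1 → 1 - z ≠ 0 := by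
    intro z hz h
    rw [← sub_eq_zero.1 h, norm_one] at hz
    exact lt_irrefl _ hz
  set F : ℂ → ℂ := fun z => ∑' n : ℕ, z ^ n * (lagFun n x : ℂ) with hF
  set G : ℂ → ℂ := fun z => F z * (1 - z) * Complex.exp (x * ((1 + z) / (2 * (1 - z)))) with hG
  have hd : ∀ z : ℂ, ‖z‖ < 1 → HasDerivAt G 0 z := by
    intro z hz
    have h1 := (lagFun_series_hasDerivAt hx hz).1
    have h2 := lagFun_series_ode hx hz
    have hz0 := hne z hz
    have h3 := (((hasDerivAt_id' z).const_add 1).fun_div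
      (((hasDerivAt_id' z).const_sub 1).const_mul 2)
      (mul_ne_zero two_ne_zero hz0)).const_mul (x : ℂ)
    refine ((h1.fun_mul ((hasDerivAt_id' z).const_sub 1)).fun_mul h3.cexp).congr_deriv ?_
    generalize Complex.exp (x * ((1 + z) / (2 * (1 - z)))) = e
    field_simp
    linear_combination 2 * e * h2
  have hconst : G r = G 0 := by
    refine Metric.isOpen_ball.is_const_of_deriv_eq_zero (convex_ball (0 : ℂ) 1).isPreconnected
      (fun z hz => (hd z (by simpa using hz)).differentiableAt.differentiableWithinAt)
      (fun z hz => (hd z (by simpa using hz)).deriv) (by simpa using hr) (by simp)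
  have h0 : G 0 = 1 := by
    have : F 0 = (Real.exp (-x / 2) : ℂ) := by
      rw [hF]
      simp only
      rw [tsum_eq_single 0 fun n hn => by simp [hn]]
      simp [lagFun, lag_zero]
    rw [hG]
    simp only
    rw [this, Complex.ofReal_exp, sub_zero, mul_one, ← Complex.exp_add]
    push_cast
    rw [show -(x : ℂ) / 2 + x * ((1 + 0) / (2 * 1)) = 0 by ring, Complex.exp_zero]
  rw [h0, hG] at hconst
  simp only at hconst
  rw [Complex.exp_neg, mul_comm (1 - r)]
  exact eq_inv_of_mul_eq_one_left hconst

/-- Expansion of `e^{-sx}` in Laguerre functions. -/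
theorem exists_lagFun_expansion_exp {s : ℂ} (hs : 0 < s.re) : ∃ r : ℂ, ‖r‖ < 1 ∧
    ∀ x : ℝ, 0 ≤ x → (1 - r) * ∑' n : ℕ, r ^ n * (lagFun n x : ℂ) = Complex.exp (-(x * s)) := by
  have h1 : (2 * s + 1) ≠ 0 := by
    intro h
    have := congrArg Complex.re h
    simp at this
    linarith
  -- The witness solves `(1 + r) / (2 (1 - r)) = s`; this Möbius map takes the right half-plane to
  -- the unit disc.
  have hr : ‖(2 * s - 1) / (2 * s + 1)‖ < 1 := by
    rw [norm_div, div_lt_one (norm_pos_iff.2 h1)]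
    refine lt_of_pow_lt_pow_left₀ 2 (norm_nonneg _) ?_
    rw [Complex.sq_norm, Complex.sq_norm, Complex.normSq_apply, Complex.normSq_apply]
    simp
    nlinarith
  refine ⟨_, hr, fun x hx => ?_⟩
  rw [lagFun_generating hx hr]
  congr 3
  have : 2 * s + 1 - (2 * s - 1) ≠ 0 := by ring_nf; norm_num
  field_simp
  ring

theorem tsum_prod_pi {d : ℕ} (f : Fin d → ℕ → ℂ) (hf : ∀ j, Summable fun k => ‖f j k‖) :
    (Summable fun n : Fin d → ℕ => ‖∏ j, f j (n j)‖) ∧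
      ∑' n : Fin d → ℕ, ∏ j, f j (n j) = ∏ j, ∑' k, f j k := by
  induction d with
  | zero =>
    refine ⟨(hasSum_fintype _).summable, ?_⟩
    rw [tsum_fintype]
    simp
  | succ d ih =>
    obtain ⟨h1, h2⟩ := ih (fun j => f j.succ) fun j => hf j.succ
    let e := Fin.consEquiv (fun _ : Fin (d + 1) => ℕ)
    have he : ∀ p : ℕ × (Fin d → ℕ), ∏ j, f j (e p j) = f 0 p.1 * ∏ j, f (Fin.succ j) (p.2 j) := by
      intro p
      rw [Fin.prod_univ_succ]
      rfl
    refine ⟨?_, ?_⟩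
    · rw [← e.summable_iff]
      refine ((hf 0).mul_of_nonneg h1 (fun _ => norm_nonneg _) fun _ => norm_nonneg _).congr
        fun p => ?_
      simp only [Function.comp]
      rw [he, norm_mul]
    · rw [← e.tsum_eq, Fin.prod_univ_succ, ← h2, tsum_mul_tsum_of_summable_norm (hf 0) h1]
      exact tsum_congr fun p => he p

/-! ## Maps between sequence spaces -/

variable {d : ℕ}

/-- The polynomial weight `∏ (n_j + 1)`. -/
def polyW (n : Fin d → ℕ) : ℝ := ∏ j, ((n j : ℝ) + 1)

theorem one_le_polyW (n : Fin d → ℕ) : 1 ≤ polyW n :=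
  Finset.one_le_prod (fun j => by simp)

theorem polyW_pos (n : Fin d → ℕ) : 0 < polyW n := zero_lt_one.trans_le (one_le_polyW n)

theorem polyW_le_of_le_two_mul {m n : Fin d → ℕ} (h : ∀ j, m j ≤ 2 * n j) :
    polyW m ≤ 2 ^ d * polyW n := by
  have : (2 : ℝ) ^ d = ∏ _j : Fin d, (2 : ℝ) := by simp
  rw [polyW, polyW, this, ← Finset.prod_mul_distrib]
  refine Finset.prod_le_prod (fun _ _ => by positivity) fun j _ => ?_
  have : (m j : ℝ) ≤ 2 * n j := by exact_mod_cast h j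
  linarith

theorem weight_add (h k β : ℝ) (n : Fin d → ℕ) :
    weight (h + k) β n = weight h β n * weight k β n := by
  rw [weight, weight, weight, ← Real.exp_add, add_mul]

theorem weight_neg_mul (h β : ℝ) (n : Fin d → ℕ) : weight h β n * weight (-h) β n = 1 := by
  rw [← weight_add, add_neg_cancel, weight, zero_mul, Real.exp_zero]

/-- The weight dominates even `polyW n ^ (p + 2)`; the two spare powers leave the summable product
`∏ (n_j + 1)^{-2}`. -/
theorem summable_polyW_weight {β : ℝ} (hβ : 0 < β) (p : ℕ) :
    Summable fun n : Fin d → ℕ => polyW n ^ p * weight (-1) β n := by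
  obtain ⟨C, hC0, hC⟩ := weight_bound β hβ (d * (p + 2))
  refine Summable.of_nonneg_of_le
    (fun n => mul_nonneg (pow_nonneg (polyW_pos n).le _) (weight_pos _ _ _).le) (fun n => ?_)
    ((summable_pi_inv d).mul_left C)
  have h1 : polyW n ^ (p + 2) ≤ C * weight 1 β n := by
    have h2 := hC (∑ j, n j)
    rw [weight, one_mul]
    refine le_trans ?_ h2
    rw [pow_mul]
    gcongr
    · exact (polyW_pos n).le
    · calc polyW n ≤ ∏ _j : Fin d, (((∑ j, n j : ℕ) : ℝ) + 1) := by
            refine Finset.prod_le_prod (fun _ _ => by positivity) fun j _ => ?_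
            have : n j ≤ ∑ j, n j :=
              Finset.single_le_sum (f := n) (fun _ _ => Nat.zero_le _) (Finset.mem_univ j)
            have : (n j : ℝ) ≤ ((∑ j, n j : ℕ) : ℝ) := by exact_mod_cast this
            gcongr
        _ = _ := by rw [Finset.prod_const, Finset.card_univ, Fintype.card_fin]
  have h3 : ∏ j, (((n j : ℝ) + 1) ^ 2)⁻¹ = (polyW n ^ 2)⁻¹ := by
    rw [polyW, Finset.prod_inv_distrib, Finset.prod_pow]
  rw [h3]
  have hp := polyW_pos n
  have hw := weight_neg_mul 1 β n
  have hw0 := weight_pos (-1) β n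
  calc polyW n ^ p * weight (-1) β n
      = polyW n ^ (p + 2) * weight (-1) β n * (polyW n ^ 2)⁻¹ := by field_simp; ring
    _ ≤ (C * weight 1 β n) * weight (-1) β n * (polyW n ^ 2)⁻¹ := by gcongr
    _ = _ := by rw [mul_assoc C, hw, mul_one]

/-- The sum of the series `∑ ∏ (n_j + 1)^p e^{-|n|^{1/(2β)}}`. -/
def polySum (d : ℕ) (β : ℝ) (p : ℕ) : ℝ := ∑' n : Fin d → ℕ, polyW n ^ p * weight (-1) β n

theorem polySum_nonneg (d : ℕ) (β : ℝ) (p : ℕ) : 0 ≤ polySum d β p :=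
  tsum_nonneg fun n => mul_nonneg (pow_nonneg (polyW_pos n).le _) (weight_pos _ _ _).le

theorem le_seqNorm {β : ℝ} (a : SeqSpace d β) (h : {h : ℝ // 0 < h}) (n : Fin d → ℕ) :
    ‖a n‖ * weight h.1 β n ≤ seqNorm d β h a := le_ciSup (a.2 h.1 h.2) n

/-- Passing from `h` to `h + 1` gains a factor `e^{-|n|^{1/(2β)}}`, which pays for polynomial
factors and for summation over `n`. Only `h + 1` has to be positive, so `h = 0` is allowed and
yields plain rapid decrease. -/
theorem norm_mul_weight_le {β h : ℝ} (hh : 0 < h + 1) (a : SeqSpace d β) (p : ℕ)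
    (n : Fin d → ℕ) : ‖a n‖ * weight h β n * polyW n ^ p
      ≤ seqNorm d β ⟨h + 1, hh⟩ a * (polyW n ^ p * weight (-1) β n) := by
  have h1 := le_seqNorm a ⟨h + 1, hh⟩ n
  have h2 : weight h β n = weight (h + 1) β n * weight (-1) β n := by
    rw [← weight_add, add_neg_cancel_right]
  have hp := polyW_pos n
  have hw := weight_pos (-1) β n
  calc ‖a n‖ * weight h β n * polyW n ^ p
      = (‖a n‖ * weight (h + 1) β n) * (polyW n ^ p * weight (-1) β n) := by rw [h2]; ring
    _ ≤ _ := by gcongr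

theorem summable_norm_mul_weight {β h : ℝ} (hβ : 0 < β) (hh : 0 < h + 1) (a : SeqSpace d β)
    (p : ℕ) : Summable fun n => ‖a n‖ * weight h β n * polyW n ^ p :=
  Summable.of_nonneg_of_le (fun n => mul_nonneg (mul_nonneg (norm_nonneg _) (weight_pos _ _ _).le)
    (pow_nonneg (polyW_pos n).le _)) (norm_mul_weight_le hh a p)
    ((summable_polyW_weight hβ p).mul_left _)

theorem tsum_norm_mul_weight_le {β h : ℝ} (hβ : 0 < β) (hh : 0 < h + 1) (a : SeqSpace d β)
    (p : ℕ) : ∑' n, ‖a n‖ * weight h β n * polyW n ^ p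
      ≤ polySum d β p * seqNorm d β ⟨h + 1, hh⟩ a := by
  rw [polySum, ← tsum_mul_right]
  refine (summable_norm_mul_weight hβ hh a p).tsum_le_tsum (fun n => ?_)
    ((summable_polyW_weight hβ p).mul_right _)
  rw [mul_comm _ (seqNorm d β _ a)]
  exact norm_mul_weight_le hh a p n

theorem summable_norm_mul_polyW {β : ℝ} (hβ : 0 < β) (a : SeqSpace d β) (p : ℕ) :
    Summable fun n => ‖a n‖ * polyW n ^ p := by
  have := summable_norm_mul_weight hβ (h := 0) (by norm_num) a p
  simpa [weight] using this

/-- A matrix with polynomially bounded entries, whose entry `(m, n)` vanishes unless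
`m_j ≤ 2 n_j` for all `j`. -/
structure IsTriangular (M : (Fin d → ℕ) → (Fin d → ℕ) → ℝ) : Prop where
  bound : ∀ m n, |M m n| ≤ 2 ^ d * polyW n
  vanish : ∀ m n, (∃ j, 2 * n j < m j) → M m n = 0

/-- On the support of `M` one has `|m| ≤ 2|n|`, so the weight at `m` is at most the weight at `n`
with `h` replaced by `h · 2^{1/(2β)}`. Such a loss is harmless in an intersection over all `h > 0`.
-/
theorem IsTriangular.entry_weight_le {M : (Fin d → ℕ) → (Fin d → ℕ) → ℝ} (hM : IsTriangular M)
    {β h : ℝ} (hβ : 0 < β) (hh : 0 < h) (m n : Fin d → ℕ) :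
    |M m n| * weight h β m ≤ 2 ^ d * polyW n * weight (h * 2 ^ (1 / (2 * β))) β n := by
  by_cases hmn : ∃ j, 2 * n j < m j
  · rw [hM.vanish m n hmn, abs_zero, zero_mul]
    have := polyW_pos n
    have := weight_pos (h * 2 ^ (1 / (2 * β))) β n
    positivity
  · push Not at hmn
    refine mul_le_mul (hM.bound m n) ?_ (weight_pos _ _ _).le
      (mul_nonneg (by positivity) (polyW_pos n).le)
    unfold weight
    rw [mul_assoc, ← Real.mul_rpow (by norm_num) (Nat.cast_nonneg _)]
    have : ((∑ j, m j : ℕ) : ℝ) ≤ 2 * ((∑ j, n j : ℕ) : ℝ) := by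
      exact_mod_cast (Finset.sum_le_sum fun j _ => hmn j).trans_eq (Finset.mul_sum _ _ _).symm
    gcongr

theorem IsTriangular.term_le {M : (Fin d → ℕ) → (Fin d → ℕ) → ℝ} (hM : IsTriangular M)
    {β h : ℝ} (hβ : 0 < β) (hh : 0 < h) (a : SeqSpace d β) (m n : Fin d → ℕ) :
    ‖(M m n : ℂ) * a n‖ * weight h β m
      ≤ 2 ^ d * (‖a n‖ * weight (h * 2 ^ (1 / (2 * β))) β n * polyW n ^ 1) := by
  have h1 := mul_le_mul_of_nonneg_left (hM.entry_weight_le hβ hh m n) (norm_nonneg (a n))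
  rw [norm_mul, Complex.norm_real, Real.norm_eq_abs]
  linarith

theorem IsTriangular.summable {M : (Fin d → ℕ) → (Fin d → ℕ) → ℝ} (hM : IsTriangular M)
    {β : ℝ} (hβ : 0 < β) (a : SeqSpace d β) (m : Fin d → ℕ) :
    Summable fun n => ‖(M m n : ℂ) * a n‖ := by
  refine Summable.of_nonneg_of_le (fun _ => norm_nonneg _) (fun n => ?_)
    ((summable_norm_mul_polyW hβ a 1).mul_left (2 ^ d))
  rw [norm_mul, Complex.norm_real, Real.norm_eq_abs]
  have := mul_le_mul_of_nonneg_left (hM.bound m n) (norm_nonneg (a n))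
  linarith

theorem IsTriangular.tsum_weight_le {M : (Fin d → ℕ) → (Fin d → ℕ) → ℝ} (hM : IsTriangular M)
    {β h : ℝ} (hβ : 0 < β) (hh : 0 < h) (hh' : 0 < h * 2 ^ (1 / (2 * β)) + 1)
    (a : SeqSpace d β) (m : Fin d → ℕ) :
    ‖∑' n, (M m n : ℂ) * a n‖ * weight h β m
      ≤ 2 ^ d * polySum d β 1 * seqNorm d β ⟨h * 2 ^ (1 / (2 * β)) + 1, hh'⟩ a := by
  have h1 := (hM.summable hβ a m).mul_right (weight h β m)
  calc ‖∑' n, (M m n : ℂ) * a n‖ * weight h β m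
      ≤ (∑' n, ‖(M m n : ℂ) * a n‖) * weight h β m :=
        mul_le_mul_of_nonneg_right (norm_tsum_le_tsum_norm (hM.summable hβ a m))
          (weight_pos _ _ _).le
    _ = ∑' n, ‖(M m n : ℂ) * a n‖ * weight h β m := tsum_mul_right.symm
    _ ≤ ∑' n, 2 ^ d * (‖a n‖ * weight (h * 2 ^ (1 / (2 * β))) β n * polyW n ^ 1) :=
        h1.tsum_le_tsum (hM.term_le hβ hh a m) ((summable_norm_mul_weight hβ hh' a 1).mul_left _)
    _ ≤ _ := by
        rw [tsum_mul_left, mul_assoc]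
        exact mul_le_mul_of_nonneg_left (tsum_norm_mul_weight_le hβ hh' a 1) (by positivity)

theorem stretch_pos {β h : ℝ} (hh : 0 < h) : 0 < h * 2 ^ (1 / (2 * β)) + 1 := by positivity

/-- The linear map on sequences given by a triangular matrix. -/
def IsTriangular.map {M : (Fin d → ℕ) → (Fin d → ℕ) → ℝ} (hM : IsTriangular M)
    {β : ℝ} (hβ : 0 < β) : SeqSpace d β →ₗ[ℂ] SeqSpace d β where
  toFun a := ⟨fun m => ∑' n, (M m n : ℂ) * a n, fun h hh =>
    ⟨_, by rintro _ ⟨m, rfl⟩; exact hM.tsum_weight_le hβ hh (stretch_pos hh) a m⟩⟩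
  map_add' a b := by
    refine Subtype.ext (funext fun m => ?_)
    change ∑' n, (M m n : ℂ) * (a n + b n) = ∑' n, (M m n : ℂ) * a n + ∑' n, (M m n : ℂ) * b n
    rw [← (hM.summable hβ a m).of_norm.tsum_add (hM.summable hβ b m).of_norm]
    exact tsum_congr fun n => mul_add _ _ _
  map_smul' c a := by
    refine Subtype.ext (funext fun m => ?_)
    change ∑' n, (M m n : ℂ) * (c * a n) = c * ∑' n, (M m n : ℂ) * a n
    rw [← tsum_mul_left]
    exact tsum_congr fun n => mul_left_comm _ _ _

theorem IsTriangular.map_apply {M : (Fin d → ℕ) → (Fin d → ℕ) → ℝ} (hM : IsTriangular M)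
    {β : ℝ} (hβ : 0 < β) (a : SeqSpace d β) (m : Fin d → ℕ) :
    hM.map hβ a m = ∑' n, (M m n : ℂ) * a n := rfl

theorem IsTriangular.seqNorm_map_le {M : (Fin d → ℕ) → (Fin d → ℕ) → ℝ} (hM : IsTriangular M)
    {β : ℝ} (hβ : 0 < β) (h : {h : ℝ // 0 < h}) (a : SeqSpace d β) :
    seqNorm d β h (hM.map hβ a) ≤ 2 ^ d * polySum d β 1
      * seqNorm d β ⟨h.1 * 2 ^ (1 / (2 * β)) + 1, stretch_pos h.2⟩ a :=
  ciSup_le fun m => hM.tsum_weight_le hβ h.2 (stretch_pos h.2) a m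

/-- Interchange of summation for a triangular matrix. -/
theorem IsTriangular.tsum_map_mul {M : (Fin d → ℕ) → (Fin d → ℕ) → ℝ} (hM : IsTriangular M)
    {β : ℝ} (hβ : 0 < β) (a : SeqSpace d β) {φ : (Fin d → ℕ) → ℂ} {C : ℝ} {p : ℕ}
    (hφ : ∀ m, ‖φ m‖ ≤ C * polyW m ^ p) :
    ∑' m, hM.map hβ a m * φ m
      = ∑' n, a n * ∑ m ∈ Fintype.piFinset fun j => Finset.range (2 * n j + 1), M m n * φ m := by
  have hC : 0 ≤ C := by
    have := (norm_nonneg _).trans (hφ 0)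
    exact nonneg_of_mul_nonneg_left this (pow_pos (polyW_pos 0) p)
  set S : (Fin d → ℕ) → Finset (Fin d → ℕ) :=
    fun n => Fintype.piFinset fun j => Finset.range (2 * n j + 1) with hS
  set f : (Fin d → ℕ) → (Fin d → ℕ) → ℂ := fun n m => (M m n : ℂ) * a n * φ m with hf
  have hmem : ∀ n m, m ∈ S n ↔ ∀ j, m j ≤ 2 * n j := by
    intro n m
    simp [hS, Fintype.mem_piFinset]
  have hzero : ∀ n m, m ∉ S n → f n m = 0 := by
    intro n m h
    rw [hmem] at h
    push Not at h
    simp [hf, hM.vanish m n h]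
  have hcard : ∀ n, ((S n).card : ℝ) ≤ 2 ^ d * polyW n := by
    intro n
    have : (2 : ℝ) ^ d = ∏ _j : Fin d, (2 : ℝ) := by simp
    simp only [hS, Fintype.card_piFinset, Finset.card_range]
    rw [this, polyW, ← Finset.prod_mul_distrib]
    push_cast
    refine Finset.prod_le_prod (fun _ _ => by positivity) fun j _ => by linarith
  have hterm : ∀ n, ∀ m ∈ S n,
      ‖f n m‖ ≤ (2 ^ d * polyW n) * ‖a n‖ * (C * (2 ^ d * polyW n) ^ p) := by
    intro n m hm
    have h1 := polyW_le_of_le_two_mul ((hmem n m).1 hm)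
    have h2 := polyW_pos m
    have h3 := polyW_pos n
    simp only [hf]
    rw [norm_mul, norm_mul, Complex.norm_real, Real.norm_eq_abs]
    have h4 := hM.bound m n
    have h5 := hφ m
    gcongr
    exact h5.trans (by gcongr)
  have hsum : Summable (Function.uncurry f) := by
    refine Summable.of_norm ?_
    rw [summable_prod_of_nonneg fun _ => norm_nonneg _]
    refine ⟨fun n => summable_of_ne_finset_zero (s := S n) fun m hm => by
      simp [Function.uncurry, hzero n m hm], ?_⟩
    -- The exponent `p + 2` collects one power for the number of terms in column `n`, one for the
    -- size of the entries, and `p` for `φ`.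
    refine Summable.of_nonneg_of_le (fun n => tsum_nonneg fun m => norm_nonneg _) (fun n => ?_)
      ((summable_norm_mul_polyW hβ a (p + 2)).mul_left (2 ^ d * 2 ^ d * C * (2 ^ d) ^ p))
    rw [tsum_eq_sum (s := S n) fun m hm => by simp [Function.uncurry, hzero n m hm]]
    refine (Finset.sum_le_card_nsmul _ _ _ fun m hm => hterm n m hm).trans ?_
    rw [nsmul_eq_mul]
    have h3 := polyW_pos n
    calc ((S n).card : ℝ) * ((2 ^ d * polyW n) * ‖a n‖ * (C * (2 ^ d * polyW n) ^ p))
        ≤ (2 ^ d * polyW n) * ((2 ^ d * polyW n) * ‖a n‖ * (C * (2 ^ d * polyW n) ^ p)) := by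
          gcongr
          exact hcard n
      _ = _ := by ring
  calc ∑' m, hM.map hβ a m * φ m = ∑' m, ∑' n, f n m := by
        refine tsum_congr fun m => ?_
        rw [hM.map_apply, ← tsum_mul_right]
    _ = ∑' n, ∑' m, f n m := hsum.tsum_comm
    _ = _ := by
        refine tsum_congr fun n => ?_
        rw [tsum_eq_sum (s := S n) fun m hm => hzero n m hm, Finset.mul_sum]
        exact Finset.sum_congr rfl fun m _ => by simp only [hf]; ring

/-! ### Continuity from seminorm estimates -/

theorem seqSpace_withSeminorms (d : ℕ) (β : ℝ) : WithSeminorms (seqNorm d β) := ⟨rfl⟩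

theorem pSpace_withSeminorms (d : ℕ) (α : ℝ) : WithSeminorms (etaNorm d α) := ⟨rfl⟩

theorem continuous_of_seminorm_le {E F ι ι' : Type*} [AddCommGroup E] [Module ℂ E]
    [TopologicalSpace E] [AddCommGroup F] [Module ℂ F] [TopologicalSpace F]
    {p : SeminormFamily ℂ E ι} {q : SeminormFamily ℂ F ι'} (hp : WithSeminorms p)
    (hq : WithSeminorms q) (f : E →ₗ[ℂ] F)
    (hf : ∀ i, ∃ (j : ι) (C : ℝ), 0 ≤ C ∧ ∀ x, q i (f x) ≤ C * p j x) : Continuous f := by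
  refine WithSeminorms.continuous_of_isBounded hp hq f fun i => ?_
  obtain ⟨j, C, hC0, hC⟩ := hf i
  refine ⟨{j}, ⟨C, hC0⟩, fun x => ?_⟩
  rw [Finset.sup_singleton]
  exact hC x

theorem IsTriangular.continuous_map {M : (Fin d → ℕ) → (Fin d → ℕ) → ℝ} (hM : IsTriangular M)
    {β : ℝ} (hβ : 0 < β) : Continuous (hM.map hβ) :=
  continuous_of_seminorm_le (seqSpace_withSeminorms d β) (seqSpace_withSeminorms d β) _ fun h =>
    ⟨_, _, mul_nonneg (by positivity) (polySum_nonneg d β 1), hM.seqNorm_map_le hβ h⟩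

/-! ### The matrices of the change of basis -/

theorem isTriangular_prod {M : ℕ → ℕ → ℝ} (h1 : ∀ m n, |M m n| ≤ 2 * (n + 1))
    (h2 : ∀ {m n}, 2 * n < m → M m n = 0) :
    IsTriangular fun m n : Fin d → ℕ => ∏ j, M (m j) (n j) where
  bound m n := by
    have : (2 : ℝ) ^ d = ∏ _j : Fin d, (2 : ℝ) := by simp
    rw [Finset.abs_prod, this, polyW, ← Finset.prod_mul_distrib]
    exact Finset.prod_le_prod (fun _ _ => abs_nonneg _) fun j _ => h1 _ _
  vanish m n := fun ⟨j, hj⟩ => Finset.prod_eq_zero (Finset.mem_univ j) (h2 hj)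

theorem isTriangular_lagToHerm :
    IsTriangular fun m n : Fin d → ℕ => ∏ j, lagToHerm (m j) (n j) :=
  isTriangular_prod lagToHerm_abs_le lagToHerm_eq_zero

theorem isTriangular_hermToLag :
    IsTriangular fun m n : Fin d → ℕ => ∏ j, hermToLag (m j) (n j) :=
  isTriangular_prod hermToLag_abs_le hermToLag_eq_zero

/-- The Laguerre functions of several variables. -/
def lagPi (n : Fin d → ℕ) (x : Fin d → ℝ) : ℂ := ∏ j, (lagFun (n j) (x j) : ℂ)

theorem hermiteFunPi_bound (x : Fin d → ℝ) :
    ∃ C : ℝ, ∀ n, ‖(hermiteFunPi n x : ℂ)‖ ≤ C * polyW n ^ 1 := by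
  choose C hC0 hC using fun j => hermiteFun_bound (x j)
  refine ⟨∏ j, C j, fun n => ?_⟩
  rw [Complex.norm_real, Real.norm_eq_abs, hermiteFunPi, Finset.abs_prod, pow_one, polyW,
    ← Finset.prod_mul_distrib]
  exact Finset.prod_le_prod (fun _ _ => abs_nonneg _) fun j _ => hC j (n j)

theorem lagPi_norm_le (n : Fin d → ℕ) {x : Fin d → ℝ} (hx : x ∈ closedOrthant d) :
    ‖lagPi n x‖ ≤ 2 ^ d * polyW n ^ 1 := by
  have : (2 : ℝ) ^ d = ∏ _j : Fin d, (2 : ℝ) := by simp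
  rw [lagPi, norm_prod, pow_one, polyW, this, ← Finset.prod_mul_distrib]
  refine Finset.prod_le_prod (fun _ _ => norm_nonneg _) fun j _ => ?_
  rw [Complex.norm_real, Real.norm_eq_abs]
  linarith [lagFun_abs_le (n j) (hx j)]

theorem vMap_mem (x : Fin d → ℝ) : vMap x ∈ closedOrthant d := fun j => sq_nonneg (x j)

/-- A Laguerre series, in the variables `x_j²`, is the Hermite series of the transformed
coefficients. -/
theorem hermiteSeries_lagToHerm {β : ℝ} (hβ : 0 < β) (a : SeqSpace d β) (x : Fin d → ℝ) :
    hermiteSeries d β hβ (isTriangular_lagToHerm.map hβ a) x = ∑' n, a n * lagPi n (vMap x) := by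
  obtain ⟨C, hC⟩ := hermiteFunPi_bound x
  change ∑' m, isTriangular_lagToHerm.map hβ a m * (hermiteFunPi m x : ℂ) = _
  rw [IsTriangular.tsum_map_mul _ hβ a hC]
  refine tsum_congr fun n => ?_
  congr 1
  have h := Finset.prod_univ_sum (fun j => Finset.range (2 * n j + 1))
    (fun j m => lagToHerm m (n j) * hermiteFun m (x j))
  simp only [lagFun_sq_expansion, Finset.prod_mul_distrib] at h
  have h' := congrArg (fun t : ℝ => (t : ℂ)) h
  push_cast at h'
  simp only [lagPi, vMap, h', hermiteFunPi]
  push_cast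
  rfl

/-- The even part of a function, in each variable. -/
def evenPart (F : (Fin d → ℝ) → ℂ) (x : Fin d → ℝ) : ℂ :=
  (2 ^ d)⁻¹ * ∑ ε : Fin d → Bool, F fun j => if ε j then x j else -x j

/-- The even part of a Hermite series is a Laguerre series in the variables `x_j²`. -/
theorem evenPart_hermiteSeries {β : ℝ} (hβ : 0 < β) (b : SeqSpace d β) (x : Fin d → ℝ) :
    evenPart (hermiteSeries d β hβ b) x
      = ∑' n, isTriangular_hermToLag.map hβ b n * lagPi n (vMap x) := by
  rw [IsTriangular.tsum_map_mul _ hβ b fun m => lagPi_norm_le m (vMap_mem x)]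
  change (2 ^ d : ℂ)⁻¹ * ∑ ε : Fin d → Bool,
    ∑' n, b n * (hermiteFunPi n (fun j => if ε j then x j else -x j) : ℂ) = _
  rw [← Summable.tsum_finsetSum fun ε _ => hermite_summable hβ b _, ← tsum_mul_left]
  refine tsum_congr fun n => ?_
  rw [← Finset.mul_sum, mul_left_comm]
  congr 1
  have h := Finset.prod_univ_sum (fun j => Finset.range (2 * n j + 1))
    (fun j m => hermToLag m (n j) * lagFun m (x j ^ 2))
  simp only [hermiteFun_even_expansion, Finset.prod_mul_distrib] at h
  have h' := congrArg (fun t : ℝ => (t : ℂ)) h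
  push_cast at h'
  simp only [lagPi, vMap]
  push_cast
  rw [← h']
  -- The sum over all sign patterns of a product of one-variable functions factorises into the
  -- product of the two-term sums.
  have h2 := Finset.prod_univ_sum (fun _ : Fin d => (Finset.univ : Finset Bool))
    (fun j ε => (hermiteFun (n j) (if ε then x j else -x j) : ℂ))
  rw [Fintype.piFinset_univ] at h2
  simp only [Fintype.sum_bool, if_true] at h2
  simp only [hermiteFunPi]
  push_cast
  rw [← h2]
  rw [Finset.prod_div_distrib]
  simp [div_eq_inv_mul]

theorem evenPart_eq_self {F : (Fin d → ℝ) → ℂ}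
    (hF : ∀ (x : Fin d → ℝ) (j : Fin d), F (Function.update x j (-x j)) = F x)
    (x : Fin d → ℝ) : evenPart F x = F x := by
  -- Evenness flips one coordinate at a time; induction on the set of flipped coordinates reaches
  -- every sign pattern.
  have key : ∀ (s : Finset (Fin d)), F (fun j => if j ∈ s then -x j else x j) = F x := by
    intro s
    induction s using Finset.induction_on with
    | empty => simp
    | insert i s hi ih =>
      rw [← ih, ← hF (fun j => if j ∈ s then -x j else x j) i]
      congr 1
      funext j
      by_cases hj : j = i
      · subst hj; simp [hi]
      · simp [hj]
  have : ∀ ε : Fin d → Bool, F (fun j => if ε j then x j else -x j) = F x := by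
    intro ε
    rw [← key (Finset.univ.filter fun j => ε j = false)]
    congr 1
    funext j
    cases h : ε j <;> simp [h]
  simp [evenPart, this]

/-! ## Families of functions with polynomially bounded derivatives on the orthant -/

/-- The weight `∏ (1 + x_j)`. -/
def wX (x : Fin d → ℝ) : ℝ := ∏ j, (1 + x j)

theorem orthant_subset (d : ℕ) : orthant d ⊆ closedOrthant d := fun _ hx j => (hx j).le

theorem one_le_wX {x : Fin d → ℝ} (hx : x ∈ closedOrthant d) : 1 ≤ wX x :=
  Finset.one_le_prod fun j _ => le_add_of_nonneg_right (hx j)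

theorem wX_pos {x : Fin d → ℝ} (hx : x ∈ closedOrthant d) : 0 < wX x :=
  zero_lt_one.trans_le (one_le_wX hx)

theorem le_wX {x : Fin d → ℝ} (hx : x ∈ closedOrthant d) (j : Fin d) : 1 + x j ≤ wX x := by
  rw [wX, ← Finset.mul_prod_erase _ _ (Finset.mem_univ j)]
  refine le_mul_of_one_le_right (add_nonneg zero_le_one (hx j)) (Finset.one_le_prod fun i _ => ?_)
  exact le_add_of_nonneg_right (hx i)

theorem continuous_wX : Continuous (wX : (Fin d → ℝ) → ℝ) := by
  unfold wX
  fun_prop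

theorem partialD_hasDerivAt {F : (Fin d → ℝ) → ℂ} {x : Fin d → ℝ} (hF : DifferentiableAt ℝ F x)
    (j : Fin d) : HasDerivAt (fun t => F (Function.update x j t)) (partialD j F x) (x j) := by
  have h := hF.hasFDerivAt
  rw [← Function.update_eq_self j x] at h
  have := h.comp_hasDerivAt (x j) (hasDerivAt_update x j (x j))
  rwa [Function.update_eq_self] at this

theorem fderiv_eq_sum_partialD (F : (Fin d → ℝ) → ℂ) (x : Fin d → ℝ) :
    fderiv ℝ F x = ∑ j, (ContinuousLinearMap.proj (R := ℝ) (φ := fun _ : Fin d => ℝ) j).smulRight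
      (partialD j F x) := by
  ext v
  rw [← ContinuousLinearMap.coe_coe, LinearMap.pi_apply_eq_sum_univ]
  simp only [ContinuousLinearMap.coe_coe, FunLike.coe_sum, Finset.sum_apply,
    ContinuousLinearMap.smulRight_apply, ContinuousLinearMap.proj_apply]
  refine Finset.sum_congr rfl fun j _ => ?_
  rw [partialD]
  congr 2
  funext i
  simp [Pi.single_apply, eq_comm]

theorem partialD_contDiff {F : (Fin d → ℝ) → ℂ} (hF : ContDiff ℝ ∞ F) (j : Fin d) :
    ContDiff ℝ ∞ (partialD j F) :=
  (hF.fderiv_right (by simp)).clm_apply contDiff_const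

/-- The derivative is the sum of the coordinate projections multiplied by the partial derivatives,
and projections have norm at most `1` for the sup norm. Total derivatives are thus controlled by
partial ones, which are explicit for Laguerre functions. -/
theorem norm_iteratedFDeriv_succ_le {F : (Fin d → ℝ) → ℂ} (hF : ContDiff ℝ ∞ F) (m : ℕ)
    (x : Fin d → ℝ) :
    ‖iteratedFDeriv ℝ (m + 1) F x‖ ≤ ∑ j, ‖iteratedFDeriv ℝ m (partialD j F) x‖ := by
  have hm : ∀ j, ContDiff ℝ m (partialD j F) := fun j =>
    (partialD_contDiff hF j).of_le (by exact_mod_cast le_top)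
  set T : Fin d → ℂ →L[ℝ] ((Fin d → ℝ) →L[ℝ] ℂ) := fun j =>
    ContinuousLinearMap.smulRightL ℝ (Fin d → ℝ) ℂ (ContinuousLinearMap.proj j) with hT
  have hTn : ∀ j, ‖T j‖ ≤ 1 := by
    intro j
    refine ContinuousLinearMap.opNorm_le_bound _ zero_le_one fun c => ?_
    change ‖(ContinuousLinearMap.proj (R := ℝ) (φ := fun _ : Fin d => ℝ) j).smulRight c‖ ≤ _
    rw [ContinuousLinearMap.norm_smulRight_apply]
    refine mul_le_mul_of_nonneg_right ?_ (norm_nonneg c)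
    refine ContinuousLinearMap.opNorm_le_bound _ zero_le_one fun v => ?_
    rw [one_mul]
    exact norm_le_pi_norm v j
  have h1 : fderiv ℝ F = fun x => ∑ j, (T j ∘ partialD j F) x := by
    funext x
    rw [fderiv_eq_sum_partialD]
    rfl
  rw [← norm_iteratedFDeriv_fderiv, h1,
    iteratedFDeriv_fun_sum_apply fun j _ => ((T j).contDiff.comp (hm j)).contDiffAt]
  refine (norm_sum_le _ _).trans (Finset.sum_le_sum fun j _ => ?_)
  refine ((T j).norm_iteratedFDeriv_comp_left (hm j).contDiffAt le_rfl).trans ?_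
  exact mul_le_of_le_one_left (norm_nonneg _) (hTn j)

/-- A partial derivative is the total derivative evaluated at a unit vector, a linear map of norm at
most `1`. It makes `PolyFamily` stable under `partialD`. -/
theorem norm_iteratedFDeriv_partialD_le {F : (Fin d → ℝ) → ℂ} (hF : ContDiff ℝ ∞ F) (j : Fin d)
    (m : ℕ) (x : Fin d → ℝ) :
    ‖iteratedFDeriv ℝ m (partialD j F) x‖ ≤ ‖iteratedFDeriv ℝ (m + 1) F x‖ := by
  have hm : ContDiff ℝ m (fderiv ℝ F) :=
    (hF.fderiv_right (m := ∞) (by simp)).of_le (by exact_mod_cast le_top)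
  set T : ((Fin d → ℝ) →L[ℝ] ℂ) →L[ℝ] ℂ :=
    ContinuousLinearMap.apply ℝ ℂ (Pi.single j 1 : Fin d → ℝ) with hT
  have hTn : ‖T‖ ≤ 1 := by
    refine ContinuousLinearMap.opNorm_le_bound _ zero_le_one fun L => ?_
    rw [one_mul, hT, ContinuousLinearMap.apply_apply]
    refine (L.le_opNorm _).trans (mul_le_of_le_one_right (norm_nonneg _) ?_)
    rw [Pi.norm_single, norm_one]
  rw [← norm_iteratedFDeriv_fderiv]
  refine (T.norm_iteratedFDeriv_comp_left hm.contDiffAt le_rfl).trans ?_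
  exact mul_le_of_le_one_left (norm_nonneg _) hTn

/-- A family of smooth functions, indexed by multi-indices, whose derivatives are rapidly
decreasing on the closed orthant, with bounds that are polynomial in the index. -/
structure PolyFamily (g : (Fin d → ℕ) → (Fin d → ℝ) → ℂ) : Prop where
  smooth : ∀ n, ContDiff ℝ ∞ (g n)
  bound : ∀ m k : ℕ, ∃ (C : ℝ) (p : ℕ), 0 ≤ C ∧ ∀ n, ∀ x ∈ closedOrthant d,
    wX x ^ k * ‖iteratedFDeriv ℝ m (g n) x‖ ≤ C * polyW n ^ p

theorem PolyFamily.partialD {g : (Fin d → ℕ) → (Fin d → ℝ) → ℂ} (hg : PolyFamily g) (j : Fin d) :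
    PolyFamily fun n => partialD j (g n) where
  smooth n := partialD_contDiff (hg.smooth n) j
  bound m k := by
    obtain ⟨C, p, hC0, hC⟩ := hg.bound (m + 1) k
    refine ⟨C, p, hC0, fun n x hx => le_trans ?_ (hC n x hx)⟩
    have := wX_pos hx
    gcongr
    exact norm_iteratedFDeriv_partialD_le (hg.smooth n) j m x

theorem PolyFamily.norm_le {g : (Fin d → ℕ) → (Fin d → ℝ) → ℂ} (hg : PolyFamily g) (k : ℕ) :
    ∃ (C : ℝ) (p : ℕ), 0 ≤ C ∧ ∀ n, ∀ x ∈ closedOrthant d,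
      wX x ^ k * ‖g n x‖ ≤ C * polyW n ^ p := by
  obtain ⟨C, p, hC0, hC⟩ := hg.bound 0 k
  exact ⟨C, p, hC0, fun n x hx => by simpa using hC n x hx⟩

/-- Sequences whose product with every polynomial is summable. -/
def RapidSeq (a : (Fin d → ℕ) → ℂ) : Prop := ∀ p : ℕ, Summable fun n => ‖a n‖ * polyW n ^ p

theorem SeqSpace.rapidSeq {β : ℝ} (hβ : 0 < β) (a : SeqSpace d β) : RapidSeq (a : _ → ℂ) :=
  summable_norm_mul_polyW hβ a

theorem index_le_polyW (n : Fin d → ℕ) : ((∑ j, n j : ℕ) : ℝ) ≤ d * polyW n := by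
  push_cast
  refine (Finset.sum_le_card_nsmul _ _ (polyW n) fun j _ => ?_).trans (by simp)
  rw [polyW, ← Finset.mul_prod_erase _ _ (Finset.mem_univ j)]
  have : (1 : ℝ) ≤ ∏ i ∈ Finset.univ.erase j, ((n i : ℝ) + 1) :=
    Finset.one_le_prod fun i => by simp
  nlinarith [(Nat.cast_nonneg (n j) : (0 : ℝ) ≤ n j)]

theorem RapidSeq.index_mul {a : (Fin d → ℕ) → ℂ} (ha : RapidSeq a) :
    RapidSeq fun n => ((∑ j, n j : ℕ) : ℂ) * a n := by
  intro p
  refine Summable.of_nonneg_of_le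
    (fun n => mul_nonneg (norm_nonneg _) (pow_nonneg (polyW_pos n).le _)) (fun n => ?_)
    ((ha (p + 1)).mul_left (d : ℝ))
  have h1 := index_le_polyW n
  have h2 := polyW_pos n
  rw [norm_mul, Complex.norm_natCast]
  calc ((∑ j, n j : ℕ) : ℝ) * ‖a n‖ * polyW n ^ p ≤ (d * polyW n) * ‖a n‖ * polyW n ^ p := by
        gcongr
    _ = _ := by ring

theorem RapidSeq.summable_bound {a : (Fin d → ℕ) → ℂ} (ha : RapidSeq a) (C : ℝ) (p : ℕ) :
    Summable fun n => ‖a n‖ * (C * polyW n ^ p) :=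
  ((ha p).mul_left C).congr fun n => by ring

/-! ### Termwise differentiation of series on the orthant -/

section Series

variable {g : (Fin d → ℕ) → (Fin d → ℝ) → ℂ} {a : (Fin d → ℕ) → ℂ}

theorem orthant_isPreconnected (d : ℕ) : IsPreconnected (orthant d) := by
  refine Convex.isPreconnected ?_
  intro x hx y hy s t hs ht hst j
  simp only [Pi.add_apply, Pi.smul_apply, smul_eq_mul]
  rcases hs.eq_or_lt with h | h
  · have : t = 1 := by linarith
    simpa [← h, this] using hy j
  · exact add_pos_of_pos_of_nonneg (mul_pos h (hx j)) (mul_nonneg ht (hy j).le)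

theorem one_mem_orthant (d : ℕ) : (fun _ => 1 : Fin d → ℝ) ∈ orthant d := fun _ => one_pos

theorem PolyFamily.deriv_bound (hg : PolyFamily g) (m : ℕ) :
    ∃ (C : ℝ) (p : ℕ), ∀ n, ∀ x ∈ closedOrthant d,
      ‖a n • iteratedFDeriv ℝ m (g n) x‖ ≤ ‖a n‖ * (C * polyW n ^ p) := by
  obtain ⟨C, p, hC0, hC⟩ := hg.bound m 0
  refine ⟨C, p, fun n x hx => ?_⟩
  rw [norm_smul]
  have := hC n x hx
  rw [pow_zero, one_mul] at this
  gcongr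

theorem PolyFamily.summable (hg : PolyFamily g) (ha : RapidSeq a) {x : Fin d → ℝ}
    (hx : x ∈ closedOrthant d) : Summable fun n => a n * g n x := by
  obtain ⟨C, p, hC0, hC⟩ := hg.norm_le 0
  refine Summable.of_norm_bounded (ha.summable_bound C p) fun n => ?_
  rw [norm_mul]
  have := hC n x hx
  rw [pow_zero, one_mul] at this
  gcongr

theorem PolyFamily.continuousOn_tsum (hg : PolyFamily g) (ha : RapidSeq a) (m : ℕ) :
    ContinuousOn (fun x => ∑' n, a n • iteratedFDeriv ℝ m (g n) x) (closedOrthant d) := by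
  obtain ⟨C, p, hC⟩ := hg.deriv_bound (a := a) m
  refine _root_.continuousOn_tsum (fun n => ?_) (ha.summable_bound C p) hC
  have : Continuous fun x => iteratedFDeriv ℝ m (g n) x :=
    (hg.smooth n).continuous_iteratedFDeriv (by exact_mod_cast le_top)
  exact (this.const_smul (a n)).continuousOn

theorem hasFDerivAt_tsum_smul {V : Type*} [NormedAddCommGroup V] [NormedSpace ℝ V]
    [NormedSpace ℂ V] [SMulCommClass ℝ ℂ V] [CompleteSpace V] {f : (Fin d → ℕ) → (Fin d → ℝ) → V}
    {u v : (Fin d → ℕ) → ℝ} (hf : ∀ n, Differentiable ℝ (f n)) (hu : Summable u) (hv : Summable v)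
    (hb : ∀ n, ∀ y ∈ closedOrthant d, ‖a n • f n y‖ ≤ u n)
    (hb' : ∀ n, ∀ y ∈ closedOrthant d, ‖a n‖ * ‖fderiv ℝ (f n) y‖ ≤ v n) {x : Fin d → ℝ}
    (hx : x ∈ orthant d) :
    HasFDerivAt (fun y => ∑' n, a n • f n y) (∑' n, a n • fderiv ℝ (f n) x) x := by
  refine hasFDerivAt_tsum_of_isPreconnected hv (isOpen_orthant d)
    (orthant_isPreconnected d) (fun n y _ => (hf n y).hasFDerivAt.const_smul (a n))
    (fun n y hy => ?_) (one_mem_orthant d) (Summable.of_norm_bounded hu fun n =>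
      hb n _ (orthant_subset d (one_mem_orthant d))) hx
  rw [norm_smul]
  exact hb' n y (orthant_subset d hy)

/-- Each derivative may be taken term by term on the open orthant, because the bounds are polynomial
in `n` and the coefficients decrease rapidly. The same bounds hold up to the boundary, so the
differentiated series also provide the continuous extensions required by `IsOrthantSchwartz`. -/
theorem PolyFamily.hasFTaylorSeriesUpToOn (hg : PolyFamily g) (ha : RapidSeq a) :
    HasFTaylorSeriesUpToOn (⊤ : ℕ∞) (fun x => ∑' n, a n * g n x)
      (fun x m => ∑' n, a n • iteratedFDeriv ℝ m (g n) x) (orthant d) where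
  zero_eq x hx := by
    obtain ⟨C, p, hC⟩ := hg.deriv_bound (a := a) 0
    have hs : Summable fun n => a n • iteratedFDeriv ℝ 0 (g n) x :=
      Summable.of_norm_bounded (ha.summable_bound C p) fun n => hC n x (orthant_subset d hx)
    have := (ContinuousMultilinearMap.apply ℝ (fun _ : Fin 0 => Fin d → ℝ) ℂ 0).map_tsum hs
    refine this.trans (tsum_congr fun n => ?_)
    change a n • (iteratedFDeriv ℝ 0 (g n) x 0) = _
    rw [iteratedFDeriv_zero_apply, smul_eq_mul]
  fderivWithin m _ x hx := by
    obtain ⟨C, p, hC⟩ := hg.deriv_bound (a := a) m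
    obtain ⟨C', p', hC'⟩ := hg.deriv_bound (a := a) (m + 1)
    have hs : Summable fun n => a n • iteratedFDeriv ℝ (m + 1) (g n) x :=
      Summable.of_norm_bounded (ha.summable_bound C' p') fun n => hC' n x (orthant_subset d hx)
    have h1 : HasFDerivAt (fun y => ∑' n, a n • iteratedFDeriv ℝ m (g n) y)
        (∑' n, a n • fderiv ℝ (iteratedFDeriv ℝ m (g n)) x) x := by
      refine hasFDerivAt_tsum_smul (f := fun n => iteratedFDeriv ℝ m (g n))
        (fun n => (hg.smooth n).differentiable_iteratedFDeriv
          (by exact_mod_cast WithTop.coe_lt_top m))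
        (ha.summable_bound C p) (ha.summable_bound C' p') hC (fun n y hy => ?_) hx
      rw [norm_fderiv_iteratedFDeriv, ← norm_smul]
      exact hC' n y hy
    have h2 : (∑' n, a n • iteratedFDeriv ℝ (m + 1) (g n) x).curryLeft
        = ∑' n, a n • fderiv ℝ (iteratedFDeriv ℝ m (g n)) x := by
      have := (continuousMultilinearCurryLeftEquiv ℝ (fun _ : Fin (m + 1) => Fin d → ℝ)
        ℂ).toContinuousLinearEquiv.toContinuousLinearMap.map_tsum hs
      refine this.trans (tsum_congr fun n => ?_)
      rfl
    exact (h1.congr_fderiv h2.symm).hasFDerivWithinAt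
  cont m _ := (hg.continuousOn_tsum ha m).mono (orthant_subset d)

theorem PolyFamily.contDiffOn_tsum (hg : PolyFamily g) (ha : RapidSeq a) :
    ContDiffOn ℝ ∞ (fun x => ∑' n, a n * g n x) (orthant d) :=
  (hg.hasFTaylorSeriesUpToOn ha).contDiffOn

theorem PolyFamily.iteratedFDeriv_tsum (hg : PolyFamily g) (ha : RapidSeq a) (m : ℕ)
    {x : Fin d → ℝ} (hx : x ∈ orthant d) :
    iteratedFDeriv ℝ m (fun x => ∑' n, a n * g n x) x
      = ∑' n, a n • iteratedFDeriv ℝ m (g n) x := by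
  rw [← iteratedFDerivWithin_of_isOpen m (isOpen_orthant d) hx]
  exact ((hg.hasFTaylorSeriesUpToOn ha).eq_iteratedFDerivWithin_of_uniqueDiffOn
    (m := m) (by exact_mod_cast (le_top : (m : ℕ∞) ≤ ⊤)) (isOpen_orthant d).uniqueDiffOn hx).symm

theorem PolyFamily.partialD_tsum (hg : PolyFamily g) (ha : RapidSeq a) (j : Fin d) :
    EqOn (LagPil.partialD j fun x => ∑' n, a n * g n x)
      (fun x => ∑' n, a n * LagPil.partialD j (g n) x) (orthant d) := by
  intro x hx
  obtain ⟨C, p, hC0, hC⟩ := hg.bound 1 0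
  have hb : ∀ n, ∀ y ∈ closedOrthant d, ‖a n • fderiv ℝ (g n) y‖ ≤ ‖a n‖ * (C * polyW n ^ p) := by
    intro n y hy
    have := hC n y hy
    rw [pow_zero, one_mul, norm_iteratedFDeriv_one] at this
    rw [norm_smul]
    gcongr
  have h1 : HasFDerivAt (fun y => ∑' n, a n * g n y) (∑' n, a n • fderiv ℝ (g n) x) x := by
    refine hasFDerivAt_tsum_of_isPreconnected (ha.summable_bound C p) (isOpen_orthant d)
      (orthant_isPreconnected d) (fun n y _ => ?_) (fun n y hy => hb n y (orthant_subset d hy))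
      (one_mem_orthant d) (hg.summable ha (orthant_subset d (one_mem_orthant d))) hx
    exact (((hg.smooth n).differentiable (by simp)) y).hasFDerivAt.const_smul (a n)
  have hs : Summable fun n => a n • fderiv ℝ (g n) x :=
    Summable.of_norm_bounded (ha.summable_bound C p) fun n => hb n x (orthant_subset d hx)
  have h2 := (ContinuousLinearMap.apply ℝ ℂ (Pi.single j 1 : Fin d → ℝ)).map_tsum hs
  rw [LagPil.partialD, h1.fderiv]
  exact h2

theorem zeroExt_apply (f : ↥(orthant d) → ℂ) {x : Fin d → ℝ} (hx : x ∈ orthant d) :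
    zeroExt d f x = f ⟨x, hx⟩ :=
  Subtype.val_injective.extend_apply f 0 ⟨x, hx⟩

theorem zeroExt_restrict (F : (Fin d → ℝ) → ℂ) :
    EqOn (zeroExt d fun y => F y.1) F (orthant d) := fun _ hx => zeroExt_apply _ hx

theorem iteratedFDeriv_congr_orthant {F G : (Fin d → ℝ) → ℂ} (h : EqOn F G (orthant d)) (m : ℕ) :
    EqOn (iteratedFDeriv ℝ m F) (iteratedFDeriv ℝ m G) (orthant d) := fun _ hx =>
  (h.eventuallyEq_of_mem ((isOpen_orthant d).mem_nhds hx)).iteratedFDeriv ℝ m |>.eq_of_nhds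

theorem prod_pow_le_wX_pow {x : Fin d → ℝ} (hx : x ∈ closedOrthant d) (β : Fin d → ℕ) :
    ∏ j, x j ^ β j ≤ wX x ^ (∑ j, β j) := by
  rw [wX, ← Finset.prod_pow]
  refine Finset.prod_le_prod (fun j _ => pow_nonneg (hx j) _) fun j _ => ?_
  have h0 := hx j
  calc x j ^ β j ≤ (1 + x j) ^ β j := by gcongr; linarith
    _ ≤ (1 + x j) ^ (∑ j, β j) := pow_le_pow_right₀ (by linarith)
        (Finset.single_le_sum (fun _ _ => Nat.zero_le _) (Finset.mem_univ j))

theorem PolyFamily.isOrthantSchwartz (hg : PolyFamily g) (ha : RapidSeq a) :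
    IsOrthantSchwartz fun y : ↥(orthant d) => ∑' n, a n * g n y.1 := by
  have he := zeroExt_restrict fun y : Fin d → ℝ => ∑' n, a n * g n y
  have hd : ∀ m, EqOn (fun x => ∑' n, a n • iteratedFDeriv ℝ m (g n) x)
      (iteratedFDeriv ℝ m (zeroExt d fun y : ↥(orthant d) => ∑' n, a n * g n y.1)) (orthant d) :=
    fun m x hx => (hg.iteratedFDeriv_tsum ha m hx).symm.trans
      (iteratedFDeriv_congr_orthant he m hx).symm
  refine ⟨(hg.contDiffOn_tsum ha).congr he, fun m => ⟨_, hg.continuousOn_tsum ha m, hd m⟩,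
    fun m β => ?_⟩
  obtain ⟨C, p, hC0, hC⟩ := hg.bound m (∑ j, β j)
  refine ⟨∑' n, ‖a n‖ * (C * polyW n ^ p), fun x hx => ?_⟩
  rw [← hd m hx]
  have hx' := orthant_subset d hx
  have hw := wX_pos hx'
  have hb : ∀ n, wX x ^ (∑ j, β j) * ‖a n • iteratedFDeriv ℝ m (g n) x‖
      ≤ ‖a n‖ * (C * polyW n ^ p) := by
    intro n
    rw [norm_smul, mul_left_comm]
    exact mul_le_mul_of_nonneg_left (hC n x hx') (norm_nonneg _)
  have hs0 : Summable fun n => wX x ^ (∑ j, β j) * ‖a n • iteratedFDeriv ℝ m (g n) x‖ :=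
    Summable.of_nonneg_of_le (fun n => by positivity) hb (ha.summable_bound C p)
  have hs : Summable fun n => ‖a n • iteratedFDeriv ℝ m (g n) x‖ :=
    (summable_mul_left_iff (pow_pos hw _).ne').1 hs0
  calc (∏ j, x j ^ β j) * ‖∑' n, a n • iteratedFDeriv ℝ m (g n) x‖
      ≤ wX x ^ (∑ j, β j) * ∑' n, ‖a n • iteratedFDeriv ℝ m (g n) x‖ := by
        gcongr
        · exact prod_pow_le_wX_pow hx' β
        · exact norm_tsum_le_tsum_norm hs
    _ = ∑' n, wX x ^ (∑ j, β j) * ‖a n • iteratedFDeriv ℝ m (g n) x‖ := tsum_mul_left.symm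
    _ ≤ _ := hs0.tsum_le_tsum hb (ha.summable_bound C p)

end Series

/-! ## Laguerre series -/

theorem lagPi_contDiff (n : Fin d → ℕ) : ContDiff ℝ ∞ (lagPi n) := by
  unfold lagPi
  refine contDiff_prod fun j _ => ?_
  exact Complex.ofRealCLM.contDiff.comp ((lagFun_contDiff (n j)).comp (contDiff_apply ℝ ℝ j))

theorem lagPi_eq_mul (n : Fin d → ℕ) (x : Fin d → ℝ) (j : Fin d) : lagPi n x
    = (lagFun (n j) (x j) : ℂ) * ∏ i ∈ Finset.univ.erase j, (lagFun (n i) (x i) : ℂ) := by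
  exact (Finset.mul_prod_erase _ (fun i => (lagFun (n i) (x i) : ℂ)) (Finset.mem_univ j)).symm

theorem lagPi_update_index (n : Fin d → ℕ) (x : Fin d → ℝ) (j : Fin d) (k : ℕ) :
    lagPi (Function.update n j k) x
      = (lagFun k (x j) : ℂ) * ∏ i ∈ Finset.univ.erase j, (lagFun (n i) (x i) : ℂ) := by
  rw [lagPi_eq_mul _ _ j, Function.update_self]
  congr 1
  refine Finset.prod_congr rfl fun i hi => ?_
  rw [Function.update_of_ne (Finset.ne_of_mem_erase hi)]

theorem lagPi_update_point (n : Fin d → ℕ) (x : Fin d → ℝ) (j : Fin d) (t : ℝ) :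
    lagPi n (Function.update x j t)
      = (lagFun (n j) t : ℂ) * ∏ i ∈ Finset.univ.erase j, (lagFun (n i) (x i) : ℂ) := by
  rw [lagPi_eq_mul _ _ j, Function.update_self]
  congr 1
  refine Finset.prod_congr rfl fun i hi => ?_
  rw [Function.update_of_ne (Finset.ne_of_mem_erase hi)]

theorem partialD_eq_of_hasDerivAt {F : (Fin d → ℝ) → ℂ} {x : Fin d → ℝ} {j : Fin d} {c : ℂ}
    (hF : DifferentiableAt ℝ F x)
    (h : HasDerivAt (fun t => F (Function.update x j t)) c (x j)) : partialD j F x = c :=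
  (partialD_hasDerivAt hF j).unique h

theorem partialD_lagPi' (n : Fin d → ℕ) (j : Fin d) (x : Fin d → ℝ) : partialD j (lagPi n) x
    = (lagFunD (n j) (x j) : ℂ) * ∏ i ∈ Finset.univ.erase j, (lagFun (n i) (x i) : ℂ) := by
  refine partialD_eq_of_hasDerivAt ((lagPi_contDiff n).differentiable (by simp) x) ?_
  simp only [lagPi_update_point]
  exact ((lagFun_hasDerivAt (n j) (x j)).ofReal_comp).mul_const _

theorem partialD_lagPi (n : Fin d → ℕ) (j : Fin d) : partialD j (lagPi n)
    = (-(1 / 2 : ℂ)) • lagPi n - ∑ k ∈ Finset.range (n j), lagPi (Function.update n j k) := by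
  funext x
  simp only [Pi.sub_apply, Pi.smul_apply, Finset.sum_apply, lagPi_update_index, smul_eq_mul]
  rw [partialD_lagPi', lagPi_eq_mul n x j, lagFunD, ← Finset.sum_mul]
  push_cast
  ring

theorem partialD_partialD_lagPi (n : Fin d → ℕ) (j : Fin d) (x : Fin d → ℝ) :
    partialD j (partialD j (lagPi n)) x
      = ((-(1 / 2) * lagFunD (n j) (x j) - ∑ k ∈ Finset.range (n j), lagFunD k (x j) : ℝ) : ℂ)
        * ∏ i ∈ Finset.univ.erase j, (lagFun (n i) (x i) : ℂ) := by
  refine partialD_eq_of_hasDerivAt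
    ((partialD_contDiff (lagPi_contDiff n) j).differentiable (by simp) x) ?_
  have : ∀ t, partialD j (lagPi n) (Function.update x j t)
      = (lagFunD (n j) t : ℂ) * ∏ i ∈ Finset.univ.erase j, (lagFun (n i) (x i) : ℂ) := by
    intro t
    rw [partialD_lagPi', Function.update_self]
    congr 1
    refine Finset.prod_congr rfl fun i hi => ?_
    rw [Function.update_of_ne (Finset.ne_of_mem_erase hi)]
  simp only [this]
  exact ((lagFunD_hasDerivAt (n j) (x j)).ofReal_comp).mul_const _

/-- The Laguerre equation in the variable `x_j`. -/
theorem lagPi_ode (n : Fin d → ℕ) (j : Fin d) (x : Fin d → ℝ) :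
    (x j : ℂ) * partialD j (partialD j (lagPi n)) x + partialD j (lagPi n) x
      - (x j : ℂ) / 4 * lagPi n x + 1 / 2 * lagPi n x = -((n j : ℂ) * lagPi n x) := by
  rw [partialD_partialD_lagPi, partialD_lagPi', lagPi_eq_mul n x j]
  have h := congrArg (fun t : ℝ => (t : ℂ)) (lagFun_ode (n j) (x j))
  push_cast at h ⊢
  linear_combination (∏ i ∈ Finset.univ.erase j, (lagFun (n i) (x i) : ℂ)) * h

theorem polyW_mono {m n : Fin d → ℕ} (h : m ≤ n) : polyW m ≤ polyW n :=
  Finset.prod_le_prod (fun _ _ => by positivity) fun j _ => by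
    have : (m j : ℝ) ≤ n j := by exact_mod_cast h j
    linarith

theorem coord_le_polyW (n : Fin d → ℕ) (j : Fin d) : (n j : ℝ) + 1 ≤ polyW n := by
  rw [polyW, ← Finset.mul_prod_erase _ _ (Finset.mem_univ j)]
  exact le_mul_of_one_le_right (by positivity) (Finset.one_le_prod fun i _ => by simp)

/-- A derivative in `x_j` replaces `l_n` by at most `n_j + 1` functions `l_k` with `k ≤ n` and
coefficients of modulus at most `1`; summing over `j`, each order costs a factor `d · polyW n`. The
bound `B` is required for all `k ≤ n` because these functions appear, and it is taken at a single
point so that it may depend on `x`. -/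
theorem lagPi_iteratedFDeriv_le (m : ℕ) (n : Fin d → ℕ) (x : Fin d → ℝ) {B : ℝ}
    (hB : ∀ k ≤ n, ‖lagPi k x‖ ≤ B) :
    ‖iteratedFDeriv ℝ m (lagPi n) x‖ ≤ (d * polyW n) ^ m * B := by
  have hB0 : 0 ≤ B := (norm_nonneg _).trans (hB n le_rfl)
  induction m generalizing n with
  | zero => simpa using hB n le_rfl
  | succ m ih =>
    have hpos := polyW_pos n
    have hc : ∀ k, ContDiffAt ℝ m (lagPi k) x := fun k =>
      ((lagPi_contDiff k).of_le (by exact_mod_cast le_top)).contDiffAt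
    have key : ∀ j, ‖iteratedFDeriv ℝ m (partialD j (lagPi n)) x‖
        ≤ polyW n * ((d * polyW n) ^ m * B) := by
      intro j
      have hs : ContDiffAt ℝ m (∑ k ∈ Finset.range (n j), lagPi (Function.update n j k)) x := by
        have := ContDiffAt.sum (s := Finset.range (n j)) fun k _ => hc (Function.update n j k)
        convert this using 1
        funext y
        simp
      have hcs : ContDiffAt ℝ m ((-(1 / 2 : ℂ)) • lagPi n) x :=
        (hc n).const_smul (-(1 / 2 : ℂ))
      rw [partialD_lagPi, iteratedFDeriv_sub_apply hcs hs,
        iteratedFDeriv_const_smul_apply (hc n), iteratedFDeriv_sum_apply fun k _ => hc _]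
      refine (norm_sub_le _ _).trans ?_
      have h1 : ‖(-(1 / 2) : ℂ) • iteratedFDeriv ℝ m (lagPi n) x‖ ≤ (d * polyW n) ^ m * B := by
        rw [norm_smul]
        have h2 := ih n hB
        have : ‖(-(1 / 2) : ℂ)‖ ≤ 1 := by norm_num
        exact (mul_le_of_le_one_left (norm_nonneg _) this).trans h2
      have h3 : ∀ k ∈ Finset.range (n j), ‖iteratedFDeriv ℝ m (lagPi (Function.update n j k)) x‖
          ≤ (d * polyW n) ^ m * B := by
        intro k hk
        have hle : Function.update n j k ≤ n :=
          update_le_self_iff.2 (Finset.mem_range.1 hk).le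
        refine (ih _ fun i hi => hB i (hi.trans hle)).trans ?_
        have := polyW_mono hle
        have := polyW_pos (Function.update n j k)
        gcongr
      have h4 := (norm_sum_le _ _).trans (Finset.sum_le_card_nsmul _ _ _ h3)
      rw [Finset.card_range, nsmul_eq_mul] at h4
      have h5 := coord_le_polyW n j
      calc _ ≤ (d * polyW n) ^ m * B + (n j : ℝ) * ((d * polyW n) ^ m * B) := add_le_add h1 h4
        _ = ((n j : ℝ) + 1) * ((d * polyW n) ^ m * B) := by ring
        _ ≤ _ := by gcongr
    refine (norm_iteratedFDeriv_succ_le (lagPi_contDiff n) m x).trans ?_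
    refine (Finset.sum_le_card_nsmul _ _ _ fun j _ => key j).trans (le_of_eq ?_)
    simp
    ring

theorem lagPi_weighted_le (k : ℕ) : ∃ (C : ℝ) (p : ℕ), 0 ≤ C ∧ ∀ n : Fin d → ℕ,
    ∀ x ∈ closedOrthant d, wX x ^ k * ‖lagPi n x‖ ≤ C * polyW n ^ p := by
  obtain ⟨C, hC0, q, hC⟩ := lagFun_one_add_pow_le k
  refine ⟨C ^ d, q, by positivity, fun n x hx => ?_⟩
  have : C ^ d = ∏ _j : Fin d, C := by simp
  rw [lagPi, norm_prod, wX, polyW, ← Finset.prod_pow, ← Finset.prod_pow, this,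
    ← Finset.prod_mul_distrib, ← Finset.prod_mul_distrib]
  refine Finset.prod_le_prod (fun j _ => ?_) fun j _ => ?_
  · have : 0 ≤ x j := hx j
    positivity
  · rw [Complex.norm_real, Real.norm_eq_abs]
    exact hC (n j) (x j) (hx j)

theorem polyFamily_lagPi : PolyFamily (lagPi : (Fin d → ℕ) → (Fin d → ℝ) → ℂ) where
  smooth := lagPi_contDiff
  bound m k := by
    obtain ⟨C, p, hC0, hC⟩ := lagPi_weighted_le (d := d) k
    refine ⟨d ^ m * C, m + p, by positivity, fun n x hx => ?_⟩
    have hw := wX_pos hx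
    have hw' : 0 < wX x ^ k := by positivity
    -- Since `B` may depend on `x`, the weight `wX x ^ k` is put into it, and decay of the functions
    -- passes to decay of their derivatives.
    have h1 := lagPi_iteratedFDeriv_le m n x (B := C * polyW n ^ p / wX x ^ k) fun i hi => by
      rw [le_div_iff₀ hw', mul_comm]
      refine (hC i x hx).trans ?_
      have := polyW_mono hi
      have := polyW_pos i
      gcongr
    calc wX x ^ k * ‖iteratedFDeriv ℝ m (lagPi n) x‖
        ≤ wX x ^ k * ((d * polyW n) ^ m * (C * polyW n ^ p / wX x ^ k)) := by gcongr
      _ = _ := by field_simp; ring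

section

variable {a : (Fin d → ℕ) → ℂ}

/-- The Laguerre series with given coefficients. -/
def lagSeries (a : (Fin d → ℕ) → ℂ) (x : Fin d → ℝ) : ℂ := ∑' n, a n * lagPi n x

theorem laguerreOp_lagSeries (ha : RapidSeq a) : EqOn (laguerreOp (lagSeries a))
    (lagSeries fun n => ((∑ j, n j : ℕ) : ℂ) * a n) (orthant d) := by
  intro x hx
  have hx' := orthant_subset d hx
  have hg := polyFamily_lagPi (d := d)
  have h1 : ∀ j, EqOn (partialD j (lagSeries a)) (fun x => ∑' n, a n * partialD j (lagPi n) x)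
      (orthant d) := fun j => hg.partialD_tsum ha j
  have h2 : ∀ j, partialD j (partialD j (lagSeries a)) x
      = ∑' n, a n * partialD j (partialD j (lagPi n)) x := fun j =>
    (partialD_congr j (h1 j) hx).trans ((hg.partialD j).partialD_tsum ha j hx)
  have s0 := hg.summable ha hx'
  have s1 := fun j => (hg.partialD j).summable ha hx'
  have s2 := fun j => ((hg.partialD j).partialD j).summable ha hx'
  have key : ∀ j, (x j : ℂ) * partialD j (partialD j (lagSeries a)) x + partialD j (lagSeries a) x
      - (x j : ℂ) / 4 * lagSeries a x + 1 / 2 * lagSeries a x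
      = ∑' n, a n * (-((n j : ℂ) * lagPi n x)) := by
    intro j
    rw [h2 j, h1 j hx, lagSeries]
    have e2 := (s2 j).hasSum.mul_left (x j : ℂ)
    have e1 := (s1 j).hasSum
    have e0 := s0.hasSum.mul_left ((x j : ℂ) / 4)
    have e0' := s0.hasSum.mul_left (1 / 2 : ℂ)
    have := ((e2.add e1).sub e0).add e0'
    refine (this.tsum_eq).symm.trans (tsum_congr fun n => ?_)
    rw [← lagPi_ode]
    ring
  rw [laguerreOp]
  simp only [key]
  have s3 : ∀ j, Summable fun n => a n * (-((n j : ℂ) * lagPi n x)) := by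
    intro j
    have := ((((s2 j).mul_left (x j : ℂ)).add (s1 j)).sub (s0.mul_left ((x j : ℂ) / 4))).add
      (s0.mul_left (1 / 2 : ℂ))
    refine this.congr fun n => ?_
    rw [← lagPi_ode]
    ring
  rw [← Summable.tsum_finsetSum fun j _ => s3 j, ← tsum_neg, lagSeries]
  refine tsum_congr fun n => ?_
  rw [← Finset.mul_sum, Finset.sum_neg_distrib, ← Finset.sum_mul]
  push_cast
  ring

theorem RapidSeq.index_pow_mul (ha : RapidSeq a) (N : ℕ) :
    RapidSeq fun n => ((∑ j, n j : ℕ) : ℂ) ^ N * a n := by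
  induction N with
  | zero => simpa using ha
  | succ N ih =>
    have := ih.index_mul
    simp only [← mul_assoc, ← pow_succ'] at this
    exact this

theorem laguerreOp_iter_congr {F G : (Fin d → ℝ) → ℂ} (h : EqOn F G (orthant d)) (N : ℕ) :
    EqOn (laguerreOp^[N] F) (laguerreOp^[N] G) (orthant d) := by
  induction N with
  | zero => exact h
  | succ N ih =>
    simp only [Function.iterate_succ_apply']
    exact laguerreOp_congr ih

theorem laguerreOp_iter_lagSeries (ha : RapidSeq a) (N : ℕ) :
    EqOn (laguerreOp^[N] (lagSeries a))
      (lagSeries fun n => ((∑ j, n j : ℕ) : ℂ) ^ N * a n) (orthant d) := by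
  induction N with
  | zero => simp [EqOn]
  | succ N ih =>
    simp only [Function.iterate_succ_apply']
    have := (laguerreOp_congr ih).trans (laguerreOp_lagSeries (ha.index_pow_mul N))
    simp only [← mul_assoc, ← pow_succ'] at this
    exact this

end

/-! ### From coefficient decay to the norms of `PSpace` -/

theorem volume_restrict_orthant (d : ℕ) : (volume : Measure (Fin d → ℝ)).restrict (orthant d)
    = Measure.pi fun _ : Fin d => (volume : Measure ℝ).restrict (Ioi 0) := by
  have : orthant d = Set.univ.pi fun _ : Fin d => Ioi (0 : ℝ) := by
    ext x
    simp [orthant]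
  rw [this, volume_pi, Measure.restrict_pi_pi]

theorem integrable_wX_inv_sq (d : ℕ) :
    Integrable (fun x : Fin d → ℝ => (wX x ^ 2)⁻¹) (volume.restrict (orthant d)) := by
  have h1 : IntegrableOn (fun t : ℝ => ((1 + t) ^ 2)⁻¹) (Ioi 0) := by
    have h2 := integrableOn_add_rpow_Ioi_of_lt (a := -2) (c := 0) (m := 1) (by norm_num)
      (by norm_num)
    refine h2.congr_fun (fun t ht => ?_) measurableSet_Ioi
    have : (0 : ℝ) ≤ 1 + t := by have : (0 : ℝ) < t := ht; linarith
    simp only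
    rw [add_comm t 1, Real.rpow_neg this]
    norm_cast
  rw [volume_restrict_orthant]
  have := Integrable.fintype_prod (f := fun _ : Fin d => fun t : ℝ => ((1 + t) ^ 2)⁻¹)
    (μ := fun _ => (volume : Measure ℝ).restrict (Ioi 0)) fun _ => h1
  refine this.congr (Eventually.of_forall fun x => ?_)
  simp only [wX, Finset.prod_inv_distrib, Finset.prod_pow]

theorem memLp_wX_inv (d : ℕ) :
    MemLp (fun x : Fin d → ℝ => (wX x)⁻¹) 2 (volume.restrict (orthant d)) := by
  rw [memLp_two_iff_integrable_sq]
  · simpa only [inv_pow] using integrable_wX_inv_sq d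
  · exact (continuous_wX.measurable.inv).aestronglyMeasurable

/-- This is `s^N ≤ N! e^s`, a single term of the exponential series, raised to the power `α` with `s
= (t/h)^{1/α}`. -/
theorem pow_le_factorial_mul_exp {α h : ℝ} (hα : 0 < α) (hh : 0 < h) (N : ℕ) {t : ℝ}
    (ht : 0 ≤ t) : t ^ N ≤ h ^ N * (Nat.factorial N : ℝ) ^ α
      * Real.exp (α * h ^ (-(1 / α)) * t ^ (1 / α)) := by
  set s : ℝ := h ^ (-(1 / α)) * t ^ (1 / α) with hs
  have hs0 : 0 ≤ s := by positivity
  have h1 : s ^ N ≤ (Nat.factorial N : ℝ) * Real.exp s := by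
    have := Real.pow_div_factorial_le_exp s hs0 N
    rwa [div_le_iff₀ (by positivity), mul_comm] at this
  have h2 : s ^ α = h⁻¹ * t := by
    rw [hs, Real.mul_rpow (by positivity) (by positivity), ← Real.rpow_mul hh.le,
      ← Real.rpow_mul ht, neg_mul, one_div, inv_mul_cancel₀ hα.ne', Real.rpow_neg_one,
      Real.rpow_one]
  have h3 : (h⁻¹ * t) ^ N ≤ (Nat.factorial N : ℝ) ^ α * Real.exp (α * s) := by
    calc (h⁻¹ * t) ^ N = (s ^ N) ^ α := by
          rw [← h2, ← Real.rpow_natCast, ← Real.rpow_natCast, ← Real.rpow_mul hs0,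
            ← Real.rpow_mul hs0, mul_comm]
      _ ≤ ((Nat.factorial N : ℝ) * Real.exp s) ^ α := by gcongr
      _ = _ := by
          rw [Real.mul_rpow (by positivity) (Real.exp_pos _).le, ← Real.exp_mul, mul_comm s α]
  calc t ^ N = h ^ N * (h⁻¹ * t) ^ N := by rw [← mul_pow, mul_inv_cancel_left₀ hh.ne']
    _ ≤ h ^ N * ((Nat.factorial N : ℝ) ^ α * Real.exp (α * s)) := by gcongr
    _ = _ := by rw [hs]; ring_nf

theorem index_pow_le {α h : ℝ} (hα : 0 < α) (hh : 0 < h) (N : ℕ) (n : Fin d → ℕ) :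
    ((∑ j, n j : ℕ) : ℝ) ^ N ≤ h ^ N * (Nat.factorial N : ℝ) ^ α
      * weight (α * h ^ (-(1 / α))) (α / 2) n := by
  have := pow_le_factorial_mul_exp hα hh N (Nat.cast_nonneg (∑ j, n j))
  rw [weight, mul_div_cancel₀ _ (two_ne_zero)]
  exact this

theorem coeff_pos {α h : ℝ} (hα : 0 < α) (hh : 0 < h) : 0 < α * h ^ (-(1 / α)) + 1 := by
  positivity

/-- Applying `E^N` multiplies the coefficients by `|n|^N`, which `index_pow_le` bounds by `h^N N!^α`
times a weight. One unit more in the weight parameter pays for the polynomial growth of `l_n` and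
the summation. The factor `1 / wX x`, taken from the decay of `l_n`, makes the pointwise bound
square integrable, so Parseval is not needed. The constant depends neither on `h` nor on the
sequence. -/
theorem eta_lagSeries_le {α : ℝ} (hα : 0 < α) : ∃ C : ℝ, 0 ≤ C ∧
    ∀ (a : SeqSpace d (α / 2)) (h : ℝ) (hh : 0 < h),
      eta α h (fun y : ↥(orthant d) => lagSeries (a : _ → ℂ) y.1)
        ≤ ENNReal.ofReal (C * seqNorm d (α / 2) ⟨_, coeff_pos hα hh⟩ a) := by
  obtain ⟨C, p, hC0, hC⟩ := lagPi_weighted_le (d := d) 1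
  set K : ℝ≥0∞ := eLpNorm (fun x : Fin d → ℝ => (wX x)⁻¹) 2 (volume.restrict (orthant d)) with hK
  have hKt : K ≠ ⊤ := (memLp_wX_inv d).eLpNorm_ne_top
  have hβ : 0 < α / 2 := half_pos hα
  refine ⟨C * polySum d (α / 2) p * K.toReal,
    mul_nonneg (mul_nonneg hC0 (polySum_nonneg _ _ _)) ENNReal.toReal_nonneg, fun a h hh => ?_⟩
  set S := seqNorm d (α / 2) ⟨_, coeff_pos hα hh⟩ a with hS
  refine iSup_le fun N => ?_
  have hra := a.rapidSeq hβ
  set D : ℝ := h ^ N * (Nat.factorial N : ℝ) ^ α with hD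
  have hD0 : 0 < D := by positivity
  have hE : EqOn (laguerreOp^[N] (zeroExt d fun y : ↥(orthant d) => lagSeries (a : _ → ℂ) y.1))
      (lagSeries fun n => ((∑ j, n j : ℕ) : ℂ) ^ N * a n) (orthant d) :=
    (laguerreOp_iter_congr (zeroExt_restrict (lagSeries (a : _ → ℂ))) N).trans
      (laguerreOp_iter_lagSeries hra N)
  rw [eLpNorm_congr_orthant hE]
  have hpt : ∀ x ∈ orthant d, ‖lagSeries (fun n => ((∑ j, n j : ℕ) : ℂ) ^ N * a n) x‖
      ≤ D * (C * polySum d (α / 2) p * S) * ‖(wX x)⁻¹‖ := by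
    intro x hx
    have hx' := orthant_subset d hx
    have hw := wX_pos hx'
    have hb : ∀ n, ‖((∑ j, n j : ℕ) : ℂ) ^ N * a n * lagPi n x‖ ≤ D * C * (wX x)⁻¹
        * (‖a n‖ * weight (α * h ^ (-(1 / α))) (α / 2) n * polyW n ^ p) := by
      intro n
      have h1 := hC n x hx'
      rw [pow_one, mul_comm, ← le_div_iff₀ hw] at h1
      have h2 := index_pow_le hα hh N n
      have h3 := weight_pos (α * h ^ (-(1 / α))) (α / 2) n
      rw [norm_mul, norm_mul, norm_pow, Complex.norm_natCast]
      calc ((∑ j, n j : ℕ) : ℝ) ^ N * ‖a n‖ * ‖lagPi n x‖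
          ≤ (D * weight (α * h ^ (-(1 / α))) (α / 2) n) * ‖a n‖ * (C * polyW n ^ p / wX x) := by
            gcongr
        _ = _ := by ring
    have hsum := summable_norm_mul_weight hβ (coeff_pos hα hh) a p
    have h5 := tsum_of_norm_bounded (hsum.mul_left (D * C * (wX x)⁻¹)).hasSum hb
    rw [tsum_mul_left] at h5
    rw [lagSeries]
    refine h5.trans ?_
    rw [Real.norm_of_nonneg (by positivity)]
    have h6 := tsum_norm_mul_weight_le hβ (coeff_pos hα hh) a p
    calc _ ≤ D * C * (wX x)⁻¹ * (polySum d (α / 2) p * S) := by gcongr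
      _ = _ := by ring
  have hS0 : 0 ≤ S := apply_nonneg _ _
  have hP0 := polySum_nonneg d (α / 2) p
  have h7 := eLpNorm_le_mul_eLpNorm_of_ae_le_mul (μ := volume.restrict (orthant d))
    ((ae_restrict_iff' (isOpen_orthant d).measurableSet).2 (Eventually.of_forall hpt)) 2
  refine (ENNReal.div_le_div_right h7 _).trans ?_
  rw [← hK, ENNReal.ofReal_mul hD0.le, mul_assoc,
    ENNReal.mul_div_right_comm, ENNReal.div_self (by simpa using hD0) ENNReal.ofReal_ne_top,
    one_mul]
  rw [← ENNReal.ofReal_toReal hKt, ← ENNReal.ofReal_mul (by positivity),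
    ENNReal.toReal_ofReal ENNReal.toReal_nonneg]
  exact ENNReal.ofReal_le_ofReal (le_of_eq (by ring))

/-- The map from coefficients to Laguerre series. -/
def lagSeriesMap (d : ℕ) {α : ℝ} (hα : 0 < α) : SeqSpace d (α / 2) →ₗ[ℂ] PSpace d α where
  toFun a := ⟨fun y => lagSeries (a : _ → ℂ) y.1,
    polyFamily_lagPi.isOrthantSchwartz (a.rapidSeq (half_pos hα)), fun h hh => by
      obtain ⟨C, _, hC⟩ := eta_lagSeries_le (d := d) hα
      exact (hC a h hh).trans_lt ENNReal.ofReal_lt_top⟩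
  map_add' a b := by
    refine Subtype.ext (funext fun y => ?_)
    have hy := orthant_subset d y.2
    have h1 := polyFamily_lagPi.summable (a.rapidSeq (half_pos hα)) hy
    have h2 := polyFamily_lagPi.summable (b.rapidSeq (half_pos hα)) hy
    exact (tsum_congr fun n => add_mul _ _ _).trans (h1.tsum_add h2)
  map_smul' c a := by
    refine Subtype.ext (funext fun y => ?_)
    exact (tsum_congr fun n => mul_assoc _ _ _).trans tsum_mul_left

theorem continuous_lagSeriesMap {α : ℝ} (hα : 0 < α) : Continuous (lagSeriesMap d hα) := by
  obtain ⟨C, hC0, hC⟩ := eta_lagSeries_le (d := d) hα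
  refine continuous_of_seminorm_le (seqSpace_withSeminorms d _) (pSpace_withSeminorms d α) _
    fun h => ⟨⟨_, coeff_pos hα h.2⟩, C, hC0, fun a => ?_⟩
  exact ENNReal.toReal_le_of_le_ofReal (mul_nonneg hC0 (apply_nonneg _ _)) (hC a h.1 h.2)

theorem closedOrthant_subset_closure (d : ℕ) : closedOrthant d ⊆ closure (orthant d) := by
  intro x hx
  have h1 : Tendsto (fun t : ℝ => fun j => x j + t) (𝓝[>] 0) (𝓝 x) := by
    have : Continuous fun t : ℝ => fun j => x j + t := by fun_prop
    have := this.tendsto 0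
    simp only [add_zero] at this
    exact this.mono_left nhdsWithin_le_nhds
  refine mem_closure_of_tendsto h1 ?_
  filter_upwards [self_mem_nhdsWithin] with t ht j
  exact add_pos_of_nonneg_of_pos (hx j) ht

/-- The continuous extension of a Laguerre series to the closed orthant. -/
theorem closedExt_eq_lagSeries {a : (Fin d → ℕ) → ℂ} (ha : RapidSeq a) {f : ↥(orthant d) → ℂ}
    (hf : ∀ y, f y = lagSeries a y.1) {x : Fin d → ℝ} (hx : x ∈ closedOrthant d) :
    closedExt f x = lagSeries a x := by
  refine extendFrom_eq (closedOrthant_subset_closure d hx) ?_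
  have h0 : ContinuousOn (lagSeries a) (closedOrthant d) := by
    obtain ⟨C, p, hC0, hC⟩ := polyFamily_lagPi.norm_le (d := d) 0
    refine continuousOn_tsum (fun n => ?_) (ha.summable_bound C p) fun n x hx => ?_
    · exact (continuous_const.mul (lagPi_contDiff n).continuous).continuousOn
    · rw [norm_mul]
      have := hC n x hx
      rw [pow_zero, one_mul] at this
      gcongr
  refine ((h0 x hx).mono_left (nhdsWithin_mono x (orthant_subset d))).congr' ?_
  filter_upwards [self_mem_nhdsWithin] with y hy
  rw [zeroExt_apply f hy, hf]

/-! ## Rapidly decreasing functions on the orthant -/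

/-- All iterated partial derivatives up to order `m` decrease rapidly on the orthant. -/
def DerivDecay : ℕ → ((Fin d → ℝ) → ℂ) → Prop
  | 0, F => ∀ k : ℕ, ∃ C : ℝ, ∀ x ∈ orthant d, wX x ^ k * ‖F x‖ ≤ C
  | m + 1, F => (∀ k : ℕ, ∃ C : ℝ, ∀ x ∈ orthant d, wX x ^ k * ‖F x‖ ≤ C) ∧
      ∀ j, DerivDecay m (partialD j F)

/-- Smooth functions all of whose derivatives decrease rapidly on the orthant. -/
structure RapidFn (F : (Fin d → ℝ) → ℂ) : Prop where
  smooth : ContDiffOn ℝ ∞ F (orthant d)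
  decay : ∀ m, DerivDecay m F

theorem DerivDecay.congr {m : ℕ} {F G : (Fin d → ℝ) → ℂ} (hF : DerivDecay m F)
    (h : EqOn G F (orthant d)) : DerivDecay m G := by
  induction m generalizing F G with
  | zero =>
    intro k
    obtain ⟨C, hC⟩ := hF k
    exact ⟨C, fun x hx => by rw [h hx]; exact hC x hx⟩
  | succ m ih =>
    refine ⟨fun k => ?_, fun j => ih (hF.2 j) (partialD_congr j h)⟩
    obtain ⟨C, hC⟩ := hF.1 k
    exact ⟨C, fun x hx => by rw [h hx]; exact hC x hx⟩

theorem DerivDecay.norm_le {m : ℕ} {F : (Fin d → ℝ) → ℂ} (hF : DerivDecay m F) (k : ℕ) :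
    ∃ C : ℝ, ∀ x ∈ orthant d, wX x ^ k * ‖F x‖ ≤ C := by
  cases m with
  | zero => exact hF k
  | succ m => exact hF.1 k

theorem DerivDecay.of_succ {m : ℕ} {F : (Fin d → ℝ) → ℂ} (hF : DerivDecay (m + 1) F) :
    DerivDecay m F := by
  induction m generalizing F with
  | zero => exact hF.1
  | succ m ih => exact ⟨hF.1, fun j => ih (hF.2 j)⟩

theorem DerivDecay.norm_add_le {m : ℕ} {F G : (Fin d → ℝ) → ℂ} (hF : DerivDecay m F)
    (hG : DerivDecay m G) (k : ℕ) : ∃ C : ℝ, ∀ x ∈ orthant d, wX x ^ k * ‖(F + G) x‖ ≤ C := by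
  obtain ⟨A, hA⟩ := hF.norm_le k
  obtain ⟨B, hB⟩ := hG.norm_le k
  refine ⟨A + B, fun x hx => ?_⟩
  have hw := pow_pos (wX_pos (orthant_subset d hx)) k
  have := mul_le_mul_of_nonneg_left (_root_.norm_add_le (F x) (G x)) hw.le
  rw [Pi.add_apply]
  linarith [hA x hx, hB x hx]

theorem DerivDecay.add {m : ℕ} {F G : (Fin d → ℝ) → ℂ} (hF : DerivDecay m F)
    (hG : DerivDecay m G) (sF : ContDiffOn ℝ ∞ F (orthant d))
    (sG : ContDiffOn ℝ ∞ G (orthant d)) : DerivDecay m (F + G) := by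
  induction m generalizing F G with
  | zero => exact hF.norm_add_le hG
  | succ m ih =>
    exact ⟨hF.norm_add_le hG, fun j => (ih (hF.2 j) (hG.2 j) (partialD_contDiffOn j sF)
      (partialD_contDiffOn j sG)).congr (partialD_add j sF sG)⟩

theorem partialD_mul (j : Fin d) {F G : (Fin d → ℝ) → ℂ} (sF : ContDiffOn ℝ ∞ F (orthant d))
    (sG : ContDiffOn ℝ ∞ G (orthant d)) :
    EqOn (partialD j (F * G)) (partialD j F * G + F * partialD j G) (orthant d) := by
  intro x hx
  have h1 := differentiableAt_of_smooth sF hx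
  have h2 := differentiableAt_of_smooth sG hx
  refine partialD_eq_of_hasDerivAt (h1.mul h2) ?_
  refine ((partialD_hasDerivAt h1 j).mul (partialD_hasDerivAt h2 j)).congr_deriv ?_
  simp only [Function.update_eq_self, Pi.add_apply, Pi.mul_apply]

theorem DerivDecay.norm_mul_le {m : ℕ} {F G : (Fin d → ℝ) → ℂ} (hF : DerivDecay m F)
    (hG : DerivDecay m G) (k : ℕ) : ∃ C : ℝ, ∀ x ∈ orthant d, wX x ^ k * ‖(F * G) x‖ ≤ C := by
  obtain ⟨A, hA⟩ := hF.norm_le k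
  obtain ⟨B, hB⟩ := hG.norm_le 0
  refine ⟨A * B, fun x hx => ?_⟩
  have hw := pow_pos (wX_pos (orthant_subset d hx)) k
  have h1 := hA x hx
  have h2 := hB x hx
  rw [pow_zero, one_mul] at h2
  rw [Pi.mul_apply, norm_mul, ← mul_assoc]
  have : 0 ≤ wX x ^ k * ‖F x‖ := by positivity
  exact mul_le_mul h1 h2 (norm_nonneg _) (this.trans h1)

theorem DerivDecay.mul {m : ℕ} {F G : (Fin d → ℝ) → ℂ} (hF : DerivDecay m F)
    (hG : DerivDecay m G) (sF : ContDiffOn ℝ ∞ F (orthant d))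
    (sG : ContDiffOn ℝ ∞ G (orthant d)) : DerivDecay m (F * G) := by
  induction m generalizing F G with
  | zero => exact hF.norm_mul_le hG
  | succ m ih =>
    refine ⟨hF.norm_mul_le hG, fun j => DerivDecay.congr ?_ (partialD_mul j sF sG)⟩
    have sF' := partialD_contDiffOn j sF
    have sG' := partialD_contDiffOn j sG
    exact (ih (hF.2 j) hG.of_succ sF' sG).add (ih hF.of_succ (hG.2 j) sF sG') (sF'.mul sG)
      (sF.mul sG')

theorem DerivDecay.smul {m : ℕ} {F : (Fin d → ℝ) → ℂ} (c : ℂ) (hF : DerivDecay m F)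
    (sF : ContDiffOn ℝ ∞ F (orthant d)) : DerivDecay m (c • F) := by
  induction m generalizing F with
  | zero =>
    intro k
    obtain ⟨A, hA⟩ := hF k
    refine ⟨‖c‖ * A, fun x hx => ?_⟩
    rw [Pi.smul_apply, norm_smul, mul_left_comm]
    exact mul_le_mul_of_nonneg_left (hA x hx) (norm_nonneg c)
  | succ m ih =>
    refine ⟨fun k => ?_, fun j => (ih (hF.2 j) (partialD_contDiffOn j sF)).congr
      (partialD_smul j c sF)⟩
    obtain ⟨A, hA⟩ := hF.1 k
    refine ⟨‖c‖ * A, fun x hx => ?_⟩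
    rw [Pi.smul_apply, norm_smul, mul_left_comm]
    exact mul_le_mul_of_nonneg_left (hA x hx) (norm_nonneg c)

/-- Multiplication by a coordinate. -/
def coordMul (i : Fin d) (F : (Fin d → ℝ) → ℂ) : (Fin d → ℝ) → ℂ := fun x => (x i : ℂ) * F x

theorem coordMul_contDiffOn (i : Fin d) {F : (Fin d → ℝ) → ℂ}
    (sF : ContDiffOn ℝ ∞ F (orthant d)) : ContDiffOn ℝ ∞ (coordMul i F) (orthant d) :=
  (Complex.ofRealCLM.contDiff.comp (contDiff_apply ℝ ℝ i)).contDiffOn.mul sF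

theorem partialD_coordMul (i j : Fin d) {F : (Fin d → ℝ) → ℂ}
    (sF : ContDiffOn ℝ ∞ F (orthant d)) : EqOn (partialD j (coordMul i F))
      ((if i = j then 1 else 0 : ℂ) • F + coordMul i (partialD j F)) (orthant d) := by
  intro x hx
  have h1 := differentiableAt_of_smooth sF hx
  refine partialD_eq_of_hasDerivAt (differentiableAt_of_smooth (coordMul_contDiffOn i sF) hx) ?_
  have h2 : HasDerivAt (fun t : ℝ => ((Function.update x j t i : ℝ) : ℂ))
      (if i = j then 1 else 0 : ℂ) (x j) := by
    split_ifs with h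
    · subst h
      simpa using (hasDerivAt_id' (x i)).ofReal_comp
    · simp only [Function.update_of_ne h]
      exact hasDerivAt_const _ _
  refine (h2.mul (partialD_hasDerivAt h1 j)).congr_deriv ?_
  simp only [Function.update_eq_self, Pi.add_apply, Pi.smul_apply, coordMul, smul_eq_mul]

theorem coordMul_bound {i : Fin d} {F : (Fin d → ℝ) → ℂ}
    (hF : ∀ k : ℕ, ∃ C : ℝ, ∀ x ∈ orthant d, wX x ^ k * ‖F x‖ ≤ C) (k : ℕ) :
    ∃ C : ℝ, ∀ x ∈ orthant d, wX x ^ k * ‖coordMul i F x‖ ≤ C := by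
  obtain ⟨C, hC⟩ := hF (k + 1)
  refine ⟨C, fun x hx => le_trans ?_ (hC x hx)⟩
  have hx' := orthant_subset d hx
  have hw := wX_pos hx'
  have h1 := le_wX hx' i
  have h2 : 0 ≤ x i := hx' i
  rw [coordMul, norm_mul, Complex.norm_real, Real.norm_of_nonneg h2, pow_succ, mul_assoc]
  gcongr
  linarith

theorem DerivDecay.coordMul {m : ℕ} (i : Fin d) {F : (Fin d → ℝ) → ℂ} (hF : DerivDecay m F)
    (sF : ContDiffOn ℝ ∞ F (orthant d)) : DerivDecay m (coordMul i F) := by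
  induction m generalizing F with
  | zero => exact coordMul_bound hF
  | succ m ih =>
    refine ⟨coordMul_bound hF.1, fun j => DerivDecay.congr ?_ (partialD_coordMul i j sF)⟩
    exact (hF.of_succ.smul _ sF).add (ih (hF.2 j) (partialD_contDiffOn j sF))
      (sF.const_smul (if i = j then 1 else 0 : ℂ)) (coordMul_contDiffOn i (partialD_contDiffOn j sF))

namespace RapidFn

variable {F G : (Fin d → ℝ) → ℂ}

theorem congr (hF : RapidFn F) (h : EqOn G F (orthant d)) : RapidFn G :=
  ⟨hF.smooth.congr h, fun m => (hF.decay m).congr h⟩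

theorem partialD (hF : RapidFn F) (j : Fin d) : RapidFn (partialD j F) :=
  ⟨partialD_contDiffOn j hF.smooth, fun m => (hF.decay (m + 1)).2 j⟩

theorem add (hF : RapidFn F) (hG : RapidFn G) : RapidFn (F + G) :=
  ⟨hF.smooth.add hG.smooth, fun m => (hF.decay m).add (hG.decay m) hF.smooth hG.smooth⟩

theorem mul (hF : RapidFn F) (hG : RapidFn G) : RapidFn (F * G) :=
  ⟨hF.smooth.mul hG.smooth, fun m => (hF.decay m).mul (hG.decay m) hF.smooth hG.smooth⟩

theorem smul (hF : RapidFn F) (c : ℂ) : RapidFn (c • F) :=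
  ⟨hF.smooth.const_smul c, fun m => (hF.decay m).smul c hF.smooth⟩

theorem sub (hF : RapidFn F) (hG : RapidFn G) : RapidFn (F - G) := by
  have := hF.add (hG.smul (-1))
  rwa [neg_one_smul, ← sub_eq_add_neg] at this

theorem coordMul (hF : RapidFn F) (i : Fin d) : RapidFn (coordMul i F) :=
  ⟨coordMul_contDiffOn i hF.smooth, fun m => (hF.decay m).coordMul i hF.smooth⟩

theorem zero : RapidFn (0 : (Fin d → ℝ) → ℂ) := by
  refine ⟨contDiffOn_const, fun m => ?_⟩
  induction m with
  | zero => exact fun k => ⟨0, fun x _ => by simp⟩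
  | succ m ih =>
    refine ⟨fun k => ⟨0, fun x _ => by simp⟩, fun j => ?_⟩
    have : LagPil.partialD j (0 : (Fin d → ℝ) → ℂ) = 0 := by
      funext x
      simp [LagPil.partialD]
    rwa [this]

theorem sum {ι : Type*} (s : Finset ι) {f : ι → (Fin d → ℝ) → ℂ} (hf : ∀ i ∈ s, RapidFn (f i)) :
    RapidFn (∑ i ∈ s, f i) :=
  Finset.sum_induction _ RapidFn (fun _ _ => add) zero hf

theorem laguerreOp (hF : RapidFn F) : RapidFn (laguerreOp F) := by
  have h := (sum Finset.univ fun j _ => ((((hF.partialD j).partialD j).coordMul j).add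
    (hF.partialD j)).add (((hF.coordMul j).smul (-(1 / 4 : ℂ))).add (hF.smul (1 / 2)))).smul (-1)
  refine h.congr fun x _ => ?_
  simp only [LagPil.laguerreOp, Pi.smul_apply, Finset.sum_apply, Pi.add_apply, LagPil.coordMul,
    smul_eq_mul, neg_one_mul]
  congr 1
  exact Finset.sum_congr rfl fun j _ => by ring

theorem laguerreOp_iter (hF : RapidFn F) (N : ℕ) : RapidFn (LagPil.laguerreOp^[N] F) := by
  induction N with
  | zero => exact hF
  | succ N ih =>
    rw [Function.iterate_succ_apply']
    exact ih.laguerreOp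

theorem norm_le (hF : RapidFn F) (k : ℕ) :
    ∃ C : ℝ, 0 ≤ C ∧ ∀ x ∈ orthant d, ‖F x‖ ≤ C * (wX x ^ k)⁻¹ := by
  obtain ⟨C, hC⟩ := (hF.decay 0) k
  refine ⟨C, ?_, fun x hx => ?_⟩
  · have := wX_pos (orthant_subset d (one_mem_orthant d))
    exact le_trans (by positivity) (hC _ (one_mem_orthant d))
  · have := wX_pos (orthant_subset d hx)
    rw [← div_eq_mul_inv, le_div_iff₀ (by positivity), mul_comm]
    exact hC x hx

theorem integrable (hF : RapidFn F) : Integrable F (volume.restrict (orthant d)) := by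
  obtain ⟨C, hC0, hC⟩ := hF.norm_le 2
  exact ((integrable_wX_inv_sq d).const_mul C).mono' (aestronglyMeasurable_of_smooth hF.smooth)
    ((ae_restrict_iff' (isOpen_orthant d).measurableSet).2 (Eventually.of_forall hC))

theorem memLp (hF : RapidFn F) : MemLp F 2 (volume.restrict (orthant d)) := by
  obtain ⟨C, hC0, hC⟩ := hF.norm_le 1
  refine (memLp_wX_inv d).of_le_mul (c := C) (aestronglyMeasurable_of_smooth hF.smooth)
    ((ae_restrict_iff' (isOpen_orthant d).measurableSet).2 (Eventually.of_forall fun x hx => ?_))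
  have hw := wX_pos (orthant_subset d hx)
  rw [Real.norm_of_nonneg (by positivity)]
  simpa using hC x hx

end RapidFn

theorem PolyFamily.rapidFn {g : (Fin d → ℕ) → (Fin d → ℝ) → ℂ} (hg : PolyFamily g)
    (n : Fin d → ℕ) : RapidFn (g n) := by
  refine ⟨(hg.smooth n).contDiffOn, fun m => ?_⟩
  have h0 : ∀ {g : (Fin d → ℕ) → (Fin d → ℝ) → ℂ}, PolyFamily g → ∀ k : ℕ,
      ∃ C : ℝ, ∀ x ∈ orthant d, wX x ^ k * ‖g n x‖ ≤ C := by
    intro g hg k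
    obtain ⟨C, p, hC0, hC⟩ := hg.norm_le k
    exact ⟨_, fun x hx => hC n x (orthant_subset d hx)⟩
  induction m generalizing g with
  | zero => exact h0 hg
  | succ m ih => exact ⟨h0 hg, fun j => ih (hg.partialD j)⟩

theorem rapidFn_lagPi (n : Fin d → ℕ) : RapidFn (lagPi n) := polyFamily_lagPi.rapidFn n

/-- Expanding `∏ (1 + x_j^k)` over subsets gives finitely many monomials, the form in which decay is
prescribed in `IsOrthantSchwartz`. -/
theorem wX_pow_le {x : Fin d → ℝ} (hx : x ∈ closedOrthant d) (k : ℕ) :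
    wX x ^ k ≤ (2 ^ k) ^ d * ∑ s : Finset (Fin d), ∏ j, x j ^ (if j ∈ s then k else 0) := by
  have h1 : ∀ t : ℝ, 0 ≤ t → (1 + t) ^ k ≤ 2 ^ k * (1 + t ^ k) := by
    intro t ht
    have := add_pow_le (zero_le_one' ℝ) ht k
    rw [one_pow] at this
    refine this.trans ?_
    gcongr
    · norm_num
    · omega
  have h2 : ((2 : ℝ) ^ k) ^ d = ∏ _j : Fin d, (2 : ℝ) ^ k := by simp
  have h3 : ∑ s : Finset (Fin d), ∏ j, x j ^ (if j ∈ s then k else 0) = ∏ j, (1 + x j ^ k) := by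
    rw [Finset.prod_one_add, Finset.powerset_univ]
    refine Finset.sum_congr rfl fun s _ => ?_
    simp only [pow_ite, pow_zero]
    rw [Finset.prod_ite_mem, Finset.univ_inter]
  rw [h3, h2, ← Finset.prod_mul_distrib, wX, ← Finset.prod_pow]
  refine Finset.prod_le_prod (fun j _ => ?_) fun j _ => h1 _ (hx j)
  have : 0 ≤ x j := hx j
  positivity

/-- Iterated partial derivatives are total derivatives evaluated at fixed vectors. The class of
functions `x ↦ iteratedFDeriv ℝ r f x v` is closed under `partialD j`, which prepends the `j`-th
unit vector to `v`, so the induction runs over all `r` and `v` at once. -/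
theorem IsOrthantSchwartz.rapidFn {f : ↥(orthant d) → ℂ} (hf : IsOrthantSchwartz f) :
    RapidFn (zeroExt d f) := by
  have hb : ∀ m k : ℕ, ∃ C : ℝ, ∀ x ∈ orthant d,
      wX x ^ k * ‖iteratedFDeriv ℝ m (zeroExt d f) x‖ ≤ C := by
    intro m k
    choose C hC using fun s : Finset (Fin d) => hf.decay m fun j => if j ∈ s then k else 0
    refine ⟨(2 ^ k) ^ d * ∑ s, C s, fun x hx => ?_⟩
    calc wX x ^ k * ‖iteratedFDeriv ℝ m (zeroExt d f) x‖
        ≤ ((2 ^ k) ^ d * ∑ s : Finset (Fin d), ∏ j, x j ^ (if j ∈ s then k else 0))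
          * ‖iteratedFDeriv ℝ m (zeroExt d f) x‖ := by
          gcongr
          exact wX_pow_le (orthant_subset d hx) k
      _ = (2 ^ k) ^ d * ∑ s : Finset (Fin d), (∏ j, x j ^ (if j ∈ s then k else 0))
          * ‖iteratedFDeriv ℝ m (zeroExt d f) x‖ := by rw [mul_assoc, Finset.sum_mul]
      _ ≤ _ := by
          gcongr with s
          exact hC s x hx
  have h0 : ∀ (r : ℕ) (v : Fin r → Fin d → ℝ) (k : ℕ), ∃ C : ℝ, ∀ x ∈ orthant d,
      wX x ^ k * ‖iteratedFDeriv ℝ r (zeroExt d f) x v‖ ≤ C := by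
    intro r v k
    obtain ⟨C, hC⟩ := hb r k
    refine ⟨C * ∏ i, ‖v i‖, fun x hx => ?_⟩
    have hw := wX_pos (orthant_subset d hx)
    calc wX x ^ k * ‖iteratedFDeriv ℝ r (zeroExt d f) x v‖
        ≤ wX x ^ k * (‖iteratedFDeriv ℝ r (zeroExt d f) x‖ * ∏ i, ‖v i‖) := by
          gcongr
          exact ContinuousMultilinearMap.le_opNorm _ _
      _ ≤ _ := by
          rw [← mul_assoc]
          gcongr
          exact hC x hx
  have key : ∀ (m r : ℕ) (v : Fin r → Fin d → ℝ),
      DerivDecay m fun x => iteratedFDeriv ℝ r (zeroExt d f) x v := by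
    intro m
    induction m with
    | zero => exact h0
    | succ m ih =>
      intro r v
      refine ⟨h0 r v, fun j => (ih (r + 1) (Fin.cons (Pi.single j 1) v)).congr fun x hx => ?_⟩
      have hd : DifferentiableAt ℝ (iteratedFDeriv ℝ r (zeroExt d f)) x :=
        (hf.contDiffAt hx (r + 1)).differentiableAt_iteratedFDeriv
          (by exact_mod_cast Nat.lt_succ_self r)
      have h1 := ((ContinuousMultilinearMap.apply ℝ (fun _ : Fin r => Fin d → ℝ) ℂ
        v).hasFDerivAt.comp x hd.hasFDerivAt).fderiv
      rw [partialD]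
      change fderiv ℝ ((ContinuousMultilinearMap.apply ℝ (fun _ : Fin r => Fin d → ℝ) ℂ v) ∘
        iteratedFDeriv ℝ r (zeroExt d f)) x _ = _
      rw [h1]
      exact (iteratedFDeriv_succ_apply_left (Fin.cons (Pi.single j 1) v : Fin (r + 1) → _)).symm
  refine ⟨hf.smooth, fun m => (key m 0 0).congr fun x _ => ?_⟩
  exact (iteratedFDeriv_zero_apply _).symm

/-! ## Integration by parts -/

theorem insertNth_mem_orthant {d : ℕ} (j : Fin (d + 1)) {y : Fin d → ℝ} (hy : y ∈ orthant d)
    {t : ℝ} (ht : 0 < t) : (j.insertNth t y : Fin (d + 1) → ℝ) ∈ orthant (d + 1) := by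
  intro i
  refine Fin.succAboveCases j ?_ (fun i => ?_) i
  · simpa using ht
  · simpa using hy i

/-- Fundamental theorem of calculus for `t ↦ t H`. The factor `t` removes the boundary term at `0`,
where `H` itself need not vanish; decay of order two, against the growth of `t`, removes the one at
infinity. -/
theorem integral_partialD_coordMul_slice {d : ℕ} (j : Fin (d + 1))
    {H : (Fin (d + 1) → ℝ) → ℂ} (hH : RapidFn H) {y : Fin d → ℝ} (hy : y ∈ orthant d)
    (hint : IntegrableOn (fun t => partialD j (coordMul j H) (j.insertNth t y)) (Ioi 0)) :
    ∫ t in Ioi 0, partialD j (coordMul j H) (j.insertNth t y) = 0 := by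
  set u : ℝ → ℂ := fun t => (t : ℂ) * H (j.insertNth t y) with hu
  obtain ⟨C, hC0, hC⟩ := hH.norm_le 2
  have hb : ∀ t : ℝ, 0 < t → ‖u t‖ ≤ C * (t * ((1 + t) ^ 2)⁻¹) := by
    intro t ht
    have hm := insertNth_mem_orthant j hy ht
    have h1 := le_wX (orthant_subset _ hm) j
    rw [Fin.insertNth_apply_same] at h1
    rw [hu]
    simp only
    rw [norm_mul, Complex.norm_real, Real.norm_of_nonneg ht.le, mul_left_comm]
    gcongr
    refine (hC _ hm).trans ?_
    gcongr
  have hd : ∀ t ∈ Ioi (0 : ℝ), HasDerivAt u (partialD j (coordMul j H) (j.insertNth t y)) t := by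
    intro t ht
    have hm := insertNth_mem_orthant j hy ht
    have h1 := partialD_hasDerivAt
      (differentiableAt_of_smooth (hH.coordMul j).smooth hm) j
    simp only [Fin.update_insertNth, Fin.insertNth_apply_same, coordMul] at h1
    exact h1
  have hc : ContinuousWithinAt u (Ici 0) 0 := by
    have h0 : u 0 = 0 := by simp [hu]
    rw [ContinuousWithinAt, h0]
    refine squeeze_zero_norm' (a := fun t : ℝ => C * t) ?_ ?_
    · filter_upwards [self_mem_nhdsWithin] with t ht
      rcases (mem_Ici.1 ht).eq_or_lt with h | h
      · simp [← h, h0]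
      · refine (hb t h).trans ?_
        gcongr
        refine mul_le_of_le_one_right h.le (inv_le_one_of_one_le₀ ?_)
        exact one_le_pow₀ (by linarith)
    · have : Continuous fun t : ℝ => C * t := by fun_prop
      have := (this.tendsto 0).mono_left (nhdsWithin_le_nhds (s := Ici 0))
      simpa using this
  have hl : Tendsto u atTop (𝓝 0) := by
    refine squeeze_zero_norm' (a := fun t : ℝ => C * t⁻¹) ?_ ?_
    · filter_upwards [eventually_gt_atTop 0] with t ht
      refine (hb t ht).trans ?_
      gcongr
      rw [← div_eq_mul_inv, div_le_iff₀ (by positivity)]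
      field_simp
      nlinarith
    · simpa using tendsto_inv_atTop_zero.const_mul C
  rw [integral_Ioi_of_hasDerivAt_of_tendsto hc hd hint hl]
  simp [hu]

/-- Fubini with the variable `x_j` integrated first. The slices are known to be integrable for
almost every value of the other variables, which suffices. -/
theorem integral_partialD_coordMul (j : Fin d) {H : (Fin d → ℝ) → ℂ} (hH : RapidFn H) :
    ∫ x in orthant d, partialD j (coordMul j H) x = 0 := by
  obtain _ | d := d
  · exact j.elim0
  have hint := ((hH.coordMul j).partialD j).integrable
  rw [volume_restrict_orthant] at hint ⊢
  have hmp := (measurePreserving_piFinSuccAbove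
    (fun _ : Fin (d + 1) => (volume : Measure ℝ).restrict (Ioi 0)) j).symm
  rw [← hmp.integral_comp' (g := partialD j (coordMul j H))]
  have hint2 := (hmp.integrable_comp_emb (MeasurableEquiv.measurableEmbedding _)).2 hint
  refine (integral_prod_symm _ hint2).trans ?_
  refine integral_eq_zero_of_ae ?_
  have hy : ∀ᵐ y ∂(Measure.pi fun _ : Fin d => (volume : Measure ℝ).restrict (Ioi 0)),
      y ∈ orthant d := by
    rw [← volume_restrict_orthant]
    exact ae_restrict_mem (isOpen_orthant d).measurableSet
  filter_upwards [hy, hint2.prod_left_ae] with y hy hi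
  exact integral_partialD_coordMul_slice j hH hy hi

/-- The Laguerre coefficients. -/
def lagCoeff (F : (Fin d → ℝ) → ℂ) (n : Fin d → ℕ) : ℂ := ∫ x in orthant d, F x * lagPi n x

/-- Symmetry of `E` by Lagrange's identity: `(E F) l_n - F (E l_n)` is minus the sum of `∂_j (x_j
(∂_j F · l_n - F · ∂_j l_n))`, whose integral vanishes, and `E l_n = |n| l_n`. -/
theorem lagCoeff_laguerreOp {F : (Fin d → ℝ) → ℂ} (hF : RapidFn F) (n : Fin d → ℕ) :
    lagCoeff (laguerreOp F) n = ((∑ j, n j : ℕ) : ℂ) * lagCoeff F n := by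
  have hL := rapidFn_lagPi n
  set H : Fin d → (Fin d → ℝ) → ℂ :=
    fun j => partialD j F * lagPi n - F * partialD j (lagPi n) with hH
  have hHr : ∀ j, RapidFn (H j) := fun j =>
    ((hF.partialD j).mul hL).sub (hF.mul (hL.partialD j))
  have key : ∀ x ∈ orthant d, laguerreOp F x * lagPi n x
      = ((∑ j, n j : ℕ) : ℂ) * (F x * lagPi n x) - ∑ j, partialD j (coordMul j (H j)) x := by
    intro x hx
    have h1 : ∀ j, partialD j (coordMul j (H j)) x
        = (x j * partialD j (partialD j F) x + partialD j F x) * lagPi n x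
          - F x * (x j * partialD j (partialD j (lagPi n)) x + partialD j (lagPi n) x) := by
      intro j
      rw [partialD_coordMul j j (hHr j).smooth hx]
      have e : H j = partialD j F * lagPi n + (-1 : ℂ) • (F * partialD j (lagPi n)) := by
        rw [hH, neg_one_smul, ← sub_eq_add_neg]
      have h2 : partialD j (H j) x = partialD j (partialD j F) x * lagPi n x
          - F x * partialD j (partialD j (lagPi n)) x := by
        have s1 := ((hF.partialD j).mul hL).smooth
        have s2 := (hF.mul (hL.partialD j)).smooth
        have s3 : ContDiffOn ℝ ∞ ((-1 : ℂ) • (F * LagPil.partialD j (lagPi n))) (orthant d) :=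
          s2.const_smul (-1 : ℂ)
        rw [e, partialD_add j s1 s3 hx]
        simp only [Pi.add_apply]
        rw [partialD_smul j _ s2 hx, partialD_mul j (hF.partialD j).smooth hL.smooth hx]
        simp only [Pi.smul_apply, smul_eq_mul]
        rw [partialD_mul j hF.smooth (hL.partialD j).smooth hx]
        simp only [Pi.add_apply, Pi.mul_apply]
        ring
      simp only [if_true, one_smul, Pi.add_apply, coordMul, h2]
      simp only [hH, Pi.sub_apply, Pi.mul_apply]
      ring
    simp only [h1, laguerreOp]
    push_cast
    rw [neg_mul, Finset.sum_mul, Finset.sum_mul, ← Finset.sum_neg_distrib,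
      ← Finset.sum_sub_distrib]
    refine Finset.sum_congr rfl fun j _ => ?_
    linear_combination -(F x) * lagPi_ode n j x
  have hi : Integrable (fun x => ((∑ j, n j : ℕ) : ℂ) * (F x * lagPi n x))
      (volume.restrict (orthant d)) := (hF.mul hL).integrable.const_mul _
  rw [lagCoeff, setIntegral_congr_fun (isOpen_orthant d).measurableSet key,
    integral_sub hi
      (integrable_finsetSum _ fun j _ => (((hHr j).coordMul j).partialD j).integrable),
    integral_finsetSum _ fun j _ => (((hHr j).coordMul j).partialD j).integrable]
  simp only [integral_partialD_coordMul _ (hHr _), Finset.sum_const_zero, sub_zero]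
  rw [integral_const_mul, lagCoeff]

theorem lagCoeff_laguerreOp_iter {F : (Fin d → ℝ) → ℂ} (hF : RapidFn F) (n : Fin d → ℕ) (N : ℕ) :
    lagCoeff (laguerreOp^[N] F) n = ((∑ j, n j : ℕ) : ℂ) ^ N * lagCoeff F n := by
  induction N with
  | zero => simp
  | succ N ih =>
    rw [Function.iterate_succ_apply', lagCoeff_laguerreOp (hF.laguerreOp_iter N), ih]
    ring

/-! ## Decay of the Laguerre coefficients -/

theorem integral_lagPi_mul_lagPi (n m : Fin d → ℕ) :
    ∫ x in orthant d, lagPi n x * lagPi m x = if n = m then 1 else 0 := by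
  have h1 : ∀ x : Fin d → ℝ, lagPi n x * lagPi m x
      = ∏ j, ((lagFun (n j) (x j) * lagFun (m j) (x j) : ℝ) : ℂ) := by
    intro x
    rw [lagPi, lagPi, ← Finset.prod_mul_distrib]
    exact Finset.prod_congr rfl fun j _ => (Complex.ofReal_mul _ _).symm
  simp only [h1]
  rw [volume_restrict_orthant,
    integral_fintype_prod_eq_prod (fun (j : Fin d) (t : ℝ) =>
      ((lagFun (n j) t * lagFun (m j) t : ℝ) : ℂ))]
  simp only [integral_complex_ofReal, lagFun_inner]
  split_ifs with h
  · simp [h]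
  · obtain ⟨j, hj⟩ := Function.ne_iff.1 h
    exact Finset.prod_eq_zero (Finset.mem_univ j) (by simp [hj])

theorem eLpNorm_lagPi (n : Fin d → ℕ) : eLpNorm (lagPi n) 2 (volume.restrict (orthant d)) = 1 := by
  rw [(rapidFn_lagPi n).memLp.eLpNorm_eq_integral_rpow_norm (by norm_num) (by norm_num)]
  have h1 : ∫ x in orthant d, ‖lagPi n x‖ ^ (2 : ℝ≥0∞).toReal = 1 := by
    have h2 := integral_lagPi_mul_lagPi n n
    rw [if_pos rfl] at h2
    have h3 : ∀ x, lagPi n x * lagPi n x = ((‖lagPi n x‖ ^ (2 : ℝ≥0∞).toReal : ℝ) : ℂ) := by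
      intro x
      have : lagPi n x = ((∏ j, lagFun (n j) (x j) : ℝ) : ℂ) := by
        rw [lagPi, Complex.ofReal_prod]
      rw [this, Complex.norm_real, ENNReal.toReal_ofNat, Real.rpow_ofNat, Real.norm_eq_abs, sq_abs,
        sq, Complex.ofReal_mul]
    simp only [h3, integral_complex_ofReal] at h2
    exact_mod_cast h2
  rw [h1, Real.one_rpow, ENNReal.ofReal_one]

theorem enorm_lagCoeff_le {F : (Fin d → ℝ) → ℂ} (hF : RapidFn F) (n : Fin d → ℕ) :
    ‖lagCoeff F n‖ₑ ≤ eLpNorm F 2 (volume.restrict (orthant d)) := by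
  have h1 := eLpNorm_smul_le_mul_eLpNorm (p := 2) (q := 2) (r := 1)
    (rapidFn_lagPi n).memLp.aestronglyMeasurable hF.memLp.aestronglyMeasurable
  rw [eLpNorm_lagPi, mul_one, eLpNorm_one_eq_lintegral_enorm] at h1
  exact (enorm_integral_le_lintegral_enorm _).trans h1

/-- The left side is the modulus of the `n`-th coefficient of `E^N f`, at most `‖E^N f‖` by
Cauchy–Schwarz because `l_n` has unit norm. -/
theorem norm_lagCoeff_mul_pow_le {α : ℝ} (f : PSpace d α) (h : {h : ℝ // 0 < h})
    (n : Fin d → ℕ) (N : ℕ) :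
    ‖lagCoeff (zeroExt d f.1) n‖ * ((∑ j, n j : ℕ) : ℝ) ^ N
      ≤ etaNorm d α h f * (h.1 ^ N * (Nat.factorial N : ℝ) ^ α) := by
  have hF := f.2.1.rapidFn
  have hc : 0 < h.1 ^ N * (Nat.factorial N : ℝ) ^ α := by
    have := h.2
    positivity
  have h1 := enorm_lagCoeff_le (hF.laguerreOp_iter N) n
  rw [lagCoeff_laguerreOp_iter hF] at h1
  have h2 : eLpNorm (laguerreOp^[N] (zeroExt d f.1)) 2 (volume.restrict (orthant d))
      ≤ eta α h.1 f.1 * ENNReal.ofReal (h.1 ^ N * (Nat.factorial N : ℝ) ^ α) := by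
    rw [← ENNReal.div_le_iff (by simpa using hc) ENNReal.ofReal_ne_top]
    exact le_iSup (fun N : ℕ => eLpNorm (laguerreOp^[N] (zeroExt d f.1)) 2
      (volume.restrict (orthant d)) / ENNReal.ofReal (h.1 ^ N * (Nat.factorial N : ℝ) ^ α)) N
  have h3 := ENNReal.toReal_mono (ENNReal.mul_ne_top (f.2.2 h.1 h.2).ne ENNReal.ofReal_ne_top)
    (h1.trans h2)
  rw [toReal_enorm, ENNReal.toReal_mul, ENNReal.toReal_ofReal hc.le, norm_mul, norm_pow,
    Complex.norm_natCast, mul_comm] at h3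
  exact h3

/-- Taking `α`-th roots turns `N!^α` into `N!`. Dividing by `(2κ)^N N!` and summing over `N` gives
an exponential on the left and a geometric series of sum `2` on the right; raising to the power `α`
restores the original quantities. -/
theorem mul_exp_le_of_forall_pow_le {α κ a t M : ℝ} (hα : 0 < α) (hκ : 0 < κ) (ha : 0 ≤ a)
    (ht : 0 ≤ t) (hM : 0 ≤ M)
    (H : ∀ N : ℕ, a * t ^ N ≤ M * ((κ ^ α) ^ N * (Nat.factorial N : ℝ) ^ α)) :
    a * Real.exp (α / (2 * κ) * t ^ (1 / α)) ≤ 2 ^ α * M := by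
  set u := t ^ (1 / α) with hu
  set b := a ^ (1 / α) with hb
  set m := M ^ (1 / α) with hm
  have root : ∀ {s : ℝ}, 0 ≤ s → (s ^ (1 / α)) ^ α = s := by
    intro s hs
    rw [← Real.rpow_mul hs, one_div, inv_mul_cancel₀ hα.ne', Real.rpow_one]
  have hu0 : 0 ≤ u := by positivity
  have hb0 : 0 ≤ b := by positivity
  have hm0 : 0 ≤ m := by positivity
  have h1 : ∀ N : ℕ, b * u ^ N ≤ m * (κ ^ N * (Nat.factorial N : ℝ)) := by
    intro N
    rw [← Real.rpow_le_rpow_iff (by positivity) (by positivity) hα, Real.mul_rpow hb0 (by positivity),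
      Real.mul_rpow hm0 (by positivity), root ha, root hM, Real.mul_rpow (by positivity)
      (by positivity), ← Real.rpow_natCast u, ← Real.rpow_mul hu0, mul_comm (N : ℝ) α,
      Real.rpow_mul hu0, root ht, ← Real.rpow_natCast κ, ← Real.rpow_mul hκ.le,
      mul_comm (N : ℝ) α, Real.rpow_mul hκ.le, Real.rpow_natCast, Real.rpow_natCast]
    exact H N
  have h2 : ∀ N : ℕ, b * ((u / (2 * κ)) ^ N / (Nat.factorial N : ℝ)) ≤ m * (1 / 2) ^ N := by
    intro N
    have hp : (0 : ℝ) < (2 * κ) ^ N * (Nat.factorial N : ℝ) := by positivity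
    calc b * ((u / (2 * κ)) ^ N / (Nat.factorial N : ℝ))
        = b * u ^ N / ((2 * κ) ^ N * (Nat.factorial N : ℝ)) := by rw [div_pow]; field_simp
      _ ≤ m * (κ ^ N * (Nat.factorial N : ℝ)) / ((2 * κ) ^ N * (Nat.factorial N : ℝ)) := by
          exact div_le_div_of_nonneg_right (h1 N) hp.le
      _ = m * (1 / 2) ^ N := by rw [mul_pow, div_pow]; field_simp; simp
  have h3 : b * Real.exp (u / (2 * κ)) ≤ m * 2 := by
    have s1 : HasSum (fun N : ℕ => (u / (2 * κ)) ^ N / (Nat.factorial N : ℝ))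
        (Real.exp (u / (2 * κ))) := by
      rw [Real.exp_eq_exp_ℝ]
      exact NormedSpace.expSeries_div_hasSum_exp _
    exact hasSum_le h2 (s1.mul_left b) (hasSum_geometric_two.mul_left m)
  have h4 := Real.rpow_le_rpow (by positivity) h3 hα.le
  rw [Real.mul_rpow hb0 (by positivity), Real.mul_rpow hm0 (by positivity), root ha, root hM,
    ← Real.exp_mul] at h4
  calc a * Real.exp (α / (2 * κ) * u) = a * Real.exp (u / (2 * κ) * α) := by ring_nf
    _ ≤ M * 2 ^ α := h4
    _ = _ := mul_comm _ _

theorem kappa_pos {α h : ℝ} (hα : 0 < α) (hh : 0 < h) : 0 < (α / (2 * h)) ^ α := by positivity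

theorem norm_lagCoeff_mul_weight_le {α : ℝ} (hα : 0 < α) (f : PSpace d α) (h : {h : ℝ // 0 < h})
    (n : Fin d → ℕ) : ‖lagCoeff (zeroExt d f.1) n‖ * weight h.1 (α / 2) n
      ≤ 2 ^ α * etaNorm d α ⟨_, kappa_pos hα h.2⟩ f := by
  -- `κ = α / (2h)` is chosen so that the exponent `α / (2κ)` of the previous estimate equals the
  -- prescribed `h`.
  have hκ : 0 < α / (2 * h.1) := div_pos hα (mul_pos two_pos h.2)
  have h1 := mul_exp_le_of_forall_pow_le hα hκ (norm_nonneg (lagCoeff (zeroExt d f.1) n))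
    (Nat.cast_nonneg (∑ j, n j)) (apply_nonneg (etaNorm d α ⟨_, kappa_pos hα h.2⟩) f)
    (norm_lagCoeff_mul_pow_le f _ n)
  have h2 : α / (2 * (α / (2 * h.1))) = h.1 := by
    have := h.2.ne'
    field_simp
  rw [h2] at h1
  rw [weight, mul_div_cancel₀ α (two_ne_zero' ℝ)]
  exact h1

theorem lagCoeff_add {F G : (Fin d → ℝ) → ℂ} (hF : RapidFn F) (hG : RapidFn G) (n : Fin d → ℕ) :
    lagCoeff (F + G) n = lagCoeff F n + lagCoeff G n := by
  have hL := rapidFn_lagPi n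
  refine Eq.trans ?_ (integral_add (hF.mul hL).integrable (hG.mul hL).integrable)
  exact integral_congr_ae (Eventually.of_forall fun x => add_mul _ _ _)

theorem lagCoeff_smul (c : ℂ) (F : (Fin d → ℝ) → ℂ) (n : Fin d → ℕ) :
    lagCoeff (c • F) n = c * lagCoeff F n := by
  rw [lagCoeff, lagCoeff, ← integral_const_mul]
  exact integral_congr_ae (Eventually.of_forall fun x => mul_assoc _ _ _)

/-- The map sending a function to the sequence of its Laguerre coefficients. -/
def lagCoeffMap (d : ℕ) {α : ℝ} (hα : 0 < α) : PSpace d α →ₗ[ℂ] SeqSpace d (α / 2) where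
  toFun f := ⟨lagCoeff (zeroExt d f.1), fun h hh => ⟨_, by
    rintro _ ⟨n, rfl⟩
    exact norm_lagCoeff_mul_weight_le hα f ⟨h, hh⟩ n⟩⟩
  map_add' f g := by
    refine Subtype.ext (funext fun n => ?_)
    change lagCoeff (zeroExt d (f.1 + g.1)) n = _
    rw [map_add]
    exact lagCoeff_add f.2.1.rapidFn g.2.1.rapidFn n
  map_smul' c f := by
    refine Subtype.ext (funext fun n => ?_)
    change lagCoeff (zeroExt d (c • f.1)) n = _
    rw [map_smul]
    exact lagCoeff_smul c _ n

theorem lagCoeffMap_apply {α : ℝ} (hα : 0 < α) (f : PSpace d α) (n : Fin d → ℕ) :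
    lagCoeffMap d hα f n = lagCoeff (zeroExt d f.1) n := rfl

theorem continuous_lagCoeffMap {α : ℝ} (hα : 0 < α) : Continuous (lagCoeffMap d hα) :=
  continuous_of_seminorm_le (pSpace_withSeminorms d α) (seqSpace_withSeminorms d _) _
    fun h => ⟨⟨_, kappa_pos hα h.2⟩, 2 ^ α, by positivity, fun f =>
      ciSup_le fun n => norm_lagCoeff_mul_weight_le hα f h n⟩

/-! ## Completeness of the Laguerre functions -/

theorem RapidSeq.summable_norm {a : (Fin d → ℕ) → ℂ} (ha : RapidSeq a) :
    Summable fun n => ‖a n‖ := by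
  simpa using ha 0

theorem rapidFn_lagSeries {a : (Fin d → ℕ) → ℂ} (ha : RapidSeq a) : RapidFn (lagSeries a) :=
  (polyFamily_lagPi.isOrthantSchwartz ha).rapidFn.congr (zeroExt_restrict (lagSeries a)).symm

theorem integral_norm_mul_lagPi_le {F : (Fin d → ℝ) → ℂ} (hF : RapidFn F) (n : Fin d → ℕ) :
    ∫ x in orthant d, ‖F x * lagPi n x‖ ≤ (eLpNorm F 2 (volume.restrict (orthant d))).toReal := by
  have h1 := eLpNorm_smul_le_mul_eLpNorm (p := 2) (q := 2) (r := 1)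
    (rapidFn_lagPi n).memLp.aestronglyMeasurable hF.memLp.aestronglyMeasurable
  rw [eLpNorm_lagPi, mul_one, eLpNorm_one_eq_lintegral_enorm] at h1
  refine (integral_norm_eq_lintegral_enorm
    (hF.mul (rapidFn_lagPi n)).integrable.aestronglyMeasurable).trans_le ?_
  exact ENNReal.toReal_mono hF.memLp.eLpNorm_ne_top h1

/-- Integral and sum may be exchanged because `∫ |F l_n| ≤ ‖F‖₂` uniformly in `n`, so absolute
summability of `c` is enough. In particular the geometric sequences of the generating function are
admissible. -/
theorem hasSum_mul_lagCoeff {F : (Fin d → ℝ) → ℂ} (hF : RapidFn F) {c : (Fin d → ℕ) → ℂ}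
    (hc : Summable fun n => ‖c n‖) :
    HasSum (fun n => c n * lagCoeff F n) (∫ x in orthant d, F x * lagSeries c x) := by
  have hi : ∀ n, Integrable (fun x => c n * (F x * lagPi n x)) (volume.restrict (orthant d)) :=
    fun n => (hF.mul (rapidFn_lagPi n)).integrable.const_mul (c n)
  have hs : Summable fun n => ∫ x in orthant d, ‖c n * (F x * lagPi n x)‖ := by
    refine Summable.of_nonneg_of_le (fun n => integral_nonneg fun x => norm_nonneg _)
      (fun n => ?_) (hc.mul_right (eLpNorm F 2 (volume.restrict (orthant d))).toReal)
    simp only [norm_mul (c n)]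
    rw [integral_const_mul]
    exact mul_le_mul_of_nonneg_left (integral_norm_mul_lagPi_le hF n) (norm_nonneg _)
  have h := hasSum_integral_of_summable_integral_norm hi hs
  simp only [integral_const_mul] at h
  have e : ∀ x, F x * lagSeries c x = ∑' n, c n * (F x * lagPi n x) := by
    intro x
    rw [lagSeries, ← tsum_mul_left]
    exact tsum_congr fun n => mul_left_comm _ _ _
  simp only [e]
  exact h

theorem lagCoeff_lagSeries {a : (Fin d → ℕ) → ℂ} (ha : RapidSeq a) (n : Fin d → ℕ) :
    lagCoeff (lagSeries a) n = a n := by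
  have h := (hasSum_mul_lagCoeff (rapidFn_lagPi n) ha.summable_norm).tsum_eq
  simp only [lagCoeff, integral_lagPi_mul_lagPi] at h ⊢
  rw [tsum_eq_single n (fun m hm => by rw [if_neg hm.symm, mul_zero]), if_pos rfl, mul_one] at h
  rw [h]
  exact integral_congr_ae (Eventually.of_forall fun x => mul_comm _ _)

/-- Each factor `e^{-x_j s_j}` is a Laguerre series with geometric coefficients, so their product is
an absolutely summable Laguerre series in `d` variables, to which `G` is orthogonal term by term. -/
theorem integral_mul_exp_eq_zero {G : (Fin d → ℝ) → ℂ} (hG : RapidFn G)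
    (h0 : ∀ n, lagCoeff G n = 0) {s : Fin d → ℂ} (hs : ∀ j, 0 < (s j).re) :
    ∫ x in orthant d, G x * ∏ j, Complex.exp (-(x j * s j)) = 0 := by
  choose r hr hexp using fun j => exists_lagFun_expansion_exp (hs j)
  have hc : Summable fun n : Fin d → ℕ => ‖∏ j, r j ^ n j‖ := by
    refine (tsum_prod_pi (fun j k => r j ^ k) fun j => ?_).1
    simpa only [norm_pow] using summable_geometric_of_lt_one (norm_nonneg _) (hr j)
  have h1 := (hasSum_mul_lagCoeff hG hc).tsum_eq
  simp only [h0, mul_zero, tsum_zero] at h1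
  have h2 : ∀ x ∈ orthant d, G x * ∏ j, Complex.exp (-(x j * s j))
      = (∏ j, (1 - r j)) * (G x * lagSeries (fun n => ∏ j, r j ^ n j) x) := by
    intro x hx
    have h3 : lagSeries (fun n => ∏ j, r j ^ n j) x
        = ∏ j, ∑' k, r j ^ k * (lagFun k (x j) : ℂ) := by
      rw [← (tsum_prod_pi (fun j k => r j ^ k * (lagFun k (x j) : ℂ))
        fun j => summable_lagFun_norm (hx j).le (hr j)).2]
      exact tsum_congr fun n => by rw [lagPi, ← Finset.prod_mul_distrib]
    rw [h3, mul_left_comm, ← Finset.prod_mul_distrib]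
    congr 1
    exact Finset.prod_congr rfl fun j _ => (hexp j (x j) (hx j).le).symm
  rw [setIntegral_congr_fun (isOpen_orthant d).measurableSet h2, integral_const_mul, ← h1, mul_zero]

/-- For `s_j = 1 + 2πi w_j` the Laplace integral is the Fourier transform at `w` of `G(x) e^{-∑
x_j}`, extended by zero outside the orthant. It vanishes identically, so Fourier inversion at points
of continuity, which include the open orthant, gives `G = 0` there. The function is moved to
`EuclideanSpace` because the Fourier transform uses the inner product. -/
theorem eq_zero_of_lagCoeff_eq_zero {G : (Fin d → ℝ) → ℂ} (hG : RapidFn G)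
    (h0 : ∀ n, lagCoeff G n = 0) {x : Fin d → ℝ} (hx : x ∈ orthant d) : G x = 0 := by
  set g : (Fin d → ℝ) → ℂ :=
    (orthant d).indicator fun x => G x * ∏ j, Complex.exp (-(x j : ℂ)) with hg
  set f : EuclideanSpace ℝ (Fin d) → ℂ := fun v => g v.ofLp with hf
  have hm := (isOpen_orthant d).measurableSet
  have hmp := EuclideanSpace.volume_preserving_symm_measurableEquiv_toLp (Fin d)
  have hcont : Continuous fun x : Fin d → ℝ => ∏ j, Complex.exp (-(x j : ℂ)) := by fun_prop
  have hgi : Integrable g := by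
    rw [hg, integrable_indicator_iff hm]
    refine Integrable.mono hG.integrable
      (hG.integrable.aestronglyMeasurable.mul hcont.aestronglyMeasurable)
      ((ae_restrict_iff' hm).2 (Eventually.of_forall fun y hy => ?_))
    rw [norm_mul, norm_prod]
    refine mul_le_of_le_one_right (norm_nonneg _) (Finset.prod_le_one (fun _ _ => norm_nonneg _)
      fun j _ => ?_)
    rw [Complex.norm_exp, Complex.neg_re, Complex.ofReal_re]
    exact Real.exp_le_one_iff.2 (neg_nonpos.2 (hy j).le)
  have hfi : Integrable f := (hmp.integrable_comp_emb (MeasurableEquiv.measurableEmbedding _)).2 hgi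
  have hF : FourierTransform.fourier f = 0 := by
    funext w
    rw [Real.fourier_eq']
    set s : Fin d → ℂ := fun j => 1 + (2 * Real.pi * w j : ℝ) * Complex.I with hs
    have h1 := integral_mul_exp_eq_zero hG h0 (s := s) fun j => by simp [hs]
    rw [← integral_indicator hm, ← hmp.integral_comp'] at h1
    rw [Pi.zero_apply, ← h1]
    refine integral_congr_ae (Eventually.of_forall fun v => ?_)
    change _ • (orthant d).indicator _ v.ofLp = (orthant d).indicator _ v.ofLp
    by_cases hv : v.ofLp ∈ orthant d
    · simp only [indicator_of_mem hv, smul_eq_mul]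
      rw [mul_left_comm, ← Complex.exp_sum, ← Complex.exp_sum, ← Complex.exp_add]
      congr 2
      rw [PiLp.inner_apply, Finset.mul_sum, Complex.ofReal_sum, Finset.sum_mul,
        ← Finset.sum_add_distrib]
      refine Finset.sum_congr rfl fun j _ => ?_
      simp [hs]
      ring
    · simp only [indicator_of_notMem hv, smul_zero]
  have hc : ContinuousAt f (WithLp.toLp 2 x) := by
    have hgc : ContinuousAt g x := by
      have h2 : ContinuousAt (fun x => G x * ∏ j, Complex.exp (-(x j : ℂ))) x :=
        (hG.smooth.continuousOn.continuousAt ((isOpen_orthant d).mem_nhds hx)).mul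
          hcont.continuousAt
      refine h2.congr ?_
      filter_upwards [(isOpen_orthant d).mem_nhds hx] with y hy
      rw [hg, indicator_of_mem hy]
    exact ContinuousAt.comp (x := WithLp.toLp 2 x) (f := WithLp.ofLp) (g := g) hgc
      (PiLp.continuous_ofLp 2 _).continuousAt
  have h3 := hfi.fourierInv_fourier_eq (by rw [hF]; exact integrable_zero _ _ _) hc
  rw [hF, Real.fourierInv_eq'] at h3
  simp only [Pi.zero_apply, smul_zero, integral_zero] at h3
  have h4 : g x = 0 := h3.symm
  rw [hg, indicator_of_mem hx] at h4
  exact (mul_eq_zero.1 h4).resolve_right (Finset.prod_ne_zero_iff.2 fun j _ => Complex.exp_ne_zero _)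

/-- The difference of `f` and its Laguerre series is rapidly decreasing and has no Laguerre
coefficients, so completeness applies. -/
theorem eq_lagSeries_lagCoeffMap {α : ℝ} (hα : 0 < α) (f : PSpace d α) (y : ↥(orthant d)) :
    f y = lagSeries (lagCoeffMap d hα f : _ → ℂ) y.1 := by
  set a := lagCoeffMap d hα f with ha
  have har := a.rapidSeq (half_pos hα)
  have hF := f.2.1.rapidFn
  have hG := hF.add ((rapidFn_lagSeries har).smul (-1))
  have h0 : ∀ n, lagCoeff (zeroExt d f.1 + (-1 : ℂ) • lagSeries (a : _ → ℂ)) n = 0 := by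
    intro n
    rw [lagCoeff_add hF ((rapidFn_lagSeries har).smul (-1)), lagCoeff_smul, lagCoeff_lagSeries har,
      ha, lagCoeffMap_apply]
    ring
  have h1 := eq_zero_of_lagCoeff_eq_zero hG h0 y.2
  rw [Pi.add_apply, Pi.smul_apply, zeroExt_apply f.1 y.2, smul_eq_mul, neg_one_mul,
    ← sub_eq_add_neg, sub_eq_zero] at h1
  exact h1

/-! ## The isomorphism -/

theorem closedExt_lagSeriesMap {α : ℝ} (hα : 0 < α) (a : SeqSpace d (α / 2)) {x : Fin d → ℝ}
    (hx : x ∈ closedOrthant d) : closedExt (lagSeriesMap d hα a).1 x = lagSeries (a : _ → ℂ) x :=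
  closedExt_eq_lagSeries (a.rapidSeq (half_pos hα)) (fun _ => rfl) hx

theorem lagSeriesMap_lagCoeffMap {α : ℝ} (hα : 0 < α) (f : PSpace d α) :
    lagSeriesMap d hα (lagCoeffMap d hα f) = f :=
  Subtype.ext (funext fun y => (eq_lagSeries_lagCoeffMap hα f y).symm)

/-- The Hermite series as a map onto the Pilipović space. -/
def hermiteSeriesMap (d : ℕ) {β : ℝ} (hβ : 0 < β) : SeqSpace d β →ₗ[ℂ] PilipovicSpace d β hβ :=
  (hermiteSeries d β hβ).rangeRestrict

theorem continuous_hermiteSeriesMap {β : ℝ} (hβ : 0 < β) :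
    Continuous (hermiteSeriesMap d hβ) := continuous_coinduced_rng

/-- The substitution `f ↦ f ∘ v`, through the Laguerre coefficients of `f`. -/
def toPilipovic (d : ℕ) {α : ℝ} (hα : 0 < α) :
    PSpace d α →ₗ[ℂ] PilipovicSpace d (α / 2) (half_pos hα) :=
  hermiteSeriesMap d (half_pos hα) ∘ₗ isTriangular_lagToHerm.map (half_pos hα) ∘ₗ lagCoeffMap d hα

theorem continuous_toPilipovic {α : ℝ} (hα : 0 < α) : Continuous (toPilipovic d hα) :=
  (continuous_hermiteSeriesMap _).comp
    ((isTriangular_lagToHerm.continuous_map (half_pos hα)).comp (continuous_lagCoeffMap hα))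

theorem toPilipovic_apply {α : ℝ} (hα : 0 < α) (f : PSpace d α) (x : Fin d → ℝ) :
    (toPilipovic d hα f).1 x = closedExt f.1 (vMap x) := by
  refine (hermiteSeries_lagToHerm (half_pos hα) (lagCoeffMap d hα f) x).trans ?_
  -- With `f` written as its own Laguerre series, the values of its extension on the boundary are
  -- given by the same series.
  conv_rhs => rw [← lagSeriesMap_lagCoeffMap hα f]
  exact (closedExt_lagSeriesMap hα _ (vMap_mem x)).symm

theorem toPilipovic_mem_even {α : ℝ} (hα : 0 < α) (f : PSpace d α) :
    toPilipovic d hα f ∈ evenPilipovic d (α / 2) (half_pos hα) := by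
  intro x j
  rw [toPilipovic_apply, toPilipovic_apply]
  congr 1
  funext i
  by_cases h : i = j
  · subst h
    simp [vMap]
  · simp [vMap, Function.update_of_ne h]

theorem vMap_wMap {x : Fin d → ℝ} (hx : x ∈ closedOrthant d) : vMap (wMap x) = x :=
  funext fun j => Real.sq_sqrt (hx j)

theorem evenPart_wMap {α : ℝ} (hα : 0 < α) (b : SeqSpace d (α / 2)) (y : ↥(orthant d)) :
    evenPart (hermiteSeries d (α / 2) (half_pos hα) b) (wMap y.1)
      = lagSeriesMap d hα (isTriangular_hermToLag.map (half_pos hα) b) y := by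
  rw [evenPart_hermiteSeries, vMap_wMap (orthant_subset d y.2)]
  rfl

theorem evenPart_add (F G : (Fin d → ℝ) → ℂ) (x : Fin d → ℝ) :
    evenPart (F + G) x = evenPart F x + evenPart G x := by
  simp [evenPart, Finset.sum_add_distrib, mul_add]

theorem evenPart_smul (c : ℂ) (F : (Fin d → ℝ) → ℂ) (x : Fin d → ℝ) :
    evenPart (c • F) x = c * evenPart F x := by
  simp [evenPart, Finset.mul_sum, mul_left_comm]

/-- The substitution `ψ ↦ ψ ∘ w` on even parts, on the whole Pilipović space. -/
def ofPilipovic (d : ℕ) {α : ℝ} (hα : 0 < α) :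
    PilipovicSpace d (α / 2) (half_pos hα) →ₗ[ℂ] PSpace d α where
  toFun ψ := ⟨fun y => evenPart ψ.1 (wMap y.1), by
    obtain ⟨_, b, rfl⟩ := ψ
    have e := funext (evenPart_wMap hα b)
    rw [e]
    exact (lagSeriesMap d hα (isTriangular_hermToLag.map (half_pos hα) b)).2⟩
  map_add' ψ φ := Subtype.ext (funext fun y => evenPart_add ψ.1 φ.1 _)
  map_smul' c ψ := Subtype.ext (funext fun y => evenPart_smul c ψ.1 _)

theorem ofPilipovic_hermiteSeriesMap {α : ℝ} (hα : 0 < α) (b : SeqSpace d (α / 2)) :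
    ofPilipovic d hα (hermiteSeriesMap d (half_pos hα) b)
      = lagSeriesMap d hα (isTriangular_hermToLag.map (half_pos hα) b) :=
  Subtype.ext (funext (evenPart_wMap hα b))

/-- For a coinduced topology, continuity is tested after composition with the Hermite series map.
This works because `ofPilipovic` is defined on the whole space by taking even parts, not only on
even functions. -/
theorem continuous_ofPilipovic {α : ℝ} (hα : 0 < α) : Continuous (ofPilipovic d hα) := by
  refine continuous_coinduced_dom.2 ?_
  have e : ofPilipovic d hα ∘ hermiteSeriesMap d (half_pos hα)
      = lagSeriesMap d hα ∘ isTriangular_hermToLag.map (half_pos hα) :=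
    funext (ofPilipovic_hermiteSeriesMap hα)
  change Continuous (ofPilipovic d hα ∘ hermiteSeriesMap d (half_pos hα))
  rw [e]
  exact (continuous_lagSeriesMap hα).comp (isTriangular_hermToLag.continuous_map _)

theorem ofPilipovic_apply {α : ℝ} (hα : 0 < α) {ψ : PilipovicSpace d (α / 2) (half_pos hα)}
    (hψ : ψ ∈ evenPilipovic d (α / 2) (half_pos hα)) (y : ↥(orthant d)) :
    ofPilipovic d hα ψ y = ψ (wMap y.1) :=
  evenPart_eq_self hψ _

theorem closedExt_coe {α : ℝ} (hα : 0 < α) (f : PSpace d α) (y : ↥(orthant d)) :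
    closedExt f.1 y.1 = f y := by
  conv_lhs => rw [← lagSeriesMap_lagCoeffMap hα f]
  rw [closedExt_lagSeriesMap hα _ (orthant_subset d y.2), ← eq_lagSeries_lagCoeffMap]

theorem ofPilipovic_toPilipovic {α : ℝ} (hα : 0 < α) (f : PSpace d α) :
    ofPilipovic d hα (toPilipovic d hα f) = f := by
  refine Subtype.ext (funext fun y => ?_)
  refine (ofPilipovic_apply hα (toPilipovic_mem_even hα f) y).trans ?_
  rw [toPilipovic_apply, vMap_wMap (orthant_subset d y.2), closedExt_coe hα]

theorem toPilipovic_ofPilipovic {α : ℝ} (hα : 0 < α) {ψ : PilipovicSpace d (α / 2) (half_pos hα)}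
    (hψ : ψ ∈ evenPilipovic d (α / 2) (half_pos hα)) :
    toPilipovic d hα (ofPilipovic d hα ψ) = ψ := by
  refine Subtype.ext (funext fun x => ?_)
  rw [toPilipovic_apply]
  -- Any coefficient sequence representing `ψ` serves; uniqueness of Hermite expansions is not
  -- needed.
  obtain ⟨b, hb⟩ := ψ.2
  obtain rfl : hermiteSeriesMap d (half_pos hα) b = ψ := Subtype.ext hb
  rw [ofPilipovic_hermiteSeriesMap, closedExt_lagSeriesMap hα _ (vMap_mem x)]
  exact (evenPart_hermiteSeries (half_pos hα) b x).symm.trans (evenPart_eq_self hψ x)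

/-- The substitution `f ↦ f ∘ v` as a linear homeomorphism. -/
def evenPilipovicEquiv (d : ℕ) {α : ℝ} (hα : 0 < α) :
    PSpace d α ≃L[ℂ] ↥(evenPilipovic d (α / 2) (half_pos hα)) where
  toLinearMap := (toPilipovic d hα).codRestrict _ (toPilipovic_mem_even hα)
  invFun ψ := ofPilipovic d hα ψ.1
  left_inv f := ofPilipovic_toPilipovic hα f
  right_inv ψ := Subtype.ext (toPilipovic_ofPilipovic hα ψ.2)
  continuous_toFun := (continuous_toPilipovic hα).subtype_mk _
  continuous_invFun := (continuous_ofPilipovic hα).comp continuous_subtype_val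

end LagPil

end

theorem mainTheorem7 (d : ℕ) (hd : 1 ≤ d) (α : ℝ) (hα : 0 < α) :
    ∃ Φ : LagPil.PSpace d α ≃L[ℂ] ↥(LagPil.evenPilipovic d (α / 2) (half_pos hα)),
      (∀ (f : LagPil.PSpace d α) (x : Fin d → ℝ),
        (Φ f).1.1 x = LagPil.closedExt f.1 (LagPil.vMap x)) ∧
      (∀ (ψ : ↥(LagPil.evenPilipovic d (α / 2) (half_pos hα))) (y : ↥(LagPil.orthant d)),
        (Φ.symm ψ).1 y = ψ.1.1 (LagPil.wMap y.1)) :=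
  ⟨LagPil.evenPilipovicEquiv d hα, fun f x => LagPil.toPilipovic_apply hα f x,
    fun ψ y => LagPil.ofPilipovic_apply hα ψ.2 y⟩
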